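/- Let $K\subset\mathbb{R}^3$ be a polyhedral cone with vertex $0$: $K=\{x: 0<|x|<\infty,\ x/|x|\in\Omega\}$, where $\Omega$ is a domain (open, connected, nonempty) in the unit sphere $S^2$, and $\partial K$ consists of the vertex $0$, the edges (half-lines) $M_1,\dots,M_n$ and smooth faces $\Gamma_1,\dots,\Gamma_n$. Near each point of a face $K$ is $C^\infty$-diffeomorphic to a half-space, and near each point of an edge to a dihedron with opening angle in $(0,2\pi)$ whose edge corresponds to $M_j$. Put $S=\{0\}\cup M_1\cup\dots\cup M_n$, $\rho(x)=|x|$, $r_j(x)=\mathrm{dist}(x,M_j)$, $J=\{1,\dots,n\}$, and let $\tilde J\subset J$. Let $l\in\mathbb{N}_0$, $1\le p<\infty$, $\beta\in\mathbb{R}$, $\delta=(\delta_1,\dots,\delta_n)\in\mathbb{R}^n$ with $\delta_j>-2/p$ for $j\in J\setminus\tilde J$. For an open set $D\subset\mathbb{R}^3$ let $\mathcal{W}^{l,p}_{\beta,\delta}(D;\tilde J)$ be the closure of $\{u|_D: u\in C_0^\infty(\mathbb{R}^3\setminus S)\}$ (real-valued functions) with respect to the norm $$\|u|\mathcal{W}^{l,p}_{\beta,\delta}(D;\tilde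 J)\|=\Big(\int_D\sum_{|\alpha|\le l}\rho^{p(\beta-l+|\alpha|)}\prod_{j\in\tilde J}\Big(\frac{r_j}{\rho}\Big)^{p(\delta_j-l+|\alpha|)}\prod_{j\in J\setminus\tilde J}\Big(\frac{r_j}{\rho}\Big)^{p\delta_j}|\partial^\alpha u|^p\,dx\Big)^{1/p}.$$ Theorem. Let $D$ be the cone $K$ or one of the bounded cones $K\cap B(0,R)$, $R>0$. Then there exists a bounded linear extension operator $$\mathfrak{E}:\mathcal{W}^{l,p}_{\beta,\delta}(D;\tilde J)\to\mathcal{W}^{l,p}_{\beta,\delta}(\mathbb{R}^3;\tilde J),$$ that is, a bounded linear operator with $(\mathfrak{E}u)|_D=u$ for all $u\in\mathcal{W}^{l,p}_{\beta,\delta}(D;\tilde J)$. -/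

import Mathlib

open Set MeasureTheory
open scoped ENNReal ContDiff

noncomputable section

/-- Three-dimensional Euclidean space `ℝ³` with the Euclidean norm. -/
abbrev E3 : Type := EuclideanSpace ℝ (Fin 3)

/-- The dihedron of opening angle `θ` around the third coordinate axis:
`{(r cos φ, r sin φ, z) : r > 0, -θ/2 < φ < θ/2, z ∈ ℝ}`. -/
def dihedron (θ : ℝ) : Set E3 :=
  {y | ∃ r φ : ℝ, 0 < r ∧ -(θ / 2) < φ ∧ φ < θ / 2 ∧
    y 0 = r * Real.cos φ ∧ y 1 = r * Real.sin φ}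

/-- A `C^∞` diffeomorphism of an open neighbourhood of `x` onto an open neighbourhood of the
origin that takes `x` to the origin. -/
def IsSmoothChartAt (Φ : OpenPartialHomeomorph E3 E3) (x : E3) : Prop :=
  x ∈ Φ.source ∧ Φ x = 0 ∧ ContDiffOn ℝ ∞ Φ Φ.source ∧ ContDiffOn ℝ ∞ Φ.symm Φ.target

/-- The open half-line from the origin in direction `e`. -/
def openRay (e : E3) : Set E3 := {x | ∃ t : ℝ, 0 < t ∧ x = t • e}

/-- An (infinite) polyhedral cone in `ℝ³` with vertex at the origin, with `n` edges and `n` smooth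
faces. The carrier is a cone over a domain of the unit sphere, its boundary consists of the vertex,
the edges (half-lines) and the faces. Near a point of a face the cone is, up to a smooth
diffeomorphism, a half-space; near a point of an edge it is, up to a smooth diffeomorphism, a
dihedron with an opening angle in `(0, 2π)` (so there are neither cusps nor slits). -/
structure PolyhedralCone (n : ℕ) where
  /-- the cone as a set -/
  carrier : Set E3
  /-- the unit direction vectors of the edges -/
  edgeDir : Fin n → E3
  /-- the faces -/
  face : Fin n → Set E3
  isOpen_carrier : IsOpen carrier
  isConnected_carrier : IsConnected carrier
  zero_notMem_carrier : (0 : E3) ∉ carrier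
  smul_mem_carrier : ∀ x ∈ carrier, ∀ t : ℝ, 0 < t → t • x ∈ carrier
  norm_edgeDir : ∀ j, ‖edgeDir j‖ = 1
  edgeDir_injective : Function.Injective edgeDir
  isConnected_face : ∀ k, IsConnected (face k)
  pairwise_disjoint_face : Pairwise fun k k' => Disjoint (face k) (face k')
  zero_notMem_face : ∀ k, (0 : E3) ∉ face k
  disjoint_edge_face : ∀ j k, Disjoint (openRay (edgeDir j)) (face k)
  frontier_carrier :
    frontier carrier = {0} ∪ (⋃ j, openRay (edgeDir j)) ∪ ⋃ k, face k
  face_chart : ∀ k, ∀ x ∈ face k, ∃ Φ : OpenPartialHomeomorph E3 E3, IsSmoothChartAt Φ x ∧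
    ∀ y ∈ Φ.source, (y ∈ carrier ↔ 0 < Φ y 0) ∧ (y ∈ face k ↔ Φ y 0 = 0)
  edge_chart : ∀ j, ∀ x ∈ openRay (edgeDir j), ∃ θ : ℝ, 0 < θ ∧ θ < 2 * Real.pi ∧
    ∃ Φ : OpenPartialHomeomorph E3 E3, IsSmoothChartAt Φ x ∧
      ∀ y ∈ Φ.source, (y ∈ carrier ↔ Φ y ∈ dihedron θ) ∧
        (y ∈ openRay (edgeDir j) ↔ Φ y 0 = 0 ∧ Φ y 1 = 0)

/-- The `i`-th first order partial derivative. -/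
def partialDeriv (i : Fin 3) (f : E3 → ℝ) : E3 → ℝ :=
  fun x => fderiv ℝ f x (EuclideanSpace.single i 1)

/-- The partial derivative `∂^α f = ∂₀^{α₀} ∂₁^{α₁} ∂₂^{α₂} f` (used for smooth `f` only). -/
def multiDeriv (α : Fin 3 → ℕ) (f : E3 → ℝ) : E3 → ℝ :=
  (partialDeriv 0)^[α 0] ((partialDeriv 1)^[α 1] ((partialDeriv 2)^[α 2] f))

/-- The multi-indices `α ∈ ℕ₀³` with `|α| ≤ l`. -/
abbrev MultiIdx (l : ℕ) : Type := {α : Fin 3 → Fin (l + 1) // ∑ i, (α i : ℕ) ≤ l}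

namespace MultiIdx

/-- The multi-index as an element of `ℕ₀³`. -/
def toNat {l : ℕ} (α : MultiIdx l) : Fin 3 → ℕ := fun i => (α.1 i : ℕ)

/-- The order `|α|`. -/
def order {l : ℕ} (α : MultiIdx l) : ℕ := ∑ i, α.toNat i

end MultiIdx

lemma contDiff_partialDeriv {f : E3 → ℝ} (hf : ContDiff ℝ ∞ f) (i : Fin 3) :
    ContDiff ℝ ∞ (partialDeriv i f) :=
  (hf.fderiv_right (m := ∞) (by simp)).clm_apply contDiff_const

lemma contDiff_iterate_partialDeriv {f : E3 → ℝ} (hf : ContDiff ℝ ∞ f) (i : Fin 3) (k : ℕ) :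
    ContDiff ℝ ∞ ((partialDeriv i)^[k] f) := by
  induction k with
  | zero => exact hf
  | succ k ih => rw [Function.iterate_succ_apply']; exact contDiff_partialDeriv ih i

lemma iterate_partialDeriv_lin {f g : E3 → ℝ} (hf : ContDiff ℝ ∞ f) (hg : ContDiff ℝ ∞ g)
    (c : ℝ) (i : Fin 3) (k : ℕ) :
    (partialDeriv i)^[k] (f + c • g) = (partialDeriv i)^[k] f + c • (partialDeriv i)^[k] g := by
  induction k with
  | zero => rfl
  | succ k ih =>
    simp only [Function.iterate_succ_apply', ih]
    have h1 := (contDiff_iterate_partialDeriv hf i k).differentiable (by simp)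
    have h2 := (contDiff_iterate_partialDeriv hg i k).differentiable (by simp)
    funext x
    simp only [partialDeriv, Pi.add_apply, Pi.smul_apply]
    rw [fderiv_add (h1 x) ((h2 x).const_smul c), fderiv_const_smul (h2 x)]
    simp

lemma multiDeriv_lin {f g : E3 → ℝ} (hf : ContDiff ℝ ∞ f) (hg : ContDiff ℝ ∞ g)
    (c : ℝ) (α : Fin 3 → ℕ) :
    multiDeriv α (f + c • g) = multiDeriv α f + c • multiDeriv α g := by
  have h2 {h : E3 → ℝ} (hh : ContDiff ℝ ∞ h) := contDiff_iterate_partialDeriv hh 2 (α 2)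
  have h1 {h : E3 → ℝ} (hh : ContDiff ℝ ∞ h) := contDiff_iterate_partialDeriv (h2 hh) 1 (α 1)
  simp only [multiDeriv]
  rw [iterate_partialDeriv_lin hf hg, iterate_partialDeriv_lin (h2 hf) (h2 hg),
    iterate_partialDeriv_lin (h1 hf) (h1 hg)]

namespace PolyhedralCone

variable {n : ℕ} (K : PolyhedralCone n)

/-- The `j`-th edge `M_j`, an open half-line. -/
def edge (j : Fin n) : Set E3 := openRay (K.edgeDir j)

/-- The singular set `S = {0} ∪ M_1 ∪ … ∪ M_n`. -/
def singularSet : Set E3 := {0} ∪ ⋃ j, K.edge j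

/-- The distance `ρ(x)` to the vertex. -/
def rho (_K : PolyhedralCone n) (x : E3) : ℝ := dist x 0

/-- The distance `r_j(x)` to the edge `M_j`. -/
def r (j : Fin n) (x : E3) : ℝ := Metric.infDist x (K.edge j)

/-- The weight (a power of exponent `p` included) in front of `|∂^α u|^p` in the norm, for
derivatives of order `m = |α|`. -/
def weight (J : Finset (Fin n)) (l : ℕ) (p β : ℝ) (δ : Fin n → ℝ) (m : ℕ) (x : E3) : ℝ :=
  K.rho x ^ (p * (β - l + m)) *
    (∏ j ∈ J, (K.r j x / K.rho x) ^ (p * (δ j - l + m))) *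
    ∏ j ∈ Jᶜ, (K.r j x / K.rho x) ^ (p * δ j)

/-- The weighted Lebesgue measure on `D` belonging to derivatives of order `m`. -/
def weightedMeasure (D : Set E3) (J : Finset (Fin n)) (l : ℕ) (p : ℝ≥0∞) (β : ℝ)
    (δ : Fin n → ℝ) (m : ℕ) : Measure E3 :=
  (volume.restrict D).withDensity
    fun x => ENNReal.ofReal (K.weight J l p.toReal β δ m x)

/-- Families `(u_α)_{|α| ≤ l}` of (classes of) functions on `D` with finite norm
`(∑_{|α| ≤ l} ∫_D weight_{|α|} |u_α|^p dx)^{1/p}`. -/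
abbrev JetSpace (D : Set E3) (J : Finset (Fin n)) (l : ℕ) (p : ℝ≥0∞) (β : ℝ)
    (δ : Fin n → ℝ) : Type :=
  PiLp p fun α : MultiIdx l => Lp ℝ p (K.weightedMeasure D J l p β δ α.order)

/-- The set `C_*^∞(D, S)` of restrictions to `D` of functions in `C_0^∞(ℝ³ \ S)`, every function
being represented by the family of its derivatives of order at most `l`, so that the norm induced
from `JetSpace` is the weighted Sobolev norm. -/
def testJets (D : Set E3) (J : Finset (Fin n)) (l : ℕ) (p : ℝ≥0∞) [Fact (1 ≤ p)] (β : ℝ)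
    (δ : Fin n → ℝ) : Submodule ℝ (K.JetSpace D J l p β δ) where
  carrier := {U | ∃ φ : E3 → ℝ, ContDiff ℝ ∞ φ ∧ HasCompactSupport φ ∧
    Disjoint (tsupport φ) K.singularSet ∧
    ∀ α : MultiIdx l,
      (U α : E3 → ℝ) =ᵐ[K.weightedMeasure D J l p β δ α.order] multiDeriv α.toNat φ}
  zero_mem' := by
    refine ⟨0, contDiff_const, HasCompactSupport.zero, by simp, fun α => ?_⟩
    have h : multiDeriv α.toNat (0 : E3 → ℝ) = 0 := by
      have := multiDeriv_lin (f := 0) (g := 0) contDiff_const contDiff_const 1 α.toNat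
      simpa using this
    rw [h]
    exact Lp.coeFn_zero _ _ _
  add_mem' := by
    rintro U V ⟨φ, hφ, cφ, dφ, eφ⟩ ⟨ψ, hψ, cψ, dψ, eψ⟩
    refine ⟨φ + ψ, hφ.add hψ, cφ.add cψ,
      (dφ.union_left dψ).mono_left (tsupport_add φ ψ), fun α => ?_⟩
    have h := multiDeriv_lin hφ hψ 1 α.toNat
    rw [one_smul, one_smul] at h
    rw [h]
    exact (Lp.coeFn_add (U α) (V α)).trans ((eφ α).add (eψ α))
  smul_mem' := by
    rintro c U ⟨φ, hφ, cφ, dφ, eφ⟩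
    refine ⟨c • φ, contDiff_const.smul hφ, cφ.smul_left (f := fun _ => c),
      dφ.mono_left (closure_mono (Function.support_const_smul_subset c φ)), fun α => ?_⟩
    have h0 : multiDeriv α.toNat (0 : E3 → ℝ) = 0 := by
      have := multiDeriv_lin (f := 0) (g := 0) contDiff_const contDiff_const 1 α.toNat
      simpa using this
    have h := multiDeriv_lin (f := 0) (g := φ) contDiff_const hφ c α.toNat
    rw [zero_add, h0, zero_add] at h
    rw [h]
    exact (Lp.coeFn_smul c (U α)).trans ((eφ α).const_smul c)

/-- The weighted Sobolev space `𝒲^{l,p}_{β,δ}(D; J)`: the closure of `C_*^∞(D, S)` in the weighted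
Sobolev norm. An element `u` is represented by the family of its (weak) derivatives of order at
most `l`, which is determined by the member of order `0`, the function `u` itself. -/
def W (D : Set E3) (J : Finset (Fin n)) (l : ℕ) (p : ℝ≥0∞) [Fact (1 ≤ p)] (β : ℝ)
    (δ : Fin n → ℝ) : Submodule ℝ (K.JetSpace D J l p β δ) :=
  (K.testJets D J l p β δ).topologicalClosure

end PolyhedralCone

end

/-!
The extension operator is built from reflections of finite order. On functions of class `C^l` with
compact support away from the vertex and the edges ("admissible" functions, `IsAdm`) a linear
operator is constructed that is bounded in the weighted Sobolev norm; mollification and density then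
carry it over to the weighted Sobolev space.

**Model corners.** Hestenes' reflection across a hyperplane takes `v` to `∑ c_k v(A_k ·)`, where
`A_k` multiplies the normal coordinate by `-(k+1)` and the `c_k` are chosen such that the moments of
order at most `l` match. The defect operator `N`, which is `v` minus its reflection on the negative
side and zero on the positive side, then preserves `C^l` (`contDiff_ite_sum_scaleAlong`). With the
defect operators `N₀`, `N₁` of the first two coordinates, `1 - N₀` extends from the half-space
`z₀ > 0`, `(1 - N₁)(1 - N₀)` from the intersection of two half-spaces, and `1 - N₁ N₀` from their
union (`CornerType.ext`). A dihedron of angle less than `π` is linearly equivalent to an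
intersection, one of angle larger than `π` to a union, one of angle `π` is a
half-space. Thus every boundary point of the cone other than the vertex has a chart onto a model
corner (`IsCornerChart`).

**Weights.** The maps `A_k`, seen through a chart, change the distance to the vertex and the
distances to the edges by bounded factors only: in a chart around a point of an edge `M_j` the
distance `r_j` is comparable to `|z₀| + |z₁|` (`IsCornerChart.exists_r_le`). Hence all weights, with
whatever exponents, change by bounded factors, and the bounds follow from the chain rule and a
change of variables, without a Hardy inequality (`LocalExt.exists_energy_le`).

**Gluing.** A partition of unity gives an operator on a spherical shell (`exists_shell_operator`).
The weights are homogeneous, so the operators at the scales `2^k` obey the same bound; as the shells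
overlap boundedly, their sum is a bounded extension operator for the infinite cone
(`hasExtension_carrier`). A bounded cone is first extended to the infinite cone by a reflection in
the variable `log (|x| / R)` (`hasExtension_carrier_inter_ball`); it moves points along rays by
bounded factors.

**Density.** The extension of a test function is only of class `C^l`, but it belongs to the weighted
Sobolev space since it is the limit of its mollifications (`IsAdm.jet_mem_W`). The operator extends
by density, and agreeing with `u` on `D` is a closed condition
(`HasExtension.exists_continuousLinearMap`).
-/

noncomputable section

/-! ### Partial derivatives and iterated Fréchet derivatives -/

/-- The iterated partial derivative `∂_{i₁} ⋯ ∂_{i_m} f` along the word `[i₁, …, i_m]`. -/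
def wordDeriv (L : List (Fin 3)) (f : E3 → ℝ) : E3 → ℝ := L.foldr partialDeriv f

lemma wordDeriv_cons (i : Fin 3) (L : List (Fin 3)) (f : E3 → ℝ) :
    wordDeriv (i :: L) f = partialDeriv i (wordDeriv L f) := rfl

lemma ContDiff.partialDeriv_nat {k : ℕ} {f : E3 → ℝ} (hf : ContDiff ℝ (k + 1 : ℕ) f) (i : Fin 3) :
    ContDiff ℝ k (partialDeriv i f) :=
  (hf.fderiv_right (m := k) (by norm_cast)).clm_apply contDiff_const

lemma ContDiff.wordDeriv_nat {L : List (Fin 3)} {k : ℕ} {f : E3 → ℝ}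
    (hf : ContDiff ℝ (k + L.length : ℕ) f) : ContDiff ℝ k (wordDeriv L f) := by
  induction L generalizing k with
  | nil => simpa [wordDeriv] using hf
  | cons i L ih =>
    rw [wordDeriv_cons]
    exact (ih (k := k + 1) (by convert hf using 2; simp; ring)).partialDeriv_nat i

lemma partialDeriv_comm {f : E3 → ℝ} (hf : ContDiff ℝ 2 f) (i j : Fin 3) :
    partialDeriv i (partialDeriv j f) = partialDeriv j (partialDeriv i f) := by
  have hd : Differentiable ℝ (fderiv ℝ f) :=
    (hf.fderiv_right (m := 1) (by norm_num)).differentiable (by norm_num)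
  have key : ∀ a b : Fin 3, ∀ x, partialDeriv a (partialDeriv b f) x =
      fderiv ℝ (fderiv ℝ f) x (EuclideanSpace.single a 1) (EuclideanSpace.single b 1) := by
    intro a b x
    have hb : partialDeriv b f = fun y => fderiv ℝ f y (EuclideanSpace.single b 1) := rfl
    rw [partialDeriv, hb, fderiv_clm_apply (hd x) (differentiableAt_const _)]
    simp
  funext x
  rw [key, key]
  exact (hf.contDiffAt.isSymmSndFDerivAt (by simp)).eq _ _

lemma wordDeriv_perm {L L' : List (Fin 3)} (h : L.Perm L') {f : E3 → ℝ}
    (hf : ContDiff ℝ L.length f) : wordDeriv L f = wordDeriv L' f := by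
  induction h with
  | nil => rfl
  | cons i h ih =>
    rw [wordDeriv_cons, wordDeriv_cons, ih (hf.of_le (by simp))]
  | swap i j L =>
    simp only [wordDeriv_cons]
    exact partialDeriv_comm
      (ContDiff.wordDeriv_nat (k := 2) (by convert hf using 2; simp; ring)) _ _
  | trans h1 h2 ih1 ih2 =>
    rw [ih1 hf, ih2 (by rwa [h1.length_eq] at hf)]

lemma multiDeriv_eq_wordDeriv (α : Fin 3 → ℕ) (f : E3 → ℝ) :
    multiDeriv α f = wordDeriv (List.replicate (α 0) 0 ++
      (List.replicate (α 1) 1 ++ List.replicate (α 2) 2)) f := by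
  have h : ∀ (k : ℕ) (i : Fin 3) (g : E3 → ℝ),
      (List.replicate k i).foldr partialDeriv g = (partialDeriv i)^[k] g := by
    intro k i g
    induction k with
    | zero => rfl
    | succ k ih => rw [List.replicate_succ, List.foldr_cons, ih, Function.iterate_succ_apply']
  simp only [multiDeriv, wordDeriv, List.foldr_append, h]

lemma iteratedFDeriv_apply_single {m : ℕ} {f : E3 → ℝ} (hf : ContDiff ℝ m f) (w : Fin m → Fin 3)
    (x : E3) : iteratedFDeriv ℝ m f x (fun j => EuclideanSpace.single (w j) 1) =
      wordDeriv (List.ofFn w) f x := by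
  induction m generalizing x with
  | zero => simp [wordDeriv]
  | succ m ih =>
    have hd : Differentiable ℝ (iteratedFDeriv ℝ m f) :=
      hf.differentiable_iteratedFDeriv (by norm_cast; omega)
    rw [iteratedFDeriv_succ_apply_left, List.ofFn_succ, wordDeriv_cons]
    have ih' : wordDeriv (List.ofFn fun i => w (Fin.succ i)) f =
        fun y => iteratedFDeriv ℝ m f y (fun j => EuclideanSpace.single (w j.succ) 1) := by
      funext y
      exact (ih (hf.of_le (by norm_cast; omega)) (fun j => w j.succ) y).symm
    rw [ih', partialDeriv]
    have := ((ContinuousMultilinearMap.apply ℝ (fun _ : Fin m => E3) ℝ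
      (fun j => EuclideanSpace.single (w j.succ) 1)).hasFDerivAt.comp x (hd x).hasFDerivAt).fderiv
    erw [this]
    rfl

lemma contDiff_multiDeriv_nat {k : ℕ} {f : E3 → ℝ} (α : Fin 3 → ℕ)
    (hf : ContDiff ℝ (k + ∑ i, α i : ℕ) f) : ContDiff ℝ k (multiDeriv α f) := by
  rw [multiDeriv_eq_wordDeriv]
  refine ContDiff.wordDeriv_nat ?_
  convert hf using 2
  simp [Fin.sum_univ_three]; ring

lemma abs_multiDeriv_le {f : E3 → ℝ} (α : Fin 3 → ℕ) {m : ℕ} (hm : ∑ i, α i = m)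
    (hf : ContDiff ℝ m f) (x : E3) :
    ‖multiDeriv α f x‖ ≤ ‖iteratedFDeriv ℝ m f x‖ := by
  set L := List.replicate (α 0) (0 : Fin 3) ++
      (List.replicate (α 1) 1 ++ List.replicate (α 2) 2) with hL
  have hlen : L.length = m := by rw [← hm]; simp [hL, Fin.sum_univ_three]; ring
  subst hlen
  have h := iteratedFDeriv_apply_single hf L.get x
  rw [List.ofFn_get] at h
  rw [multiDeriv_eq_wordDeriv, ← hL, ← h]
  refine (ContinuousMultilinearMap.le_opNorm _ _).trans ?_
  simp

/-- The multi-index that counts the letters of a word. -/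
def MultiIdx.ofWord {l m : ℕ} (hm : m ≤ l) (w : Fin m → Fin 3) : MultiIdx l :=
  ⟨fun i => ⟨(List.ofFn w).count i, by
      have := (List.ofFn w).count_le_length (a := i); simp at this; omega⟩, by
    have : ∀ L : List (Fin 3), L.count 0 + L.count 1 + L.count 2 = L.length := by
      intro L
      induction L with
      | nil => rfl
      | cons a L ih => fin_cases a <;> simp <;> omega
    have h := this (List.ofFn w)
    simp only [Fin.sum_univ_three]
    simp at h
    omega⟩

lemma MultiIdx.order_ofWord {l m : ℕ} (hm : m ≤ l) (w : Fin m → Fin 3) :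
    (MultiIdx.ofWord hm w).order = m := by
  have : ∀ L : List (Fin 3), L.count 0 + L.count 1 + L.count 2 = L.length := by
    intro L
    induction L with
    | nil => rfl
    | cons a L ih => fin_cases a <;> simp <;> omega
  have h := this (List.ofFn w)
  simp only [MultiIdx.order, Fin.sum_univ_three, MultiIdx.toNat, MultiIdx.ofWord]
  simpa using h

lemma wordDeriv_ofFn_eq_multiDeriv {l m : ℕ} (hm : m ≤ l) (w : Fin m → Fin 3) {f : E3 → ℝ}
    (hf : ContDiff ℝ m f) :
    wordDeriv (List.ofFn w) f = multiDeriv (MultiIdx.ofWord hm w).toNat f := by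
  rw [multiDeriv_eq_wordDeriv]
  refine wordDeriv_perm ?_ (by simpa using hf)
  rw [List.perm_iff_count]
  intro a
  simp only [List.count_append, MultiIdx.toNat, MultiIdx.ofWord, List.count_replicate]
  fin_cases a <;> simp

/-- The full derivative of order `m` is controlled by the partial derivatives of order `m`. -/
lemma norm_iteratedFDeriv_le_sum_multiDeriv {l m : ℕ} (hm : m ≤ l) {f : E3 → ℝ}
    (hf : ContDiff ℝ m f) (x : E3) :
    ‖iteratedFDeriv ℝ m f x‖ ≤
      ∑ w : Fin m → Fin 3, ‖multiDeriv (MultiIdx.ofWord hm w).toNat f x‖ := by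
  refine ContinuousMultilinearMap.opNorm_le_bound (Finset.sum_nonneg fun _ _ => norm_nonneg _) ?_
  intro v
  have hv : v = fun j => ∑ i : Fin 3, (v j i) • (EuclideanSpace.single i (1 : ℝ) : E3) := by
    funext j
    ext k
    simp [Fin.sum_univ_three]
    fin_cases k <;> simp
  have hexp : iteratedFDeriv ℝ m f x v = ∑ w : Fin m → Fin 3, (∏ j, v j (w j)) *
      multiDeriv (MultiIdx.ofWord hm w).toNat f x := by
    conv_lhs => rw [hv]
    rw [ContinuousMultilinearMap.map_sum]
    refine Finset.sum_congr rfl fun w _ => ?_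
    rw [ContinuousMultilinearMap.map_smul_univ, smul_eq_mul, iteratedFDeriv_apply_single hf,
      wordDeriv_ofFn_eq_multiDeriv hm w hf]
  rw [hexp, Finset.sum_mul]
  refine (norm_sum_le _ _).trans (Finset.sum_le_sum fun w _ => ?_)
  rw [norm_mul, mul_comm, norm_prod]
  gcongr with j
  exact PiLp.norm_apply_le (v j) (w j)

lemma partialDeriv_lin_nat {f g : E3 → ℝ} (hf : ContDiff ℝ 1 f) (hg : ContDiff ℝ 1 g)
    (c : ℝ) (i : Fin 3) :
    partialDeriv i (f + c • g) = partialDeriv i f + c • partialDeriv i g := by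
  have h1 := hf.differentiable (by simp)
  have h2 := hg.differentiable (by simp)
  funext x
  simp only [partialDeriv, Pi.add_apply, Pi.smul_apply]
  rw [fderiv_add (h1 x) ((h2 x).const_smul c), fderiv_const_smul (h2 x)]
  simp

lemma wordDeriv_lin {L : List (Fin 3)} {f g : E3 → ℝ} (hf : ContDiff ℝ L.length f)
    (hg : ContDiff ℝ L.length g) (c : ℝ) :
    wordDeriv L (f + c • g) = wordDeriv L f + c • wordDeriv L g := by
  induction L with
  | nil => rfl
  | cons i L ih =>
    rw [wordDeriv_cons, ih (hf.of_le (by simp)) (hg.of_le (by simp)), partialDeriv_lin_nat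
      (ContDiff.wordDeriv_nat (k := 1) (by convert hf using 2; simp; ring))
      (ContDiff.wordDeriv_nat (k := 1) (by convert hg using 2; simp; ring))]
    rfl

lemma multiDeriv_lin_nat {f g : E3 → ℝ} (α : Fin 3 → ℕ) (hf : ContDiff ℝ (∑ i, α i : ℕ) f)
    (hg : ContDiff ℝ (∑ i, α i : ℕ) g) (c : ℝ) :
    multiDeriv α (f + c • g) = multiDeriv α f + c • multiDeriv α g := by
  simp only [multiDeriv_eq_wordDeriv]
  refine wordDeriv_lin ?_ ?_ c
  · convert hf using 2; simp [Fin.sum_univ_three]; ring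
  · convert hg using 2; simp [Fin.sum_univ_three]; ring

/-! ### Distances to the edges and the weights -/

/-- For `a, b ≥ 0` that are comparable, powers are comparable, whatever the sign of the exponent.
The junk values `0 ^ t` do no harm because `a` and `b` vanish simultaneously. -/
lemma Real.rpow_le_of_comparable {a b A t : ℝ} (ha : 0 ≤ a) (hb : 0 ≤ b) (hA : 1 ≤ A)
    (hab : a ≤ A * b) (hba : b ≤ A * a) : a ^ t ≤ A ^ |t| * b ^ t := by
  have hA0 : 0 ≤ A := by linarith
  rcases le_total 0 t with ht | ht
  · rw [abs_of_nonneg ht, ← Real.mul_rpow hA0 hb]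
    exact Real.rpow_le_rpow ha hab ht
  · rcases ha.eq_or_lt with rfl | ha'
    · have : b = 0 := by simp at hba; linarith
      subst this
      exact le_mul_of_one_le_left (Real.rpow_nonneg le_rfl _)
        (Real.one_le_rpow hA (abs_nonneg _))
    · have hb' : 0 < b := by nlinarith
      have h := Real.rpow_le_rpow_of_nonpos hb' hba ht
      rw [Real.mul_rpow hA0 ha] at h
      rw [abs_of_nonpos ht, Real.rpow_neg hA0]
      have hAt : 0 < A ^ t := Real.rpow_pos_of_pos (by linarith) _
      rw [inv_mul_eq_div, le_div_iff₀ hAt]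
      linarith

namespace PolyhedralCone

variable {n : ℕ} (K : PolyhedralCone n)

lemma edge_nonempty (j : Fin n) : (K.edge j).Nonempty := ⟨K.edgeDir j, 1, one_pos, by simp⟩

lemma rho_eq_norm (x : E3) : K.rho x = ‖x‖ := by simp [rho]

lemma continuous_rho : Continuous K.rho := by
  simpa only [funext K.rho_eq_norm] using continuous_norm

lemma continuous_r (j : Fin n) : Continuous (K.r j) := Metric.continuous_infDist_pt _

lemma rho_nonneg (x : E3) : 0 ≤ K.rho x := dist_nonneg

lemma r_nonneg (j : Fin n) (x : E3) : 0 ≤ K.r j x := Metric.infDist_nonneg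

lemma rho_smul {t : ℝ} (ht : 0 < t) (x : E3) : K.rho (t • x) = t * K.rho x := by
  simp [rho_eq_norm, norm_smul, abs_of_pos ht]

open scoped Pointwise in
lemma smul_edge {t : ℝ} (ht : 0 < t) (j : Fin n) : t • K.edge j = K.edge j := by
  ext x
  rw [Set.mem_smul_set]
  constructor
  · rintro ⟨_, ⟨s, hs, rfl⟩, rfl⟩
    exact ⟨t * s, mul_pos ht hs, by rw [smul_smul]⟩
  · rintro ⟨s, hs, rfl⟩
    exact ⟨(t⁻¹ * s) • K.edgeDir j, ⟨t⁻¹ * s, by positivity, rfl⟩, by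
      rw [smul_smul]; congr 1; field_simp⟩

open scoped Pointwise in
lemma r_smul {t : ℝ} (ht : 0 < t) (j : Fin n) (x : E3) : K.r j (t • x) = t * K.r j x := by
  have h := infDist_smul₀ ht.ne' (K.edge j) x
  rw [K.smul_edge ht] at h
  rw [r, h, Real.norm_of_nonneg ht.le, r]

lemma r_le_dist (j : Fin n) {x y : E3} (hy : y ∈ K.edge j) : K.r j x ≤ dist x y :=
  Metric.infDist_le_dist_of_mem hy

lemma r_eq_zero_of_mem_edge {j : Fin n} {x : E3} (hx : x ∈ K.edge j) : K.r j x = 0 :=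
  Metric.infDist_zero_of_mem hx

lemma r_le_rho (j : Fin n) (x : E3) : K.r j x ≤ K.rho x := by
  refine le_of_forall_pos_le_add fun ε hε => ?_
  refine (K.r_le_dist j (y := ε • K.edgeDir j) ⟨ε, hε, rfl⟩).trans ?_
  have := dist_triangle x 0 (ε • K.edgeDir j)
  have h2 : dist (0 : E3) (ε • K.edgeDir j) = ε := by
    simp [norm_smul, K.norm_edgeDir, abs_of_pos hε]
  rw [h2] at this
  exact this

lemma edge_union_zero (j : Fin n) : {0} ∪ K.edge j = {x : E3 | ‖x‖ • K.edgeDir j = x} := by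
  ext x
  constructor
  · rintro (rfl | ⟨t, ht, rfl⟩)
    · simp
    · simp [norm_smul, K.norm_edgeDir, abs_of_pos ht]
  · intro hx
    rcases eq_or_ne x 0 with rfl | h0
    · exact Or.inl rfl
    · exact Or.inr ⟨‖x‖, norm_pos_iff.2 h0, hx.symm⟩

lemma isClosed_edge_union_zero (j : Fin n) : IsClosed ({0} ∪ K.edge j) := by
  rw [edge_union_zero]
  exact isClosed_eq (by fun_prop) continuous_id

lemma isClosed_singularSet : IsClosed K.singularSet := by
  have h : K.singularSet = {0} ∪ ⋃ j, ({0} ∪ K.edge j) := by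
    ext x
    simp only [singularSet, mem_union, mem_iUnion, mem_singleton_iff, exists_or]
    tauto
  rw [h]
  exact isClosed_singleton.union (isClosed_iUnion_of_finite fun j => K.isClosed_edge_union_zero j)

lemma zero_mem_singularSet : (0 : E3) ∈ K.singularSet := Or.inl rfl

lemma edge_subset_singularSet (j : Fin n) : K.edge j ⊆ K.singularSet :=
  (subset_iUnion _ j).trans subset_union_right

lemma rho_pos_of_ne {x : E3} (hx : x ≠ 0) : 0 < K.rho x := by
  rw [rho_eq_norm]; exact norm_pos_iff.2 hx

lemma r_pos_of_notMem {j : Fin n} {x : E3} (h0 : x ≠ 0) (hx : x ∉ K.edge j) : 0 < K.r j x := by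
  refine (K.r_nonneg j x).lt_of_ne' fun h => ?_
  have h1 : x ∈ closure (K.edge j) := (Metric.mem_closure_iff_infDist_zero (K.edge_nonempty j)).2 h
  have h2 := closure_minimal (subset_union_right (s := {0})) (K.isClosed_edge_union_zero j) h1
  rcases h2 with h2 | h2
  · exact h0 h2
  · exact hx h2

lemma r_pos {j : Fin n} {x : E3} (hx : x ∉ K.singularSet) : 0 < K.r j x :=
  K.r_pos_of_notMem (fun h => hx (h ▸ K.zero_mem_singularSet))
    fun h => hx (K.edge_subset_singularSet j h)

lemma rho_pos {x : E3} (hx : x ∉ K.singularSet) : 0 < K.rho x :=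
  K.rho_pos_of_ne fun h => hx (h ▸ K.zero_mem_singularSet)

lemma volume_singularSet : volume K.singularSet = 0 := by
  refine measure_union_null (by simp) (measure_iUnion_null fun j => ?_)
  refine measure_mono_null (t := (Submodule.span ℝ {K.edgeDir j} : Set E3)) ?_
    (Measure.addHaar_submodule _ _ ?_)
  · rintro _ ⟨t, -, rfl⟩
    exact Submodule.smul_mem _ _ (Submodule.mem_span_singleton_self _)
  · intro h
    have h1 := finrank_span_singleton (K := ℝ) (v := K.edgeDir j)
      (by rw [← norm_pos_iff, K.norm_edgeDir]; norm_num)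
    rw [h, finrank_top] at h1
    simp at h1

lemma ae_notMem_singularSet : ∀ᵐ x : E3, x ∉ K.singularSet :=
  compl_mem_ae_iff.2 K.volume_singularSet

/-- Two points are comparable with constant `B` if their distances to the vertex and to the edges
are the same up to the factor `B`. -/
def Comparable (B : ℝ) (x y : E3) : Prop :=
  (K.rho x ≤ B * K.rho y ∧ K.rho y ≤ B * K.rho x) ∧
    ∀ j, K.r j x ≤ B * K.r j y ∧ K.r j y ≤ B * K.r j x

lemma Comparable.smul {B : ℝ} {x y : E3} (h : K.Comparable B x y) {t : ℝ} (ht : 0 < t) :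
    K.Comparable B (t • x) (t • y) := by
  refine ⟨?_, fun j => ?_⟩
  · rw [K.rho_smul ht, K.rho_smul ht]
    exact ⟨by nlinarith [h.1.1], by nlinarith [h.1.2]⟩
  · rw [K.r_smul ht, K.r_smul ht]
    exact ⟨by nlinarith [(h.2 j).1], by nlinarith [(h.2 j).2]⟩

lemma Comparable.mono {B B' : ℝ} {x y : E3} (h : K.Comparable B x y) (hB : B ≤ B') :
    K.Comparable B' x y := by
  have h1 := K.rho_nonneg x
  have h2 := K.rho_nonneg y
  refine ⟨⟨by nlinarith [h.1.1], by nlinarith [h.1.2]⟩, fun j => ?_⟩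
  have h3 := K.r_nonneg j x
  have h4 := K.r_nonneg j y
  exact ⟨by nlinarith [(h.2 j).1], by nlinarith [(h.2 j).2]⟩

lemma Comparable.refl {B : ℝ} (hB : 1 ≤ B) (x : E3) : K.Comparable B x x := by
  have h1 := K.rho_nonneg x
  refine ⟨⟨by nlinarith, by nlinarith⟩, fun j => ?_⟩
  have h3 := K.r_nonneg j x
  exact ⟨by nlinarith, by nlinarith⟩

section Weight

variable (J : Finset (Fin n)) (l : ℕ) (q β : ℝ) (δ : Fin n → ℝ)

lemma weight_nonneg (m : ℕ) (x : E3) : 0 ≤ K.weight J l q β δ m x := by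
  have h1 := K.rho_nonneg x
  have h2 := fun j => div_nonneg (K.r_nonneg j x) h1
  refine mul_nonneg (mul_nonneg (Real.rpow_nonneg h1 _) (Finset.prod_nonneg fun j _ => ?_))
    (Finset.prod_nonneg fun j _ => ?_) <;> exact Real.rpow_nonneg (h2 j) _

lemma weight_pos (m : ℕ) {x : E3} (hx : x ∉ K.singularSet) : 0 < K.weight J l q β δ m x := by
  have h1 := K.rho_pos hx
  have h2 := fun j => div_pos (K.r_pos (j := j) hx) h1
  refine mul_pos (mul_pos (Real.rpow_pos_of_pos h1 _) (Finset.prod_pos fun j _ => ?_))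
    (Finset.prod_pos fun j _ => ?_) <;> exact Real.rpow_pos_of_pos (h2 j) _

lemma measurable_weight (m : ℕ) : Measurable (K.weight J l q β δ m) := by
  have h1 := K.continuous_rho.measurable
  have h2 := fun j => (K.continuous_r j).measurable
  unfold weight
  refine ((h1.pow_const _).mul (Finset.measurable_prod _ fun j _ => ?_)).mul
    (Finset.measurable_prod _ fun j _ => ?_) <;>
  exact ((h2 j).div h1).pow_const _

lemma continuousOn_weight (m : ℕ) : ContinuousOn (K.weight J l q β δ m) K.singularSetᶜ := by
  have h1 : ContinuousOn K.rho K.singularSetᶜ := K.continuous_rho.continuousOn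
  have h2 := fun j => (K.continuous_r j).continuousOn (s := K.singularSetᶜ)
  have h3 : ∀ j, ContinuousOn (fun x => K.r j x / K.rho x) K.singularSetᶜ :=
    fun j => (h2 j).div h1 fun x hx => (K.rho_pos hx).ne'
  have h4 : ∀ j x, x ∈ K.singularSetᶜ → K.r j x / K.rho x ≠ 0 := fun j x hx =>
    (div_pos (K.r_pos hx) (K.rho_pos hx)).ne'
  unfold weight
  refine ((h1.rpow_const fun x hx => Or.inl (K.rho_pos hx).ne').mul
    (continuousOn_finsetProd _ fun j _ => ?_)).mul (continuousOn_finsetProd _ fun j _ => ?_) <;>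
  exact (h3 j).rpow_const fun x hx => Or.inl (h4 j x hx)

/-- The weight in terms of the lower order weight: raising the order by `k` multiplies it by
`ρ ^ (q k) ∏ (r_j / ρ) ^ (q k)`. -/
lemma weight_add (m k : ℕ) {x : E3} (hx : x ∉ K.singularSet) :
    K.weight J l q β δ (m + k) x = (K.rho x ^ (q * k) * ∏ j ∈ J, (K.r j x / K.rho x) ^ (q * k)) *
      K.weight J l q β δ m x := by
  have h1 := K.rho_pos hx
  have h2 := fun j => div_pos (K.r_pos (j := j) hx) h1
  have e1 : ∀ (a s : ℝ), 0 < a → a ^ (q * (s - l + (m + k : ℕ))) =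
      a ^ (q * k) * a ^ (q * (s - l + m)) := by
    intro a s ha
    rw [← Real.rpow_add ha]; push_cast; ring_nf
  simp only [weight]
  rw [e1 _ _ h1, Finset.prod_congr rfl fun j _ => e1 _ _ (h2 j), Finset.prod_mul_distrib]
  ring

/-- On bounded sets the weights decrease with the order up to a constant, since `r_j ≤ ρ`. Hence the
lower order terms that the product and chain rules produce are harmless. -/
lemma weight_mono_order (hq : 0 ≤ q) {i m : ℕ} (him : i ≤ m) (hm : m ≤ l) {x : E3} {B : ℝ}
    (hB : 1 ≤ B) (hx : x ∉ K.singularSet) (hρ : K.rho x ≤ B) :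
    K.weight J l q β δ m x ≤ B ^ (q * l) * K.weight J l q β δ i x := by
  obtain ⟨k, rfl⟩ := Nat.exists_eq_add_of_le him
  rw [K.weight_add J l q β δ i k hx]
  have h1 := K.rho_pos hx
  have h2 := fun j => div_pos (K.r_pos (j := j) hx) h1
  have hk : 0 ≤ q * k := by positivity
  refine mul_le_mul_of_nonneg_right ?_ (K.weight_nonneg _ _ _ _ _ _ _)
  calc _ ≤ B ^ (q * k) * 1 := by
        refine mul_le_mul (Real.rpow_le_rpow h1.le hρ hk) ?_
          (Finset.prod_nonneg fun j _ => Real.rpow_nonneg (h2 j).le _)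
          (Real.rpow_nonneg (by linarith) _)
        refine Finset.prod_le_one (fun j _ => Real.rpow_nonneg (h2 j).le _) fun j _ => ?_
        exact Real.rpow_le_one (h2 j).le ((div_le_one h1).2 (K.r_le_rho j x)) hk
    _ ≤ B ^ (q * l) := by
        rw [mul_one]
        refine Real.rpow_le_rpow_of_exponent_le hB (mul_le_mul_of_nonneg_left ?_ hq)
        exact_mod_cast (by omega : k ≤ l)

/-- The weights at comparable points are comparable, whatever the signs of the exponents. -/
lemma exists_weight_le_of_comparable {B : ℝ} (hB : 1 ≤ B) (m : ℕ) : ∃ C : ℝ, 0 ≤ C ∧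
    ∀ x y, K.Comparable B x y → K.weight J l q β δ m x ≤ C * K.weight J l q β δ m y := by
  have hB0 : 0 ≤ B := by linarith
  have hB2 : 1 ≤ B * B := by nlinarith
  refine ⟨B ^ |q * (β - l + m)| * (∏ j ∈ J, (B * B) ^ |q * (δ j - l + m)|) *
    ∏ j ∈ Jᶜ, (B * B) ^ |q * δ j|, ?_, fun x y h => ?_⟩
  · have h' := fun t : ℝ => Real.rpow_nonneg (mul_self_nonneg B) t
    exact mul_nonneg (mul_nonneg (Real.rpow_nonneg hB0 _) (Finset.prod_nonneg fun j _ => h' _))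
      (Finset.prod_nonneg fun j _ => h' _)
  have hx := K.rho_nonneg x
  have hy := K.rho_nonneg y
  have hquot : ∀ a b c d : ℝ, 0 ≤ a → 0 ≤ b → 0 ≤ c → 0 ≤ d → a ≤ B * b → d ≤ B * c →
      c ≤ B * d → a / c ≤ B * B * (b / d) := by
    intro a b c d ha hb hc hd hab hdc hcd
    rcases hc.eq_or_lt with rfl | hc'
    · simp; positivity
    · have hd' : 0 < d := by nlinarith
      rw [← mul_div_assoc, div_le_div_iff₀ hc' hd']
      calc a * d ≤ (B * b) * (B * c) := mul_le_mul hab hdc hd (by positivity)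
        _ = _ := by ring
  have hs : ∀ (t : ℝ) j, (K.r j x / K.rho x) ^ t ≤ (B * B) ^ |t| * (K.r j y / K.rho y) ^ t := by
    intro t j
    have h3 := K.r_nonneg j x
    have h4 := K.r_nonneg j y
    exact Real.rpow_le_of_comparable (div_nonneg h3 hx) (div_nonneg h4 hy) hB2
      (hquot _ _ _ _ h3 h4 hx hy (h.2 j).1 h.1.2 h.1.1)
      (hquot _ _ _ _ h4 h3 hy hx (h.2 j).2 h.1.1 h.1.2)
  have hp : ∀ (s : Finset (Fin n)) (t : Fin n → ℝ), (∏ j ∈ s, (K.r j x / K.rho x) ^ t j) ≤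
      (∏ j ∈ s, (B * B) ^ |t j|) * ∏ j ∈ s, (K.r j y / K.rho y) ^ t j := by
    intro s t
    rw [← Finset.prod_mul_distrib]
    exact Finset.prod_le_prod
      (fun j _ => Real.rpow_nonneg (div_nonneg (K.r_nonneg j x) hx) _) fun j _ => hs _ j
  have hn : ∀ z (s : Finset (Fin n)) (t : Fin n → ℝ), 0 ≤ ∏ j ∈ s, (K.r j z / K.rho z) ^ t j :=
    fun z s t => Finset.prod_nonneg
      fun j _ => Real.rpow_nonneg (div_nonneg (K.r_nonneg j z) (K.rho_nonneg z)) _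
  have h0 := Real.rpow_le_of_comparable (t := q * (β - l + m)) hx hy hB h.1.1 h.1.2
  simp only [weight]
  calc _ ≤ ((B ^ |q * (β - l + m)| * K.rho y ^ (q * (β - l + m))) *
        ((∏ j ∈ J, (B * B) ^ |q * (δ j - l + m)|) *
          ∏ j ∈ J, (K.r j y / K.rho y) ^ (q * (δ j - l + m)))) *
        ((∏ j ∈ Jᶜ, (B * B) ^ |q * δ j|) * ∏ j ∈ Jᶜ, (K.r j y / K.rho y) ^ (q * δ j)) := by
        have h5 := h0.trans' (Real.rpow_nonneg hx _)
        have h6 := (hp J fun j => q * (δ j - l + m)).trans' (hn _ _ _)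
        exact mul_le_mul (mul_le_mul h0 (hp J _) (hn _ _ _) h5) (hp Jᶜ _) (hn _ _ _)
          (mul_nonneg h5 h6)
    _ = _ := by ring

lemma weight_smul (m : ℕ) {t : ℝ} (ht : 0 < t) (x : E3) :
    K.weight J l q β δ m (t • x) = t ^ (q * (β - l + m)) * K.weight J l q β δ m x := by
  have h : ∀ j, K.r j (t • x) / K.rho (t • x) = K.r j x / K.rho x := fun j => by
    rw [K.r_smul ht, K.rho_smul ht, mul_div_mul_left _ _ ht.ne']
  simp only [weight, h]
  rw [K.rho_smul ht, Real.mul_rpow ht.le (K.rho_nonneg x)]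
  ring

end Weight

end PolyhedralCone

/-! ### Finite order reflection across a hyperplane -/

section Reflection

/-- Cutting off a `C^l` function along a hyperplane on which it vanishes to order `l` gives a `C^l`
function. -/
lemma contDiff_ite_of_iteratedFDeriv_eq_zero {l : ℕ} {E F : Type} [NormedAddCommGroup E]
    [NormedSpace ℝ E] [NormedAddCommGroup F] [NormedSpace ℝ F] (ℓ : E →L[ℝ] ℝ) {f : E → F}
    (hf : ContDiff ℝ l f) (h0 : ∀ m ≤ l, ∀ x, ℓ x = 0 → iteratedFDeriv ℝ m f x = 0) :
    ContDiff ℝ l (fun x => if ℓ x ≤ 0 then f x else 0) := by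
  have hval : ∀ x, ℓ x = 0 → f x = 0 := fun x hx => by
    have := congrArg norm (h0 0 (Nat.zero_le _) x hx)
    simpa using this
  induction l generalizing F with
  | zero =>
    rw [Nat.cast_zero, contDiff_zero] at hf ⊢
    exact Continuous.if_le hf continuous_const ℓ.continuous continuous_const hval
  | succ l ih =>
    have hfd : ∀ x, ℓ x = 0 → fderiv ℝ f x = 0 := fun x hx => by
      have := congrArg norm (h0 1 (by omega) x hx)
      simpa using this
    rw [Nat.cast_succ] at hf ⊢
    rw [contDiff_succ_iff_hasFDerivAt]
    refine ⟨fun x => if ℓ x ≤ 0 then fderiv ℝ f x else 0,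
      ih (hf.fderiv_right le_rfl) (fun m hm x hx => ?_) hfd, fun x => ?_⟩
    · rw [← norm_eq_zero, norm_iteratedFDeriv_fderiv, h0 (m + 1) (by omega) x hx, norm_zero]
    · have hd : HasFDerivAt f (fderiv ℝ f x) x := (hf.differentiable (by simp) x).hasFDerivAt
      beta_reduce
      rcases lt_trichotomy (ℓ x) 0 with hx | hx | hx
      · rw [if_pos hx.le]
        refine hd.congr_of_eventuallyEq ?_
        filter_upwards [(isOpen_Iio.preimage ℓ.continuous).mem_nhds hx] with y hy
        exact if_pos (le_of_lt hy)
      · rw [if_pos hx.le, hfd x hx]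
        rw [hfd x hx] at hd
        rw [hasFDerivAt_iff_isLittleO] at hd ⊢
        simp only [hx, le_refl, if_true, hval x hx, sub_zero, zero_apply]
          at hd ⊢
        refine (Asymptotics.IsBigO.of_bound 1
          (Filter.Eventually.of_forall fun y => ?_)).trans_isLittleO hd
        split_ifs <;> simp
      · rw [if_neg (not_le.2 hx)]
        refine (hasFDerivAt_const (0 : F) x).congr_of_eventuallyEq ?_
        filter_upwards [(isOpen_Ioi.preimage ℓ.continuous).mem_nhds hx] with y hy
        exact if_neg (not_le.2 hy)

/-- The linear map that is the identity on the kernel of `ℓ` and multiplies `e` by `a`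
(where `ℓ e = 1`). -/
def scaleAlong {E : Type} [NormedAddCommGroup E] [NormedSpace ℝ E] (ℓ : E →L[ℝ] ℝ) (e : E) (a : ℝ) :
    E →L[ℝ] E :=
  ContinuousLinearMap.id ℝ E + (a - 1) • ℓ.smulRight e

lemma scaleAlong_apply {E : Type} [NormedAddCommGroup E] [NormedSpace ℝ E] (ℓ : E →L[ℝ] ℝ)
    (e : E) (a : ℝ) (x : E) : scaleAlong ℓ e a x = x + ((a - 1) * ℓ x) • e := by
  simp [scaleAlong, smul_smul]

/-- Expanding along the splitting of each `v j` into its normal and tangential part, a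
multilinear map of degree `m ≤ l` is a polynomial of degree at most `l` in `a`, which
the moments annihilate. -/
lemma sum_multilinear_scaleAlong {E : Type} [NormedAddCommGroup E] [NormedSpace ℝ E]
    (ℓ : E →L[ℝ] ℝ) (e : E) {ι : Type} [Fintype ι] (a b : ι → ℝ) {l m : ℕ} (hm : m ≤ l)
    (hab : ∀ j ≤ l, ∑ o, b o * a o ^ j = 0) (M : E [×m]→L[ℝ] ℝ) (v : Fin m → E) :
    ∑ o, b o * M (fun j => scaleAlong ℓ e (a o) (v j)) = 0 := by
  have key : ∀ o, M (fun j => scaleAlong ℓ e (a o) (v j)) = ∑ s : Finset (Fin m), a o ^ s.card *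
      M (s.piecewise (fun j => ℓ (v j) • e) fun j => v j - ℓ (v j) • e) := by
    intro o
    have h1 : (fun j => scaleAlong ℓ e (a o) (v j)) =
        (fun j => a o • (ℓ (v j) • e)) + fun j => v j - ℓ (v j) • e := by
      funext j
      rw [scaleAlong_apply, Pi.add_apply, smul_smul]
      module
    rw [h1, ContinuousMultilinearMap.map_add_univ]
    refine Finset.sum_congr rfl fun s _ => ?_
    have h2 := M.toMultilinearMap.map_piecewise_smul (fun _ => a o)
      (s.piecewise (fun j => ℓ (v j) • e) fun j => v j - ℓ (v j) • e) s
    simp only [Finset.prod_const, smul_eq_mul, ContinuousMultilinearMap.coe_coe] at h2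
    rw [← h2]
    congr 1
    funext j
    by_cases hj : j ∈ s <;> simp [Finset.piecewise, hj]
  simp_rw [key, Finset.mul_sum]
  rw [Finset.sum_comm]
  refine Finset.sum_eq_zero fun s _ => ?_
  simp_rw [← mul_assoc]
  rw [← Finset.sum_mul, hab _ ((Finset.card_le_univ s).trans (by simpa using hm)), zero_mul]

/-- If the moments `∑ b_o a_o^j`, `j ≤ l`, vanish, then `∑ b_o g(A_o x)`, where `A_o` scales the
normal direction by `a_o`, vanishes to order `l` on the hyperplane `ℓ = 0` and can be cut off
there. -/
lemma contDiff_ite_sum_scaleAlong {E : Type} [NormedAddCommGroup E] [NormedSpace ℝ E]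
    (ℓ : E →L[ℝ] ℝ) (e : E) {ι : Type} [Fintype ι] (a b : ι → ℝ) {l : ℕ}
    (hab : ∀ j ≤ l, ∑ o, b o * a o ^ j = 0) {g : E → ℝ} (hg : ContDiff ℝ l g) :
    ContDiff ℝ l (fun x => if ℓ x ≤ 0 then ∑ o, b o * g (scaleAlong ℓ e (a o) x) else 0) := by
  have hterm : ∀ o, ContDiff ℝ l (fun x => g (scaleAlong ℓ e (a o) x)) := fun o =>
    hg.comp (scaleAlong ℓ e (a o)).contDiff
  refine contDiff_ite_of_iteratedFDeriv_eq_zero ℓ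
    (f := fun x => ∑ o, b o * g (scaleAlong ℓ e (a o) x))
    (ContDiff.sum fun o _ => contDiff_const.mul (hterm o)) fun m hm x hx => ?_
  have hml : (m : ℕ∞ω) ≤ l := by exact_mod_cast hm
  have h1 : ∀ o, iteratedFDeriv ℝ m (fun x => b o * g (scaleAlong ℓ e (a o) x)) x =
      b o • (iteratedFDeriv ℝ m g x).compContinuousLinearMap fun _ => scaleAlong ℓ e (a o) := by
    intro o
    have h2 := iteratedFDeriv_const_smul_apply (a := b o) ((hterm o).of_le hml).contDiffAt (x := x)
    have h3 := (scaleAlong ℓ e (a o)).iteratedFDeriv_comp_right hg x hml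
    have h4 : scaleAlong ℓ e (a o) x = x := by simp [scaleAlong_apply, hx]
    rw [h4] at h3
    rw [← h3]
    exact h2
  rw [iteratedFDeriv_fun_sum_apply fun o _ =>
    (contDiff_const.mul ((hterm o).of_le hml)).contDiffAt]
  ext v
  simp only [h1]
  simpa using sum_multilinear_scaleAlong ℓ e a b hm hab (iteratedFDeriv ℝ m g x) v

/-- Hestenes' coefficients: `∑ c_k P(-(k+1)) = P(1)` for polynomials `P` of degree at most `l`. -/
lemma exists_reflection_coeff (l : ℕ) : ∃ c : Fin (l + 1) → ℝ,
    ∀ j ≤ l, ∑ k, c k * (-((k : ℝ) + 1)) ^ j = 1 := by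
  set v : Fin (l + 1) → ℝ := fun k => -((k : ℝ) + 1) with hv
  have hinj : Set.InjOn v (Finset.univ : Finset (Fin (l + 1))) := by
    intro a _ b _ hab
    simp only [hv, neg_inj, add_left_inj, Nat.cast_inj] at hab
    exact Fin.ext hab
  refine ⟨fun k => (Lagrange.basis Finset.univ v k).eval 1, fun j hj => ?_⟩
  have h := Lagrange.eq_interpolate (f := (Polynomial.X ^ j : Polynomial ℝ)) hinj (by
    rw [Polynomial.degree_X_pow]; simp; exact_mod_cast (by omega : j < l + 1))
  have h1 := congrArg (Polynomial.eval 1) h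
  rw [Lagrange.interpolate_apply, Polynomial.eval_finsetSum] at h1
  simp only [Polynomial.eval_pow, Polynomial.eval_X, one_pow, Polynomial.eval_mul,
    Polynomial.eval_C] at h1
  exact (Finset.sum_congr rfl fun k _ => mul_comm _ _).trans h1.symm

/-- A choice of reflection coefficients. -/
def reflCoeff (l : ℕ) : Fin (l + 1) → ℝ := (exists_reflection_coeff l).choose

/-- The scaling factors that occur in reflected terms: `1` for `none`, where nothing is reflected,
and `-(k+1)` for the `k`-th reflection. -/
def reflFactor {l : ℕ} : Option (Fin (l + 1)) → ℝ
  | none => 1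
  | some k => -((k : ℝ) + 1)

/-- The coefficients of the identity. -/
def idCoeff {l : ℕ} : Option (Fin (l + 1)) → ℝ
  | none => 1
  | some _ => 0

/-- The coefficients of the reflection operator `v ↦ ∑ c_k v(A_k ·)`. -/
def optReflCoeff {l : ℕ} : Option (Fin (l + 1)) → ℝ
  | none => 0
  | some k => reflCoeff l k

lemma sum_idCoeff_mul {l : ℕ} (f : Option (Fin (l + 1)) → ℝ) : ∑ o, idCoeff o * f o = f none := by
  simp [Fintype.sum_option, idCoeff]

lemma reflection_moments {l : ℕ} : ∀ j ≤ l,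
    ∑ o : Option (Fin (l + 1)), (idCoeff o - optReflCoeff o) * reflFactor o ^ j = 0 := by
  intro j hj
  have := (exists_reflection_coeff l).choose_spec j hj
  simp only [Fintype.sum_option, idCoeff, optReflCoeff, reflFactor, one_pow, zero_sub, neg_mul,
    Finset.sum_neg_distrib]
  rw [reflCoeff, this]
  norm_num

lemma one_le_abs_reflFactor {l : ℕ} (o : Option (Fin (l + 1))) : 1 ≤ |reflFactor o| := by
  cases o with
  | none => simp [reflFactor]
  | some k =>
    rw [reflFactor, abs_neg, abs_of_nonneg (by positivity)]
    linarith [Nat.cast_nonneg (α := ℝ) k.1]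

lemma abs_reflFactor_le {l : ℕ} (o : Option (Fin (l + 1))) : |reflFactor o| ≤ l + 1 := by
  cases o with
  | none => simp [reflFactor]
  | some k =>
    rw [reflFactor, abs_neg, abs_of_nonneg (by positivity)]
    have : (k : ℝ) ≤ l := by exact_mod_cast Nat.lt_succ_iff.1 k.2
    linarith

lemma reflFactor_ne_zero {l : ℕ} (o : Option (Fin (l + 1))) : reflFactor o ≠ 0 := fun h => by
  have := one_le_abs_reflFactor o
  rw [h] at this; simp at this; linarith

lemma reflFactor_some_neg {l : ℕ} (k : Fin (l + 1)) : reflFactor (some k) < 0 := by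
  simp only [reflFactor]; linarith [Nat.cast_nonneg (α := ℝ) k.1]

end Reflection

/-! ### Extension operators for the model corners -/

section Model

/-- Scaling of the `i`-th coordinate. -/
def scaleCoord (i : Fin 3) (a : ℝ) : E3 →L[ℝ] E3 :=
  scaleAlong (EuclideanSpace.proj i) (EuclideanSpace.single i 1) a

lemma scaleCoord_apply (i j : Fin 3) (a : ℝ) (z : E3) :
    scaleCoord i a z j = if j = i then a * z j else z j := by
  rw [scaleCoord, scaleAlong_apply]
  split_ifs with h
  · subst h; simp; ring
  · simp [h]

/-- The three model domains: a half-space, the intersection of two half-spaces, and the union of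
two half-spaces. -/
inductive CornerType
  | half
  | inter
  | union

/-- The model domain. -/
def CornerType.domain : CornerType → Set E3
  | half => {z | 0 < z 0}
  | inter => {z | 0 < z 0 ∧ 0 < z 1}
  | union => {z | 0 < z 0 ∨ 0 < z 1}

variable {l : ℕ}

open Classical in
/-- The coefficients of the operator `v ↦ v - (reflection of v)` on the negative side, and zero on
the positive side (`s` says that the point is on the positive side). -/
def defectCoeff (s : Prop) (o : Option (Fin (l + 1))) : ℝ :=
  if s then 0 else idCoeff o - optReflCoeff o

/-- With `N_i` the defect operator of the reflection in the `i`-th coordinate, the coefficients of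
`1 - N_0`, `(1 - N_1)(1 - N_0)` and `1 - N_1 N_0`; these extend functions from the half-space, from
the intersection and from the union. -/
def CornerType.coeff (τ : CornerType) (s t : Prop)
    (o : Option (Fin (l + 1)) × Option (Fin (l + 1))) : ℝ :=
  match τ with
  | half => (idCoeff o.1 - defectCoeff s o.1) * idCoeff o.2
  | inter => (idCoeff o.1 - defectCoeff s o.1) * (idCoeff o.2 - defectCoeff t o.2)
  | union => idCoeff o.1 * idCoeff o.2 - defectCoeff s o.1 * defectCoeff t o.2

/-- Scaling of the first two coordinates. -/
def scalePair (o : Option (Fin (l + 1)) × Option (Fin (l + 1))) : E3 →L[ℝ] E3 :=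
  (scaleCoord 0 (reflFactor o.1)).comp (scaleCoord 1 (reflFactor o.2))

lemma scalePair_apply (o : Option (Fin (l + 1)) × Option (Fin (l + 1))) (z : E3) :
    scalePair o z 0 = reflFactor o.1 * z 0 ∧ scalePair o z 1 = reflFactor o.2 * z 1 ∧
      scalePair o z 2 = z 2 := by
  refine ⟨?_, ?_, ?_⟩ <;> simp [scalePair, scaleCoord_apply]

lemma scalePair_none (z : E3) : scalePair (l := l) (none, none) z = z := by
  ext j
  have h := scalePair_apply (l := l) (none, none) z
  simp only [reflFactor, one_mul] at h
  fin_cases j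
  exacts [h.1, h.2.1, h.2.2]

/-- The extension operator for a model domain. -/
def CornerType.ext (τ : CornerType) (l : ℕ) (v : E3 → ℝ) (z : E3) : ℝ :=
  ∑ o : Option (Fin (l + 1)) × Option (Fin (l + 1)),
    τ.coeff (0 < z 0) (0 < z 1) o * v (scalePair o z)

/-- The defect operator of the reflection in one coordinate. -/
def defect (l : ℕ) (i : Fin 3) (v : E3 → ℝ) (z : E3) : ℝ :=
  ∑ o : Option (Fin (l + 1)), defectCoeff (0 < z i) o * v (scaleCoord i (reflFactor o) z)

lemma contDiff_defect (i : Fin 3) {v : E3 → ℝ} (hv : ContDiff ℝ l v) :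
    ContDiff ℝ l (defect l i v) := by
  convert contDiff_ite_sum_scaleAlong (EuclideanSpace.proj i : E3 →L[ℝ] ℝ)
    (EuclideanSpace.single i 1) reflFactor (fun o => idCoeff o - optReflCoeff o)
    (reflection_moments (l := l)) hv using 1
  funext z
  by_cases h : z i ≤ 0
  · have h' : ¬ 0 < z i := not_lt.2 h
    simp [defect, defectCoeff, h, h', scaleCoord]
  · have h' : 0 < z i := not_le.1 h
    simp [defect, defectCoeff, h, h']

lemma defect_defect (v : E3 → ℝ) (z : E3) : defect l 1 (defect l 0 v) z =
    ∑ o : Option (Fin (l + 1)) × Option (Fin (l + 1)),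
      defectCoeff (0 < z 0) o.1 * defectCoeff (0 < z 1) o.2 * v (scalePair o z) := by
  rw [Fintype.sum_prod_type_right]
  simp only [defect, Finset.mul_sum, scalePair, ContinuousLinearMap.comp_apply]
  refine Finset.sum_congr rfl fun o _ => Finset.sum_congr rfl fun o' _ => ?_
  have : (scaleCoord 1 (reflFactor o) z) 0 = z 0 := by simp [scaleCoord_apply]
  rw [this]
  ring

lemma scaleCoord_one (i : Fin 3) (z : E3) : scaleCoord i 1 z = z := by
  ext j; simp [scaleCoord_apply]

lemma sum_pair_idCoeff_left (c : Option (Fin (l + 1)) → ℝ) (v : E3 → ℝ) (z : E3) :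
    ∑ o : Option (Fin (l + 1)) × Option (Fin (l + 1)), idCoeff o.1 * c o.2 * v (scalePair o z) =
      ∑ o, c o * v (scaleCoord 1 (reflFactor o) z) := by
  rw [Fintype.sum_prod_type_right]
  refine Finset.sum_congr rfl fun o _ => ?_
  simp_rw [mul_assoc]
  rw [sum_idCoeff_mul]
  simp [scalePair, reflFactor, scaleCoord_one]

lemma sum_pair_idCoeff_right (c : Option (Fin (l + 1)) → ℝ) (v : E3 → ℝ) (z : E3) :
    ∑ o : Option (Fin (l + 1)) × Option (Fin (l + 1)), c o.1 * idCoeff o.2 * v (scalePair o z) =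
      ∑ o, c o * v (scaleCoord 0 (reflFactor o) z) := by
  rw [Fintype.sum_prod_type]
  refine Finset.sum_congr rfl fun o _ => ?_
  simp_rw [mul_comm (c o), mul_assoc]
  rw [sum_idCoeff_mul, mul_comm]
  simp only [scalePair, ContinuousLinearMap.comp_apply]
  simp [show reflFactor (none : Option (Fin (l + 1))) = 1 from rfl, scaleCoord_one, mul_comm]

/-- The model operators as `1 - N₀`, `(1 - N₁)(1 - N₀)` and `1 - N₁ N₀`, with `N_i` the defect
operators. -/
lemma CornerType.ext_eq (τ : CornerType) (v : E3 → ℝ) : τ.ext l v =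
    match τ with
    | half => v - defect l 0 v
    | inter => (v - defect l 0 v) - (defect l 1 v - defect l 1 (defect l 0 v))
    | union => v - defect l 1 (defect l 0 v) := by
  have hid : ∀ z, ∑ o : Option (Fin (l + 1)) × Option (Fin (l + 1)),
      idCoeff o.1 * idCoeff o.2 * v (scalePair o z) = v z := fun z => by
    rw [sum_pair_idCoeff_left, sum_idCoeff_mul]; simp [reflFactor, scaleCoord_one]
  cases τ <;> funext z <;>
    simp only [CornerType.ext, CornerType.coeff, Pi.sub_apply, sub_mul, mul_sub,
      Finset.sum_sub_distrib, hid, sum_pair_idCoeff_left, sum_pair_idCoeff_right,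
      defect_defect] <;> simp only [defect]

lemma CornerType.contDiff_ext (τ : CornerType) {v : E3 → ℝ} (hv : ContDiff ℝ l v) :
    ContDiff ℝ l (τ.ext l v) := by
  have h0 := contDiff_defect 0 hv
  have h1 := contDiff_defect 1 hv
  have h10 := contDiff_defect 1 h0
  rw [CornerType.ext_eq]
  cases τ
  exacts [hv.sub h0, (hv.sub h0).sub (h1.sub h10), hv.sub h10]

lemma idCoeff_sub_defectCoeff_pos {s : Prop} (hs : s) (o : Option (Fin (l + 1))) :
    idCoeff o - defectCoeff s o = idCoeff o := by simp [defectCoeff, hs]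

lemma idCoeff_sub_defectCoeff_neg {s : Prop} (hs : ¬ s) (o : Option (Fin (l + 1))) :
    idCoeff o - defectCoeff s o = optReflCoeff o := by simp [defectCoeff, hs]

lemma eq_none_of_idCoeff_ne_zero {o : Option (Fin (l + 1))} (h : idCoeff o ≠ 0) : o = none := by
  cases o with
  | none => rfl
  | some k => exact absurd rfl h

lemma reflFactor_neg_of_reflCoeff_ne_zero {o : Option (Fin (l + 1))} (h : optReflCoeff o ≠ 0) :
    reflFactor o < 0 := by
  cases o with
  | none => exact absurd rfl h
  | some k => exact reflFactor_some_neg k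

/-- Off the hyperplane, every term of `1 - N_i` that occurs evaluates on the positive side. -/
lemma factor_mul_pos {o : Option (Fin (l + 1))} {a : ℝ} (ha : a ≠ 0)
    (h : idCoeff o - defectCoeff (0 < a) o ≠ 0) : 0 < reflFactor o * a := by
  by_cases hs : 0 < a
  · rw [idCoeff_sub_defectCoeff_pos hs] at h
    rw [eq_none_of_idCoeff_ne_zero h]
    simpa [reflFactor] using hs
  · rw [idCoeff_sub_defectCoeff_neg hs] at h
    exact mul_pos_of_neg_of_neg (reflFactor_neg_of_reflCoeff_ne_zero h)
      (lt_of_le_of_ne (not_lt.1 hs) ha)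

/-- The extension operator only uses values in the model domain. -/
lemma CornerType.scalePair_mem_domain (τ : CornerType) {z : E3} (h0 : z 0 ≠ 0) (h1 : z 1 ≠ 0)
    {o : Option (Fin (l + 1)) × Option (Fin (l + 1))}
    (ho : τ.coeff (0 < z 0) (0 < z 1) o ≠ 0) : scalePair o z ∈ τ.domain := by
  obtain ⟨e0, e1, -⟩ := scalePair_apply o z
  cases τ
  · simp only [CornerType.coeff, ne_eq, mul_eq_zero, not_or] at ho
    simp only [CornerType.domain, mem_ofPred_eq, e0]
    exact factor_mul_pos h0 ho.1
  · simp only [CornerType.coeff, ne_eq, mul_eq_zero, not_or] at ho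
    simp only [CornerType.domain, mem_ofPred_eq, e0, e1]
    exact ⟨factor_mul_pos h0 ho.1, factor_mul_pos h1 ho.2⟩
  · simp only [CornerType.coeff, ne_eq] at ho
    simp only [CornerType.domain, mem_ofPred_eq, e0, e1]
    by_contra hcon
    push Not at hcon
    have hc0 : idCoeff o.1 - defectCoeff (0 < z 0) o.1 = 0 := by
      by_contra h; exact absurd (factor_mul_pos h0 h) (not_lt.2 hcon.1)
    have hc1 : idCoeff o.2 - defectCoeff (0 < z 1) o.2 = 0 := by
      by_contra h; exact absurd (factor_mul_pos h1 h) (not_lt.2 hcon.2)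
    rw [← sub_eq_zero.1 hc0, ← sub_eq_zero.1 hc1, sub_self] at ho
    exact ho rfl

lemma CornerType.ext_eq_self (τ : CornerType) (v : E3 → ℝ) {z : E3} (hz : z ∈ τ.domain) :
    τ.ext l v z = v z := by
  have hid : ∑ o : Option (Fin (l + 1)) × Option (Fin (l + 1)),
      idCoeff o.1 * idCoeff o.2 * v (scalePair o z) = v z := by
    rw [sum_pair_idCoeff_left, sum_idCoeff_mul]; simp [reflFactor, scaleCoord_one]
  rw [← hid, CornerType.ext]
  refine Finset.sum_congr rfl fun o _ => ?_
  congr 1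
  cases τ
  · simp only [CornerType.coeff, idCoeff_sub_defectCoeff_pos (s := 0 < z 0) hz]
  · simp only [CornerType.coeff, idCoeff_sub_defectCoeff_pos (s := 0 < z 0) hz.1,
      idCoeff_sub_defectCoeff_pos (s := 0 < z 1) hz.2]
  · rcases hz with hz | hz
    · simp [CornerType.coeff, defectCoeff, show 0 < z 0 from hz]
    · simp [CornerType.coeff, defectCoeff, show 0 < z 1 from hz]

/-- Away from the coordinate planes the coefficients are locally constant. -/
lemma CornerType.eventually_coeff_eq (τ : CornerType) {z : E3} (h0 : z 0 ≠ 0) (h1 : z 1 ≠ 0) :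
    ∀ᶠ y in nhds z, ∀ o : Option (Fin (l + 1)) × Option (Fin (l + 1)),
      τ.coeff (0 < y 0) (0 < y 1) o = τ.coeff (0 < z 0) (0 < z 1) o := by
  have key : ∀ i : Fin 3, z i ≠ 0 → ∀ᶠ y : E3 in nhds z, (0 < y i) = (0 < z i) := by
    intro i hi
    have hc : ContinuousAt (fun y : E3 => y i) z := by fun_prop
    rcases lt_or_gt_of_ne hi with h | h
    · filter_upwards [hc.eventually (Iio_mem_nhds h)] with y hy
      have hy' : y i < 0 := hy
      simp [not_lt.2 h.le, not_lt.2 hy'.le]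
    · filter_upwards [hc.eventually (Ioi_mem_nhds h)] with y hy
      have hy' : 0 < y i := hy
      simp [h, hy']
  filter_upwards [key 0 h0, key 1 h1] with y hy0 hy1 o
  rw [hy0, hy1]

end Model

/-! ### Local extension operators and their bounds -/

/-- Bounds for the derivatives of `χ · (v ∘ R)` in terms of those of `v`. -/
lemma exists_norm_iteratedFDeriv_mul_comp_le (l : ℕ) (A B : ℝ) (hA : 0 ≤ A) (hB : 1 ≤ B) :
    ∃ C : ℝ, 0 ≤ C ∧ ∀ (U : Set E3), IsOpen U → ∀ (χ : E3 → ℝ) (R : E3 → E3) (v : E3 → ℝ),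
      ContDiff ℝ ∞ χ → ContDiffOn ℝ ∞ R U → ContDiff ℝ l v → ∀ x ∈ U,
      (∀ i ≤ l, ‖iteratedFDeriv ℝ i χ x‖ ≤ A) →
      (∀ i, 1 ≤ i → i ≤ l → ‖iteratedFDeriv ℝ i R x‖ ≤ B) → ∀ m ≤ l,
      ‖iteratedFDeriv ℝ m (fun y => χ y * v (R y)) x‖ ≤
        C * ∑ i ∈ Finset.range (m + 1), ‖iteratedFDeriv ℝ i v (R x)‖ := by
  refine ⟨∑ m ∈ Finset.range (l + 1), ∑ i ∈ Finset.range (m + 1),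
    (m.choose i : ℝ) * A * ((m - i).factorial * B ^ (m - i)), by positivity, ?_⟩
  intro U hU χ R v hχ hR hv x hx hχA hRB m hm
  have hml : (m : ℕ∞ω) ≤ l := by exact_mod_cast hm
  have hl : (l : ℕ∞ω) ≤ (∞ : ℕ∞ω) := by exact_mod_cast le_top
  have hcomp : ∀ k ≤ m, ‖iteratedFDeriv ℝ k (fun y => v (R y)) x‖ ≤
      k.factorial * (∑ i ∈ Finset.range (m + 1), ‖iteratedFDeriv ℝ i v (R x)‖) * B ^ k := by
    intro k hk
    rw [← iteratedFDerivWithin_of_isOpen k hU hx]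
    refine norm_iteratedFDerivWithin_comp_le (t := univ) (N := l) (n := k)
      (g := v) (f := R) hv.contDiffOn (hR.of_le hl) (by exact_mod_cast hk.trans hm)
      uniqueDiffOn_univ hU.uniqueDiffOn (fun _ _ => mem_univ _) hx (fun i hi => ?_)
      fun i hi1 hi => ?_
    · rw [iteratedFDerivWithin_univ]
      exact Finset.single_le_sum (f := fun i => ‖iteratedFDeriv ℝ i v (R x)‖)
        (fun _ _ => norm_nonneg _) (Finset.mem_range.2 (by omega))
    · rw [iteratedFDerivWithin_of_isOpen i hU hx]
      exact (hRB i hi1 (by omega)).trans (le_self_pow₀ hB (by omega))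
  set s := ∑ i ∈ Finset.range (m + 1), ‖iteratedFDeriv ℝ i v (R x)‖ with hs
  have hs0 : 0 ≤ s := Finset.sum_nonneg fun _ _ => norm_nonneg _
  have hvR : ContDiffOn ℝ l (fun y => v (R y)) U := hv.comp_contDiffOn (hR.of_le hl)
  have hmul := norm_iteratedFDerivWithin_mul_le (hχ.contDiffOn.of_le hl) hvR hU.uniqueDiffOn hx hml
  rw [iteratedFDerivWithin_of_isOpen m hU hx] at hmul
  refine hmul.trans ?_
  calc _ ≤ ∑ i ∈ Finset.range (m + 1),
        (m.choose i : ℝ) * A * ((m - i).factorial * s * B ^ (m - i)) := by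
        refine Finset.sum_le_sum fun i hi => ?_
        have hi' : i ≤ m := Nat.lt_succ_iff.1 (Finset.mem_range.1 hi)
        rw [iteratedFDerivWithin_of_isOpen i hU hx, iteratedFDerivWithin_of_isOpen _ hU hx]
        have := hχA i (hi'.trans hm)
        have h2 := hcomp (m - i) (by omega)
        gcongr
    _ = (∑ i ∈ Finset.range (m + 1),
        (m.choose i : ℝ) * A * ((m - i).factorial * B ^ (m - i))) * s := by
        rw [Finset.sum_mul]
        exact Finset.sum_congr rfl fun i _ => by ring
    _ ≤ _ := by
        refine mul_le_mul_of_nonneg_right ?_ hs0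
        exact Finset.single_le_sum (f := fun m => ∑ i ∈ Finset.range (m + 1),
          (m.choose i : ℝ) * A * ((m - i).factorial * B ^ (m - i)))
          (fun _ _ => by positivity) (Finset.mem_range.2 (by omega))

/-- One-sided change of variables for an injective map whose Jacobian is bounded below. -/
lemma lintegral_comp_le_of_det {U : Set E3} (hU : IsOpen U) {R : E3 → E3}
    (hR : DifferentiableOn ℝ R U) (hinj : InjOn R U) {B : ℝ}
    (hdet : ∀ x ∈ U, 1 ≤ B * |(fderiv ℝ R x).det|) (G : E3 → ℝ≥0∞) :
    ∫⁻ x in U, G (R x) ≤ ENNReal.ofReal B * ∫⁻ y, G y := by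
  have hder : ∀ x ∈ U, HasFDerivWithinAt R (fderiv ℝ R x) U x := fun x hx =>
    ((hR.differentiableAt (hU.mem_nhds hx)).hasFDerivAt).hasFDerivWithinAt
  calc ∫⁻ x in U, G (R x)
      ≤ ∫⁻ x in U, ENNReal.ofReal B * (ENNReal.ofReal |(fderiv ℝ R x).det| * G (R x)) := by
        refine setLIntegral_mono' hU.measurableSet fun x hx => ?_
        rw [← mul_assoc, ← ENNReal.ofReal_mul' (abs_nonneg _)]
        exact le_mul_of_one_le_left' (by simpa using ENNReal.ofReal_le_ofReal (hdet x hx))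
    _ = ENNReal.ofReal B * ∫⁻ y in R '' U, G y := by
        rw [lintegral_const_mul' _ _ ENNReal.ofReal_ne_top,
          lintegral_image_eq_lintegral_abs_det_fderiv_mul volume hU.measurableSet hder hinj]
    _ ≤ _ := by gcongr; exact Measure.restrict_le_self

namespace PolyhedralCone

variable {n : ℕ} (K : PolyhedralCone n)

lemma Comparable.symm {K : PolyhedralCone n} {B : ℝ} {x y : E3} (h : K.Comparable B x y) :
    K.Comparable B y x :=
  ⟨h.1.symm, fun j => (h.2 j).symm⟩

lemma Comparable.notMem_singularSet {K : PolyhedralCone n} {B : ℝ} {x y : E3}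
    (h : K.Comparable B x y) (hy : y ∉ K.singularSet) : x ∉ K.singularSet := by
  have h1 := K.rho_pos hy
  rintro (hx | hx)
  · have : K.rho x = 0 := by rw [hx, rho_eq_norm, norm_zero]
    have := h.1.2
    simp_all; linarith
  · obtain ⟨j, hj⟩ := mem_iUnion.1 hx
    have h2 := K.r_pos (j := j) hy
    have := (h.2 j).2
    rw [K.r_eq_zero_of_mem_edge hj] at this
    simp at this; linarith

/-- The weighted Sobolev energy of order `l` and exponent `q` of a function with classical
derivatives. The norms of the iterated Fréchet derivatives stand in place of the partial
derivatives; with `q = p` the energy is equivalent to the `p`-th power of the norm. -/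
def energy (J : Finset (Fin n)) (l : ℕ) (q β : ℝ) (δ : Fin n → ℝ) (D : Set E3) (v : E3 → ℝ) :
    ℝ≥0∞ :=
  ∑ m ∈ Finset.range (l + 1),
    ∫⁻ x in D, ENNReal.ofReal (K.weight J l q β δ m x) * ‖iteratedFDeriv ℝ m v x‖ₑ ^ q

lemma measurable_energy_integrand (J : Finset (Fin n)) (l : ℕ) (q β : ℝ) (δ : Fin n → ℝ) {m : ℕ}
    {v : E3 → ℝ} (hm : m ≤ l) (hv : ContDiff ℝ l v) : Measurable fun x =>
      ENNReal.ofReal (K.weight J l q β δ m x) * ‖iteratedFDeriv ℝ m v x‖ₑ ^ q :=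
  ((K.measurable_weight J l q β δ m).ennreal_ofReal).mul
    ((hv.continuous_iteratedFDeriv (by exact_mod_cast hm)).enorm.measurable.pow_const q)

/-- Subadditivity of the energy up to a constant, for finite sums. -/
lemma energy_sum_le (J : Finset (Fin n)) (l : ℕ) {q : ℝ} (hq : 1 ≤ q) (β : ℝ) (δ : Fin n → ℝ)
    (D : Set E3) {κ : Type} (s : Finset κ) (v : κ → E3 → ℝ) (hv : ∀ k ∈ s, ContDiff ℝ l (v k)) :
    K.energy J l q β δ D (fun x => ∑ k ∈ s, v k x) ≤
      (s.card : ℝ≥0∞) ^ (q - 1) * ∑ k ∈ s, K.energy J l q β δ D (v k) := by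
  simp only [energy]
  rw [Finset.sum_comm, Finset.mul_sum]
  refine Finset.sum_le_sum fun m hm => ?_
  have hml : m ≤ l := Nat.lt_succ_iff.1 (Finset.mem_range.1 hm)
  rw [← lintegral_finsetSum' _ fun k hk =>
    (K.measurable_energy_integrand J l q β δ hml (hv k hk)).aemeasurable,
    ← lintegral_const_mul' _ _ (ENNReal.rpow_ne_top_of_nonneg (by linarith) (by simp))]
  refine lintegral_mono fun x => ?_
  rw [iteratedFDeriv_fun_sum_apply fun k hk =>
    ((hv k hk).of_le (by exact_mod_cast hml)).contDiffAt]
  calc _ ≤ ENNReal.ofReal (K.weight J l q β δ m x) *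
        ((s.card : ℝ≥0∞) ^ (q - 1) * ∑ k ∈ s, ‖iteratedFDeriv ℝ m (v k) x‖ₑ ^ q) := by
        gcongr
        refine (ENNReal.rpow_le_rpow (enorm_sum_le _ _) (by linarith)).trans ?_
        exact ENNReal.rpow_sum_le_const_mul_sum_rpow _ _ hq
    _ = _ := by
        rw [mul_left_comm, Finset.mul_sum, Finset.mul_sum]

/-- A local extension operator on the open set `U`. It takes functions known on `D` to functions
on `U ∩ D'`, and is locally a finite combination of compositions `v ∘ R o` with diffeomorphisms
that move no point by more than a factor relative to the vertex and the edges. The formula for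
`op` is required off a null set only, because the coefficients jump. -/
structure LocalExt (l : ℕ) (D D' U : Set E3) where
  /-- the index set of the maps -/
  ι : Type
  /-- there are finitely many maps -/
  fintype : Fintype ι
  /-- the extension operator -/
  op : (E3 → ℝ) →ₗ[ℝ] (E3 → ℝ)
  /-- the maps -/
  R : ι → E3 → E3
  /-- a constant for all the estimates -/
  B : ℝ
  one_le_B : 1 ≤ B
  isOpen : IsOpen U
  contDiffOn_R : ∀ o, ContDiffOn ℝ ∞ (R o) U
  injOn_R : ∀ o, InjOn (R o) U
  norm_le : ∀ o, ∀ x ∈ U, ∀ i, 1 ≤ i → i ≤ l → ‖iteratedFDeriv ℝ i (R o) x‖ ≤ B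
  det_le : ∀ o, ∀ x ∈ U, 1 ≤ B * |(fderiv ℝ (R o) x).det|
  comparable : ∀ o, ∀ x ∈ U, K.Comparable B x (R o x)
  rho_le : ∀ x ∈ U, K.rho x ≤ B
  ae_formula : ∀ᵐ x, x ∈ U → x ∈ D' → ∃ c : ι → ℝ, (∀ o, |c o| ≤ B) ∧ (∀ o, c o ≠ 0 → R o x ∈ D) ∧
    ∀ v, op v =ᶠ[nhds x] fun y => ∑ o, c o * v (R o y)
  contDiffOn_op : ∀ v, ContDiff ℝ l v → ContDiffOn ℝ l (op v) U
  op_eq : ∀ v, ∀ x ∈ U, x ∈ D → op v x = v x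
  exists_ne_zero : ∀ v, ∀ x ∈ U, op v x ≠ 0 → ∃ o, v (R o x) ≠ 0

attribute [instance] LocalExt.fintype

variable {K}

/-- The localized extension `χ · op v` is globally defined and smooth. -/
lemma LocalExt.contDiff_mul {l : ℕ} {D D' U : Set E3} (L : K.LocalExt l D D' U) {χ : E3 → ℝ}
    (hχ : ContDiff ℝ ∞ χ) (hχU : tsupport χ ⊆ U) {v : E3 → ℝ} (hv : ContDiff ℝ l v) :
    ContDiff ℝ l (fun x => χ x * L.op v x) := by
  rw [contDiff_iff_contDiffAt]
  intro x
  by_cases hx : x ∈ tsupport χ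
  · exact ((hχ.of_le (by exact_mod_cast le_top)).contDiffAt).mul
      ((L.contDiffOn_op v hv).contDiffAt (L.isOpen.mem_nhds (hχU hx)))
  · refine (contDiffAt_const (c := (0 : ℝ))).congr_of_eventuallyEq ?_
    filter_upwards [notMem_tsupport_iff_eventuallyEq.1 hx] with y hy
    rw [hy]; simp

/-- Almost everywhere the derivatives of the localized extension are bounded by the derivatives of
the function at those image points `L.R o x` that lie in `D`. -/
lemma LocalExt.exists_pointwise_bound {l : ℕ} {D D' U : Set E3} (L : K.LocalExt l D D' U)
    {χ : E3 → ℝ} (hχ : ContDiff ℝ ∞ χ) (hχc : HasCompactSupport χ) : ∃ C : ℝ, 0 ≤ C ∧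
    ∀ v, ContDiff ℝ l v → ∀ᵐ x, x ∈ U → x ∈ D' → ∀ m ≤ l,
      ‖iteratedFDeriv ℝ m (fun y => χ y * L.op v y) x‖ ≤
        C * ∑ o, D.indicator (fun y => ∑ i ∈ Finset.range (m + 1), ‖iteratedFDeriv ℝ i v y‖)
          (L.R o x) := by
  have hAi : ∀ i : ℕ, ∃ A, ∀ x, ‖iteratedFDeriv ℝ i χ x‖ ≤ A := fun i =>
    (hχc.iteratedFDeriv i).exists_bound_of_continuous
      (hχ.continuous_iteratedFDeriv (by exact_mod_cast le_top))
  choose A hA using hAi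
  have hA0 : ∀ i, 0 ≤ A i := fun i => (norm_nonneg _).trans (hA i 0)
  obtain ⟨C, hC0, hC⟩ := exists_norm_iteratedFDeriv_mul_comp_le l
    (∑ i ∈ Finset.range (l + 1), A i) L.B (Finset.sum_nonneg fun i _ => hA0 i) L.one_le_B
  have hB0 : 0 ≤ L.B := by linarith [L.one_le_B]
  refine ⟨L.B * C, by positivity, fun v hv => ?_⟩
  filter_upwards [L.ae_formula] with x hform hxU hxD' m hm
  obtain ⟨c, hcB, hcD, hc⟩ := hform hxU hxD'
  have hev : (fun y => χ y * L.op v y) =ᶠ[nhds x]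
      fun y => ∑ o, c o • (χ y * v (L.R o y)) := by
    filter_upwards [hc v] with y hy
    rw [hy, Finset.mul_sum]
    exact Finset.sum_congr rfl fun o _ => by rw [smul_eq_mul]; ring
  have hml : (m : ℕ∞ω) ≤ l := by exact_mod_cast hm
  have hl : (l : ℕ∞ω) ≤ (∞ : ℕ∞ω) := by exact_mod_cast le_top
  have hterm : ∀ o, ContDiffAt ℝ m (fun y => χ y * v (L.R o y)) x := fun o =>
    ((hχ.of_le hl).contDiffAt.mul (hv.contDiffAt.comp x
      (((L.contDiffOn_R o).of_le hl).contDiffAt (L.isOpen.mem_nhds hxU)))).of_le hml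
  rw [(hev.iteratedFDeriv ℝ m).eq_of_nhds,
    iteratedFDeriv_fun_sum_apply (f := fun o y => c o • (χ y * v (L.R o y)))
      fun o _ => (hterm o).const_smul (c o), Finset.mul_sum]
  refine (norm_sum_le _ _).trans (Finset.sum_le_sum fun o _ => ?_)
  have hsmul : iteratedFDeriv ℝ m (fun y => c o • (χ y * v (L.R o y))) x =
      c o • iteratedFDeriv ℝ m (fun y => χ y * v (L.R o y)) x :=
    iteratedFDeriv_const_smul_apply (a := c o) (hterm o)
  rw [hsmul, norm_smul, Real.norm_eq_abs]
  by_cases ho : c o = 0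
  · rw [ho]; simp
    refine mul_nonneg (by positivity) (indicator_nonneg (fun _ _ => ?_) _)
    exact Finset.sum_nonneg fun _ _ => norm_nonneg _
  · rw [indicator_of_mem (hcD o ho), mul_assoc]
    refine mul_le_mul (hcB o) ?_ (norm_nonneg _) hB0
    refine hC U L.isOpen χ (L.R o) v hχ (L.contDiffOn_R o) hv x hxU (fun i hi => ?_)
      (L.norm_le o x hxU) m hm
    exact (hA i x).trans (Finset.single_le_sum (f := A) (fun i _ => hA0 i)
      (Finset.mem_range.2 (by omega)))

/-- The localized extension is bounded in the weighted Sobolev norm. -/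
lemma LocalExt.exists_energy_le {l : ℕ} {D D' U : Set E3} (L : K.LocalExt l D D' U)
    (hD : MeasurableSet D) (hD' : MeasurableSet D') {χ : E3 → ℝ} (hχ : ContDiff ℝ ∞ χ)
    (hχc : HasCompactSupport χ) (hχU : tsupport χ ⊆ U)
    (J : Finset (Fin n)) {q : ℝ} (hq : 1 ≤ q) (β : ℝ) (δ : Fin n → ℝ) :
    ∃ C : ℝ≥0∞, C ≠ ⊤ ∧ ∀ v, ContDiff ℝ l v →
      K.energy J l q β δ D' (fun x => χ x * L.op v x) ≤ C * K.energy J l q β δ D v := by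
  have hq0 : 0 ≤ q := by linarith
  obtain ⟨C, hC0, hC⟩ := L.exists_pointwise_bound hχ hχc
  have hB0 : 0 ≤ L.B := by linarith [L.one_le_B]
  have hw := fun m => K.exists_weight_le_of_comparable J l q β δ L.one_le_B m
  choose W hW0 hW using hw
  set G : (E3 → ℝ) → ℕ → E3 → ℝ≥0∞ := fun v i => D.indicator fun y =>
    ENNReal.ofReal (K.weight J l q β δ i y) * ‖iteratedFDeriv ℝ i v y‖ₑ ^ q with hG
  set M : ℕ → ℝ≥0∞ := fun m => ENNReal.ofReal (W m) * ENNReal.ofReal ((L.B * L.B) ^ (q * l)) *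
    (ENNReal.ofReal C ^ q * ((Fintype.card L.ι : ℝ≥0∞) ^ (q - 1) *
      ((m + 1 : ℕ) : ℝ≥0∞) ^ (q - 1))) with hM
  have hMtop : ∀ m, M m ≠ ⊤ := by
    intro m
    have h1 : ∀ a : ℕ, (a : ℝ≥0∞) ^ (q - 1) ≠ ⊤ := fun a =>
      ENNReal.rpow_ne_top_of_nonneg (by linarith) (by simp)
    exact ENNReal.mul_ne_top (ENNReal.mul_ne_top ENNReal.ofReal_ne_top ENNReal.ofReal_ne_top)
      (ENNReal.mul_ne_top (ENNReal.rpow_ne_top_of_nonneg hq0 ENNReal.ofReal_ne_top)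
        (ENNReal.mul_ne_top (h1 _) (h1 _)))
  -- the pointwise estimate, with the weights carried along
  have hpt : ∀ m ≤ l, ∀ v, ContDiff ℝ l v → ∀ᵐ x, x ∈ U → x ∈ D' →
      ENNReal.ofReal (K.weight J l q β δ m x) *
        ‖iteratedFDeriv ℝ m (fun y => χ y * L.op v y) x‖ₑ ^ q ≤
      M m * ∑ o, ∑ i ∈ Finset.range (m + 1), G v i (L.R o x) := by
    intro m hm v hv
    filter_upwards [hC v hv, K.ae_notMem_singularSet] with x hx hxS hxU hxD'
    have h1 : ‖iteratedFDeriv ℝ m (fun y => χ y * L.op v y) x‖ₑ ≤ ENNReal.ofReal C *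
        ∑ o, D.indicator (fun y => ∑ i ∈ Finset.range (m + 1), ‖iteratedFDeriv ℝ i v y‖ₑ)
          (L.R o x) := by
      have h2 := ENNReal.ofReal_le_ofReal (hx hxU hxD' m hm)
      rw [ofReal_norm, ENNReal.ofReal_mul hC0, ENNReal.ofReal_sum_of_nonneg
        (fun o _ => indicator_nonneg
          (fun _ _ => Finset.sum_nonneg fun _ _ => norm_nonneg _) _)] at h2
      refine h2.trans_eq ?_
      congr 1
      refine Finset.sum_congr rfl fun o _ => ?_
      by_cases ho : L.R o x ∈ D
      · rw [indicator_of_mem ho, indicator_of_mem ho,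
          ENNReal.ofReal_sum_of_nonneg fun _ _ => norm_nonneg _]
        simp only [ofReal_norm]
      · rw [indicator_of_notMem ho, indicator_of_notMem ho, ENNReal.ofReal_zero]
    have h3 : ‖iteratedFDeriv ℝ m (fun y => χ y * L.op v y) x‖ₑ ^ q ≤
        ENNReal.ofReal C ^ q * ((Fintype.card L.ι : ℝ≥0∞) ^ (q - 1) *
          ((m + 1 : ℕ) : ℝ≥0∞) ^ (q - 1)) * ∑ o, ∑ i ∈ Finset.range (m + 1),
            D.indicator (fun y => ‖iteratedFDeriv ℝ i v y‖ₑ ^ q) (L.R o x) := by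
      refine (ENNReal.rpow_le_rpow h1 hq0).trans ?_
      rw [ENNReal.mul_rpow_of_nonneg _ _ hq0, mul_assoc (ENNReal.ofReal C ^ q), mul_assoc]
      gcongr
      refine (ENNReal.rpow_sum_le_const_mul_sum_rpow _ _ hq).trans ?_
      rw [Finset.card_univ]
      gcongr
      rw [Finset.mul_sum]
      refine Finset.sum_le_sum fun o _ => ?_
      by_cases ho : L.R o x ∈ D
      · simp only [indicator_of_mem ho]
        refine (ENNReal.rpow_sum_le_const_mul_sum_rpow _ _ hq).trans_eq ?_
        rw [Finset.card_range]
      · simp only [indicator_of_notMem ho]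
        rw [ENNReal.zero_rpow_of_pos (by linarith)]
        exact zero_le
    have hwt : ∀ o, ∀ i ∈ Finset.range (m + 1), ENNReal.ofReal (K.weight J l q β δ m x) *
        D.indicator (fun y => ‖iteratedFDeriv ℝ i v y‖ₑ ^ q) (L.R o x) ≤
        ENNReal.ofReal (W m) * ENNReal.ofReal ((L.B * L.B) ^ (q * l)) * G v i (L.R o x) := by
      intro o i hi
      by_cases ho : L.R o x ∈ D
      · simp only [hG, indicator_of_mem ho]
        rw [← mul_assoc]
        gcongr
        rw [← ENNReal.ofReal_mul (hW0 m),
          ← ENNReal.ofReal_mul (mul_nonneg (hW0 m) (by positivity))]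
        refine ENNReal.ofReal_le_ofReal ?_
        have hcmp := L.comparable o x hxU
        have hRS : L.R o x ∉ K.singularSet := by
          exact hcmp.symm.notMem_singularSet hxS
        have h4 := K.weight_mono_order J l q β δ hq0 (Nat.lt_succ_iff.1 (Finset.mem_range.1 hi)) hm
          (B := L.B * L.B) (by nlinarith [L.one_le_B]) hRS
          (hcmp.1.2.trans (mul_le_mul_of_nonneg_left (L.rho_le x hxU) hB0))
        refine (hW m _ _ hcmp).trans ?_
        rw [mul_assoc]
        exact mul_le_mul_of_nonneg_left h4 (hW0 m)
      · simp only [hG, indicator_of_notMem ho, mul_zero, le_refl]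
    set P : ℝ≥0∞ := ENNReal.ofReal C ^ q * ((Fintype.card L.ι : ℝ≥0∞) ^ (q - 1) *
          ((m + 1 : ℕ) : ℝ≥0∞) ^ (q - 1)) with hP
    set Q : ℝ≥0∞ := ENNReal.ofReal (W m) * ENNReal.ofReal ((L.B * L.B) ^ (q * l)) with hQ
    calc _ ≤ ENNReal.ofReal (K.weight J l q β δ m x) * (P * ∑ o, ∑ i ∈ Finset.range (m + 1),
            D.indicator (fun y => ‖iteratedFDeriv ℝ i v y‖ₑ ^ q) (L.R o x)) := by gcongr
      _ = P * ∑ o, ∑ i ∈ Finset.range (m + 1), ENNReal.ofReal (K.weight J l q β δ m x) *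
            D.indicator (fun y => ‖iteratedFDeriv ℝ i v y‖ₑ ^ q) (L.R o x) := by
          simp_rw [← Finset.mul_sum]
          ring
      _ ≤ P * ∑ o, ∑ i ∈ Finset.range (m + 1), Q * G v i (L.R o x) := by
          refine mul_le_mul_right (Finset.sum_le_sum fun o _ => Finset.sum_le_sum fun i hi => ?_) _
          exact hwt o i hi
      _ = M m * ∑ o, ∑ i ∈ Finset.range (m + 1), G v i (L.R o x) := by
          simp_rw [← Finset.mul_sum]
          simp only [hM]
          ring
  have hGm : ∀ i ≤ l, ∀ v, ContDiff ℝ l v → Measurable (G v i) := fun i hi v hv =>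
    (K.measurable_energy_integrand J l q β δ hi hv).indicator hD
  have hGint : ∀ i ≤ l, ∀ v, ∫⁻ y, G v i y ≤ K.energy J l q β δ D v := by
    intro i hi v
    rw [hG, lintegral_indicator hD]
    exact Finset.single_le_sum (f := fun m => ∫⁻ x in D, ENNReal.ofReal (K.weight J l q β δ m x) *
      ‖iteratedFDeriv ℝ m v x‖ₑ ^ q) (fun _ _ => zero_le) (Finset.mem_range.2 (by omega))
  have hRm : ∀ o, AEMeasurable (L.R o) (volume.restrict U) := fun o =>
    (L.contDiffOn_R o).continuousOn.aemeasurable L.isOpen.measurableSet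
  have hmain : ∀ m ≤ l, ∀ v, ContDiff ℝ l v →
      ∫⁻ x in D', ENNReal.ofReal (K.weight J l q β δ m x) *
        ‖iteratedFDeriv ℝ m (fun y => χ y * L.op v y) x‖ₑ ^ q ≤
      M m * (Fintype.card L.ι * ((m + 1 : ℕ) * (ENNReal.ofReal L.B *
        K.energy J l q β δ D v))) := by
    intro m hm v hv
    calc _ ≤ ∫⁻ x in D', U.indicator (fun x =>
            M m * ∑ o, ∑ i ∈ Finset.range (m + 1), G v i (L.R o x)) x := by
          refine lintegral_mono_ae ?_
          rw [ae_restrict_iff' hD']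
          filter_upwards [hpt m hm v hv] with x hx hxD'
          by_cases hxU : x ∈ U
          · rw [indicator_of_mem hxU]
            exact hx hxU hxD'
          · have h0 : iteratedFDeriv ℝ m (fun y => χ y * L.op v y) x = 0 := by
              have hx : (fun y => χ y * L.op v y) =ᶠ[nhds x] fun _ => 0 := by
                filter_upwards [notMem_tsupport_iff_eventuallyEq.1 fun h => hxU (hχU h)] with y hy
                rw [hy]; simp
              rw [(hx.iteratedFDeriv ℝ m).eq_of_nhds]
              exact congrFun iteratedFDeriv_fun_zero x
            rw [h0, enorm_zero, ENNReal.zero_rpow_of_pos (by linarith), mul_zero]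
            exact zero_le
      _ ≤ ∫⁻ x in U, M m * ∑ o, ∑ i ∈ Finset.range (m + 1), G v i (L.R o x) := by
          rw [← lintegral_indicator L.isOpen.measurableSet]
          exact lintegral_mono' Measure.restrict_le_self le_rfl
      _ = M m * ∑ o, ∑ i ∈ Finset.range (m + 1), ∫⁻ x in U, G v i (L.R o x) := by
          have hmeas : ∀ o, ∀ i ∈ Finset.range (m + 1),
              AEMeasurable (fun x => G v i (L.R o x)) (volume.restrict U) := fun o i hi =>
            (hGm i ((Nat.lt_succ_iff.1 (Finset.mem_range.1 hi)).trans hm) v hv).comp_aemeasurable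
              (hRm o)
          rw [lintegral_const_mul' _ _ (hMtop m), lintegral_finsetSum' _ fun o _ =>
            Finset.aemeasurable_fun_sum _ (hmeas o)]
          congr 1
          exact Finset.sum_congr rfl fun o _ => lintegral_finsetSum' _ (hmeas o)
      _ ≤ M m * ∑ o : L.ι, ∑ i ∈ Finset.range (m + 1),
            ENNReal.ofReal L.B * K.energy J l q β δ D v := by
          gcongr with o _ i hi
          refine (lintegral_comp_le_of_det L.isOpen
            ((L.contDiffOn_R o).differentiableOn (by simp)) (L.injOn_R o) (L.det_le o) _).trans ?_
          gcongr
          exact hGint i ((Nat.lt_succ_iff.1 (Finset.mem_range.1 hi)).trans hm) v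
      _ = _ := by simp
  refine ⟨∑ m ∈ Finset.range (l + 1), M m * (Fintype.card L.ι * ((m + 1 : ℕ) *
    ENNReal.ofReal L.B)), ?_, fun v hv => ?_⟩
  · refine ENNReal.sum_ne_top.2 fun m _ => ENNReal.mul_ne_top (hMtop m) (ENNReal.mul_ne_top
      (by simp) (ENNReal.mul_ne_top (by simp) ENNReal.ofReal_ne_top))
  · rw [Finset.sum_mul]
    refine Finset.sum_le_sum fun m hm => ?_
    refine (hmain m (Nat.lt_succ_iff.1 (Finset.mem_range.1 hm)) v hv).trans_eq ?_
    ring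

end PolyhedralCone

/-! ### Local extension operators from charts -/

/-- A smooth map with a differentiable left inverse has bounded derivatives and a Jacobian bounded
below on compact sets. -/
lemma exists_bound_of_leftInverse (l : ℕ) {V C : Set E3} (hV : IsOpen V) (hC : IsCompact C)
    (hCV : C ⊆ V) {R S : E3 → E3} (hR : ContDiffOn ℝ ∞ R V)
    (hS : ∀ x ∈ V, DifferentiableAt ℝ S (R x)) (hSR : ∀ x ∈ V, S (R x) = x) :
    ∃ B : ℝ, 1 ≤ B ∧ ∀ x ∈ C, (∀ i ≤ l, ‖iteratedFDeriv ℝ i R x‖ ≤ B) ∧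
      1 ≤ B * |(fderiv ℝ R x).det| := by
  have hder : ∀ i : ℕ, ∃ b : ℝ, ∀ x ∈ C, ‖iteratedFDeriv ℝ i R x‖ ≤ b := by
    intro i
    refine hC.exists_bound_of_continuousOn (ContinuousOn.mono ?_ hCV)
    refine (hR.continuousOn_iteratedFDerivWithin (m := i) (by exact_mod_cast le_top)
      hV.uniqueDiffOn).congr fun x hx => ?_
    exact (iteratedFDerivWithin_of_isOpen i hV hx).symm
  choose b hb using hder
  have hdet0 : ∀ x ∈ V, (fderiv ℝ R x).det ≠ 0 := by
    intro x hx h0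
    have hRx : DifferentiableAt ℝ R x :=
      (hR.contDiffAt (hV.mem_nhds hx)).differentiableAt (by simp)
    have h1 : HasFDerivAt (fun y => S (R y)) ((fderiv ℝ S (R x)).comp (fderiv ℝ R x)) x :=
      (hS x hx).hasFDerivAt.comp x hRx.hasFDerivAt
    have h2 : HasFDerivAt (fun y => S (R y)) (ContinuousLinearMap.id ℝ E3) x :=
      (hasFDerivAt_id x).congr_of_eventuallyEq (by
        filter_upwards [hV.mem_nhds hx] with y hy using hSR y hy)
    have h3 := congrArg ContinuousLinearMap.det (h1.unique h2)
    rw [ContinuousLinearMap.det, ContinuousLinearMap.toLinearMap_comp, LinearMap.det_comp] at h3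
    have h4 : LinearMap.det (fderiv ℝ R x : E3 →ₗ[ℝ] E3) = 0 := h0
    rw [h4, mul_zero] at h3
    simp [ContinuousLinearMap.det] at h3
  have hdetc : ContinuousOn (fun x => |(fderiv ℝ R x).det|⁻¹) C := by
    refine ContinuousOn.inv₀ ?_ fun x hx => abs_ne_zero.2 (hdet0 x (hCV hx))
    refine (ContinuousLinearMap.continuous_det.comp_continuousOn ?_).abs
    exact (hR.continuousOn_fderiv_of_isOpen hV (by simp)).mono hCV
  obtain ⟨d, hd⟩ := hC.exists_bound_of_continuousOn hdetc
  refine ⟨1 + (∑ i ∈ Finset.range (l + 1), |b i|) + |d|, ?_, fun x hx => ⟨fun i hi => ?_, ?_⟩⟩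
  · have : 0 ≤ ∑ i ∈ Finset.range (l + 1), |b i| := Finset.sum_nonneg fun _ _ => abs_nonneg _
    linarith [abs_nonneg d]
  · have := Finset.single_le_sum (f := fun i => |b i|) (fun _ _ => abs_nonneg _)
      (Finset.mem_range.2 (by omega : i < l + 1))
    linarith [hb i x hx, le_abs_self (b i), abs_nonneg d]
  · have h1 := hd x hx
    have h2 : 0 < |(fderiv ℝ R x).det| := abs_pos.2 (hdet0 x (hCV hx))
    rw [norm_inv, Real.norm_eq_abs, abs_abs, inv_le_iff_one_le_mul₀ h2] at h1
    have h0 : 0 ≤ ∑ i ∈ Finset.range (l + 1), |b i| := Finset.sum_nonneg fun _ _ => abs_nonneg _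
    have : d * |(fderiv ℝ R x).det| ≤
        (1 + (∑ i ∈ Finset.range (l + 1), |b i|) + |d|) * |(fderiv ℝ R x).det| :=
      mul_le_mul_of_nonneg_right (by linarith [le_abs_self d]) h2.le
    linarith

lemma volume_coord_eq_zero (i : Fin 3) : volume {z : E3 | z i = 0} = 0 := by
  have h : {z : E3 | z i = 0} =
      (LinearMap.ker (EuclideanSpace.proj i : E3 →L[ℝ] ℝ).toLinearMap : Set E3) := by
    ext z; simp
  rw [h]
  refine Measure.addHaar_submodule _ _ fun htop => ?_
  have : (EuclideanSpace.single i (1 : ℝ) : E3) ∈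
      LinearMap.ker (EuclideanSpace.proj i : E3 →L[ℝ] ℝ).toLinearMap := by rw [htop]; trivial
  simp at this

namespace PolyhedralCone

variable {n : ℕ} {K : PolyhedralCone n}

/-- The trivial local extension operator, where nothing has to be extended. -/
lemma nonempty_localExt_id (l : ℕ) {D D' U : Set E3} (hU : IsOpen U) (hUD : U ∩ D' ⊆ D) {r : ℝ}
    (hUr : U ⊆ Metric.closedBall 0 r) : Nonempty (K.LocalExt l D D' U) := by
  obtain ⟨B, hB1, hB⟩ := exists_bound_of_leftInverse l (V := univ) (R := id) (S := id) isOpen_univ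
    (isCompact_closedBall (0 : E3) r) (subset_univ _) contDiff_id.contDiffOn
    (fun _ _ => differentiableAt_id) fun _ _ => rfl
  have hBr : B ≤ B + |r| := by linarith [abs_nonneg r]
  exact ⟨{
    ι := Unit
    fintype := inferInstance
    op := LinearMap.id
    R := fun _ => id
    B := B + |r|
    one_le_B := hB1.trans hBr
    isOpen := hU
    contDiffOn_R := fun _ => contDiff_id.contDiffOn
    injOn_R := fun _ => injOn_id _
    norm_le := fun _ x hx i _ hi => ((hB x (hUr hx)).1 i hi).trans hBr
    det_le := fun _ x hx => (hB x (hUr hx)).2.trans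
      (mul_le_mul_of_nonneg_right hBr (abs_nonneg _))
    comparable := fun _ x _ => Comparable.refl K (hB1.trans hBr) x
    rho_le := fun x hx => by
      have := hUr hx
      rw [mem_closedBall_zero_iff] at this
      rw [rho_eq_norm]
      linarith [le_abs_self r]
    ae_formula := Filter.Eventually.of_forall fun x hx hx' => ⟨fun _ => 1, fun _ => by
      simpa using hB1.trans hBr, fun _ _ => hUD ⟨hx, hx'⟩, fun v =>
      Filter.Eventually.of_forall fun y => by simp⟩
    contDiffOn_op := fun v hv => hv.contDiffOn
    op_eq := fun v x _ _ => rfl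
    exists_ne_zero := fun v x _ h => ⟨(), h⟩ }⟩

variable (K) in
/-- The local normal form of the cone near a boundary point: a chart onto one of the model domains
in which every edge either stays away or is the axis `z 0 = z 1 = 0`. -/
def IsCornerChart (Φ : OpenPartialHomeomorph E3 E3) (τ : CornerType) (x : E3) : Prop :=
  IsSmoothChartAt Φ x ∧ (∀ y ∈ Φ.source, y ∈ K.carrier ↔ Φ y ∈ τ.domain) ∧
    ∀ j, 0 < K.r j x ∨ ∀ y ∈ Φ.source, y ∈ K.edge j ↔ Φ y 0 = 0 ∧ Φ y 1 = 0

lemma IsSmoothChartAt.contDiffAt {Φ : OpenPartialHomeomorph E3 E3} {x : E3}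
    (h : IsSmoothChartAt Φ x) {y : E3} (hy : y ∈ Φ.source) : ContDiffAt ℝ ∞ Φ y :=
  h.2.2.1.contDiffAt (Φ.open_source.mem_nhds hy)

lemma IsSmoothChartAt.contDiffAt_symm {Φ : OpenPartialHomeomorph E3 E3} {x : E3}
    (h : IsSmoothChartAt Φ x) {z : E3} (hz : z ∈ Φ.target) : ContDiffAt ℝ ∞ Φ.symm z :=
  h.2.2.2.contDiffAt (Φ.open_target.mem_nhds hz)

lemma IsSmoothChartAt.zero_mem_target {Φ : OpenPartialHomeomorph E3 E3} {x : E3}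
    (h : IsSmoothChartAt Φ x) : (0 : E3) ∈ Φ.target := h.2.1 ▸ Φ.map_source h.1

lemma IsSmoothChartAt.symm_zero {Φ : OpenPartialHomeomorph E3 E3} {x : E3}
    (h : IsSmoothChartAt Φ x) : Φ.symm 0 = x := by rw [← h.2.1, Φ.left_inv h.1]

lemma abs_coord_le_norm (z : E3) (i : Fin 3) : |z i| ≤ ‖z‖ := by
  simpa using PiLp.norm_apply_le z i

/-- In a corner chart the distance to an edge is controlled by the first two coordinates only:
either it is bounded above and below, or it is comparable to `|z 0| + |z 1|`. -/
lemma IsCornerChart.exists_r_le {Φ : OpenPartialHomeomorph E3 E3} {τ : CornerType} {x : E3}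
    (h : K.IsCornerChart Φ τ x) (j : Fin n) (A : ℝ) (hA : 0 ≤ A) : ∃ C : ℝ,
    ∀ᶠ ε in nhdsWithin (0 : ℝ) (Ioi 0), ∀ z ∈ Metric.ball (0 : E3) ε, ∀ z' ∈ Metric.ball (0 : E3) ε,
      |z 0| ≤ A * |z' 0| → |z 1| ≤ A * |z' 1| → K.r j (Φ.symm z) ≤ C * K.r j (Φ.symm z') := by
  obtain ⟨hΦ, -, hedge⟩ := h
  have h0t := IsSmoothChartAt.zero_mem_target hΦ
  have hs0 := IsSmoothChartAt.symm_zero hΦ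
  have hball : ∀ s ∈ nhds (0 : E3), ∀ᶠ ε in nhdsWithin (0 : ℝ) (Ioi 0), Metric.ball 0 ε ⊆ s := by
    intro s hs
    obtain ⟨ε, hε, hsub⟩ := Metric.mem_nhds_iff.1 hs
    filter_upwards [Ioo_mem_nhdsGT hε] with ε' hε'
    exact (Metric.ball_subset_ball hε'.2.le).trans hsub
  have hcsymm : ContinuousAt Φ.symm 0 := Φ.continuousAt_symm h0t
  rcases hedge j with hpos | hed
  · -- the edge stays away: `r j` is close to its value at the centre
    have hc : ContinuousAt (fun z => K.r j (Φ.symm z)) 0 :=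
      ((K.continuous_r j).continuousAt).comp hcsymm
    have hmem : {z | K.r j x / 2 < K.r j (Φ.symm z) ∧ K.r j (Φ.symm z) < 2 * K.r j x} ∈
        nhds (0 : E3) := by
      have h1 : K.r j (Φ.symm 0) ∈ Ioo (K.r j x / 2) (2 * K.r j x) := by
        rw [hs0]; constructor <;> linarith
      exact hc.preimage_mem_nhds (Ioo_mem_nhds h1.1 h1.2)
    refine ⟨4, ?_⟩
    filter_upwards [hball _ hmem] with ε hε z hz z' hz' _ _
    have h1 : _ ∧ _ := hε hz
    have h2 : _ ∧ _ := hε hz'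
    linarith [h1.2, h2.1]
  · -- the edge is the axis: both the chart and its inverse are Lipschitz
    obtain ⟨L, t, ht, hL⟩ := ((IsSmoothChartAt.contDiffAt_symm hΦ h0t).of_le
      (by exact_mod_cast le_top : (1 : ℕ∞ω) ≤ (∞ : ℕ∞ω))).exists_lipschitzOnWith
    obtain ⟨L', t', ht', hL'⟩ := ((IsSmoothChartAt.contDiffAt hΦ hΦ.1).of_le
      (by exact_mod_cast le_top : (1 : ℕ∞ω) ≤ (∞ : ℕ∞ω))).exists_lipschitzOnWith
    obtain ⟨η, hη, hηt⟩ := Metric.mem_nhds_iff.1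
      (Filter.inter_mem ht' (Φ.open_source.mem_nhds hΦ.1))
    have hnear : Φ.symm ⁻¹' Metric.ball x (η / 2) ∈ nhds (0 : E3) :=
      hcsymm.preimage_mem_nhds (by rw [hs0]; exact Metric.ball_mem_nhds _ (by positivity))
    refine ⟨2 * L * A * (L' + 1), ?_⟩
    filter_upwards [hball _ ht, hball _ (Φ.open_target.mem_nhds h0t), hball _ hnear,
      Ioo_mem_nhdsGT (half_pos hη)] with ε hεt hεT hεn hεη z hz z' hz' h0 h1
    have hup : K.r j (Φ.symm z) ≤ L * (|z 0| + |z 1|) := by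
      set a : E3 := EuclideanSpace.single 2 (z 2) with ha
      have haε : a ∈ Metric.ball (0 : E3) ε := by
        rw [mem_ball_zero_iff] at hz ⊢
        rw [ha, PiLp.norm_single]
        exact (abs_coord_le_norm z 2).trans_lt hz
      have hae : Φ.symm a ∈ K.edge j := by
        rw [hed _ (Φ.map_target (hεT haε)), Φ.right_inv (hεT haε)]
        simp [ha]
      refine (K.r_le_dist j hae).trans ((hL.dist_le_mul _ (hεt hz) _ (hεt haε)).trans ?_)
      refine mul_le_mul_of_nonneg_left ?_ L.2
      have hza : z - a = EuclideanSpace.single 0 (z 0) + EuclideanSpace.single 1 (z 1) := by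
        ext i; fin_cases i <;> simp [ha]
      rw [dist_eq_norm, hza]
      refine (norm_add_le _ _).trans_eq ?_
      simp
    have hlow : ∀ i : Fin 3, i = 0 ∨ i = 1 → |z' i| ≤ (L' + 1) * K.r j (Φ.symm z') := by
      intro i hi
      have hL1 : (0 : ℝ) < L' + 1 := by have := L'.2; positivity
      rw [← div_le_iff₀' hL1, r, Metric.le_infDist (K.edge_nonempty j)]
      intro m hm
      rw [div_le_iff₀' hL1]
      have hx' : Φ.symm z' ∈ Metric.ball x (η / 2) := hεn hz'
      by_cases hmb : m ∈ Metric.ball x η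
      · have hm0 : Φ m i = 0 := by
          have := (hed m (hηt hmb).2).1 hm
          rcases hi with rfl | rfl
          exacts [this.1, this.2]
        have h2 := hL'.dist_le_mul _ (hηt (Metric.ball_subset_ball (by linarith) hx')).1 _
          (hηt hmb).1
        rw [Φ.right_inv (hεT hz'), dist_eq_norm] at h2
        have h3 := abs_coord_le_norm (z' - Φ m) i
        rw [PiLp.sub_apply, hm0, sub_zero] at h3
        have h4 : (0 : ℝ) ≤ dist (Φ.symm z') m := dist_nonneg
        linarith
      · rw [Metric.mem_ball, not_lt] at hmb
        rw [Metric.mem_ball] at hx'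
        have h5 := dist_triangle m (Φ.symm z') x
        rw [dist_comm m (Φ.symm z')] at h5
        have h6 := abs_coord_le_norm z' i
        rw [mem_ball_zero_iff] at hz'
        have h7 : |z' i| ≤ dist (Φ.symm z') m := by linarith [hεη.2]
        have := L'.2
        nlinarith [dist_nonneg (x := Φ.symm z') (y := m)]
    have := hlow 0 (Or.inl rfl)
    have := hlow 1 (Or.inr rfl)
    have hLA : (0 : ℝ) ≤ L * A := mul_nonneg L.2 hA
    calc _ ≤ (L : ℝ) * (|z 0| + |z 1|) := hup
      _ ≤ L * (A * |z' 0| + A * |z' 1|) := mul_le_mul_of_nonneg_left (by linarith) L.2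
      _ = L * A * (|z' 0| + |z' 1|) := by ring
      _ ≤ L * A * (2 * ((L' + 1) * K.r j (Φ.symm z'))) :=
          mul_le_mul_of_nonneg_left (by linarith) hLA
      _ = _ := by ring

end PolyhedralCone

section Model
variable {l : ℕ}

/-- The inverse of `scalePair`. -/
def scalePairInv (o : Option (Fin (l + 1)) × Option (Fin (l + 1))) : E3 →L[ℝ] E3 :=
  (scaleCoord 0 (reflFactor o.1)⁻¹).comp (scaleCoord 1 (reflFactor o.2)⁻¹)

lemma scalePairInv_scalePair (o : Option (Fin (l + 1)) × Option (Fin (l + 1))) (z : E3) :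
    scalePairInv o (scalePair o z) = z := by
  have h1 := reflFactor_ne_zero o.1
  have h2 := reflFactor_ne_zero o.2
  ext j
  fin_cases j <;> simp [scalePairInv, scalePair, scaleCoord_apply, h1, h2]

lemma CornerType.exists_abs_coeff_le (τ : CornerType) (l : ℕ) : ∃ M : ℝ, ∀ (s t : Prop)
    (o : Option (Fin (l + 1)) × Option (Fin (l + 1))), |τ.coeff s t o| ≤ M := by
  refine ⟨∑ o : Option (Fin (l + 1)) × Option (Fin (l + 1)), (|τ.coeff True True o| +
    |τ.coeff True False o| + |τ.coeff False True o| + |τ.coeff False False o|), fun s t o => ?_⟩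
  refine le_trans ?_ (Finset.single_le_sum (f := fun o => |τ.coeff True True o| +
    |τ.coeff True False o| + |τ.coeff False True o| + |τ.coeff False False o|)
    (fun _ _ => by positivity) (Finset.mem_univ o))
  rcases Classical.propComplete s with rfl | rfl <;>
  rcases Classical.propComplete t with rfl | rfl <;>
  linarith [abs_nonneg (τ.coeff True True o), abs_nonneg (τ.coeff True False o),
    abs_nonneg (τ.coeff False True o), abs_nonneg (τ.coeff False False o)]

end Model

namespace PolyhedralCone

variable {n : ℕ} {K : PolyhedralCone n}

/-- Near every point with a corner chart there is a local extension operator: the model operator,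
transported by the chart. -/
theorem IsCornerChart.exists_localExt {Φ : OpenPartialHomeomorph E3 E3} {τ : CornerType} {x₀ : E3}
    (h : K.IsCornerChart Φ τ x₀) (l : ℕ) {A : Set E3} (hA : IsOpen A) (hx₀ : x₀ ∈ A) {a b : ℝ}
    (ha : 0 < a) (hAa : ∀ x ∈ A, a < ‖x‖ ∧ ‖x‖ < b) :
    ∃ U, x₀ ∈ U ∧ U ⊆ A ∧ Nonempty (K.LocalExt l (K.carrier ∩ A) univ U) := by
  have hΦ := h.1
  have h0t := IsSmoothChartAt.zero_mem_target hΦ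
  have hs0 := IsSmoothChartAt.symm_zero hΦ
  have hcsymm : ContinuousAt Φ.symm 0 := Φ.continuousAt_symm h0t
  choose C hC using fun j => h.exists_r_le j (l + 1) (by positivity)
  -- the radius of the ball in the chart in which everything takes place
  obtain ⟨ε₁, ⟨hε₁C, hε₁t, hε₁A⟩, hε₁⟩ := (((Filter.eventually_all.2 hC).and
    ((show ∀ᶠ ε in nhdsWithin (0 : ℝ) (Ioi 0), Metric.ball 0 ε ⊆ Φ.target from by
      obtain ⟨ε, hε, hsub⟩ := Metric.mem_nhds_iff.1 (Φ.open_target.mem_nhds h0t)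
      filter_upwards [Ioo_mem_nhdsGT hε] with ε' hε'
      exact (Metric.ball_subset_ball hε'.2.le).trans hsub).and
    (show ∀ᶠ ε in nhdsWithin (0 : ℝ) (Ioi 0), Metric.ball 0 ε ⊆ Φ.symm ⁻¹' A from by
      obtain ⟨ε, hε, hsub⟩ := Metric.mem_nhds_iff.1
        (hcsymm.preimage_mem_nhds (hA.mem_nhds (hs0.symm ▸ hx₀)))
      filter_upwards [Ioo_mem_nhdsGT hε] with ε' hε'
      exact (Metric.ball_subset_ball hε'.2.le).trans hsub))).and self_mem_nhdsWithin).exists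
  have hε₁ : 0 < ε₁ := hε₁
  let ζ : ContDiffBump (0 : E3) := ⟨ε₁ / 2, 3 * ε₁ / 4, by positivity, by linarith⟩
  have hζt : tsupport ζ ⊆ Metric.ball 0 ε₁ := by
    rw [ζ.tsupport_eq]
    exact Metric.closedBall_subset_ball (by change 3 * ε₁ / 4 < ε₁; linarith)
  have hζ1 : ∀ z ∈ Metric.ball (0 : E3) (ε₁ / 2), ζ z = 1 := fun z hz =>
    ζ.one_of_mem_closedBall (Metric.ball_subset_closedBall hz)
  -- a smaller ball that all the scalings map into the region where the cut-off is one
  obtain ⟨ε₂, hε₂, hscale⟩ : ∃ ε₂ > 0, ∀ z ∈ Metric.ball (0 : E3) ε₂,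
      ∀ o : Option (Fin (l + 1)) × Option (Fin (l + 1)),
        scalePair o z ∈ Metric.ball (0 : E3) (ε₁ / 2) := by
    have : ∀ᶠ z in nhds (0 : E3), ∀ o : Option (Fin (l + 1)) × Option (Fin (l + 1)),
        scalePair o z ∈ Metric.ball (0 : E3) (ε₁ / 2) := by
      refine Filter.eventually_all.2 fun o => ?_
      refine (scalePair o).continuous.continuousAt.eventually_mem ?_
      rw [map_zero]
      exact Metric.ball_mem_nhds _ (by positivity)
    exact Metric.eventually_nhds_iff_ball.1 this
  have hb12 : Metric.ball (0 : E3) (ε₁ / 2) ⊆ Metric.ball 0 ε₁ :=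
    Metric.ball_subset_ball (by linarith)
  have hb2 : Metric.ball (0 : E3) ε₂ ⊆ Metric.ball (0 : E3) (ε₁ / 2) := fun z hz => by
    simpa [scalePair_none] using hscale z hz (none, none)
  have hb3 : Metric.ball (0 : E3) (ε₂ / 2) ⊆ Metric.ball (0 : E3) ε₂ :=
    Metric.ball_subset_ball (by linarith)
  set V : Set E3 := Φ.source ∩ Φ ⁻¹' Metric.ball 0 ε₂ with hV
  set U : Set E3 := Φ.source ∩ Φ ⁻¹' Metric.ball 0 (ε₂ / 2) with hU
  have hVo : IsOpen V := Φ.isOpen_inter_preimage Metric.isOpen_ball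
  have hUo : IsOpen U := Φ.isOpen_inter_preimage Metric.isOpen_ball
  have hUV : U ⊆ V := fun x hx => ⟨hx.1, hb3 hx.2⟩
  set Cc : Set E3 := Φ.symm '' Metric.closedBall 0 (ε₂ / 2) with hCc
  have hcb : Metric.closedBall (0 : E3) (ε₂ / 2) ⊆ Metric.ball 0 ε₂ :=
    Metric.closedBall_subset_ball (by linarith)
  have hbt : Metric.ball (0 : E3) ε₂ ⊆ Φ.target := (hb2.trans hb12).trans hε₁t
  have hCcomp : IsCompact Cc := (isCompact_closedBall _ _).image_of_continuousOn
    (Φ.continuousOn_symm.mono (hcb.trans hbt))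
  have hCV : Cc ⊆ V := by
    rintro _ ⟨z, hz, rfl⟩
    exact ⟨Φ.map_target (hbt (hcb hz)), by
      rw [mem_preimage, Φ.right_inv (hbt (hcb hz))]; exact hcb hz⟩
  have hUC : U ⊆ Cc := fun x hx =>
    ⟨Φ x, Metric.ball_subset_closedBall hx.2, Φ.left_inv hx.1⟩
  -- the reflections in the original coordinates
  set R : Option (Fin (l + 1)) × Option (Fin (l + 1)) → E3 → E3 :=
    fun o x => Φ.symm (scalePair o (Φ x)) with hR
  have hsp : ∀ o, ∀ x ∈ V, scalePair o (Φ x) ∈ Metric.ball (0 : E3) ε₁ :=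
    fun o x hx => hb12 (hscale _ hx.2 o)
  have hΦR : ∀ o, ∀ x ∈ V, Φ (R o x) = scalePair o (Φ x) := fun o x hx =>
    Φ.right_inv (hε₁t (hsp o x hx))
  have hRs : ∀ o, ∀ x ∈ V, R o x ∈ Φ.source := fun o x hx => Φ.map_target (hε₁t (hsp o x hx))
  have hRA : ∀ o, ∀ x ∈ V, R o x ∈ A := fun o x hx => hε₁A (hsp o x hx)
  have hUA : U ⊆ A := fun x hx => by
    have h1 := hε₁A (hb12 (hb2 (hUV hx).2))
    rwa [mem_preimage, Φ.left_inv hx.1] at h1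
  have hRc : ∀ o, ContDiffOn ℝ ∞ (R o) V := fun o x hx =>
    ((IsSmoothChartAt.contDiffAt_symm hΦ (hε₁t (hsp o x hx))).comp x
      ((scalePair o).contDiff.contDiffAt.comp x
        (IsSmoothChartAt.contDiffAt hΦ hx.1))).contDiffWithinAt
  set Sx : Option (Fin (l + 1)) × Option (Fin (l + 1)) → E3 → E3 :=
    fun o x => Φ.symm (scalePairInv o (Φ x)) with hSx
  have hSR : ∀ o, ∀ x ∈ V, Sx o (R o x) = x := fun o x hx => by
    simp only [hSx]
    rw [hΦR o x hx, scalePairInv_scalePair, Φ.left_inv hx.1]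
  have hSd : ∀ o, ∀ x ∈ V, DifferentiableAt ℝ (Sx o) (R o x) := by
    intro o x hx
    have h1 : DifferentiableAt ℝ Φ (R o x) :=
      (IsSmoothChartAt.contDiffAt hΦ (hRs o x hx)).differentiableAt (by simp)
    have h2 : DifferentiableAt ℝ Φ.symm (scalePairInv o (Φ (R o x))) := by
      rw [hΦR o x hx, scalePairInv_scalePair]
      exact (IsSmoothChartAt.contDiffAt_symm hΦ (Φ.map_source hx.1)).differentiableAt (by simp)
    exact h2.comp (R o x) ((scalePairInv o).differentiableAt.comp (R o x) h1)
  choose B hB1 hB using fun o => exists_bound_of_leftInverse l hVo hCcomp hCV (hRc o) (hSd o)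
    (hSR o)
  obtain ⟨M, hM⟩ := τ.exists_abs_coeff_le l
  have hab : a < b := (hAa _ hx₀).1.trans (hAa _ hx₀).2
  have hb0 : 0 < b := ha.trans hab
  have hsB : 0 ≤ ∑ o, |B o| := Finset.sum_nonneg fun _ _ => abs_nonneg _
  have hsC : 0 ≤ ∑ j, |C j| := Finset.sum_nonneg fun _ _ => abs_nonneg _
  set B' : ℝ := 1 + (∑ o, |B o|) + |M| + b + b / a + ∑ j, |C j| with hB'
  have hBo : ∀ o, B o ≤ B' := fun o => by
    have := Finset.single_le_sum (f := fun o => |B o|) (fun _ _ => abs_nonneg _)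
      (Finset.mem_univ o)
    have := le_abs_self (B o)
    have : 0 < b / a := by positivity
    linarith [abs_nonneg M]
  have hCj : ∀ j, C j ≤ B' := fun j => by
    have := Finset.single_le_sum (f := fun j => |C j|) (fun _ _ => abs_nonneg _)
      (Finset.mem_univ j)
    have := le_abs_self (C j)
    have : 0 < b / a := by positivity
    linarith [abs_nonneg M]
  have hMB : M ≤ B' := by
    have : 0 < b / a := by positivity
    linarith [le_abs_self M]
  have hbB : b ≤ B' := by
    have : 0 < b / a := by positivity
    linarith [abs_nonneg M]
  have hbaB : b / a ≤ B' := by linarith [abs_nonneg M]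
  have h1B : 1 ≤ B' := by
    have : 0 < b / a := by positivity
    linarith [abs_nonneg M]
  have hnorm : ∀ x ∈ A, ∀ y ∈ A, ‖x‖ ≤ B' * ‖y‖ := fun x hx y hy => by
    calc ‖x‖ ≤ b := (hAa x hx).2.le
      _ = b / a * a := by field_simp
      _ ≤ B' * ‖y‖ := mul_le_mul hbaB (hAa y hy).1.le ha.le (by linarith)
  have hrle : ∀ j, ∀ z ∈ Metric.ball (0 : E3) ε₁, ∀ z' ∈ Metric.ball (0 : E3) ε₁,
      |z 0| ≤ (l + 1) * |z' 0| → |z 1| ≤ (l + 1) * |z' 1| →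
      K.r j (Φ.symm z) ≤ B' * K.r j (Φ.symm z') := fun j z hz z' hz' h0 h1 =>
    (hε₁C j z hz z' hz' h0 h1).trans (mul_le_mul_of_nonneg_right (hCj j) (K.r_nonneg _ _))
  have hcmp : ∀ o, ∀ x ∈ U, K.Comparable B' x (R o x) := by
    intro o x hx
    have hxV := hUV hx
    have hRxA := hRA o x hxV
    refine ⟨by simp only [rho_eq_norm]; exact ⟨hnorm _ (hUA hx) _ hRxA, hnorm _ hRxA _ (hUA hx)⟩,
      fun j => ?_⟩
    have hz : Φ x ∈ Metric.ball (0 : E3) ε₁ := hb12 (hb2 hxV.2)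
    obtain ⟨e0, e1, -⟩ := scalePair_apply o (Φ x)
    have hbig : ∀ (o : Option (Fin (l + 1))) (t : ℝ), |t| ≤ (l + 1) * |reflFactor o * t| := by
      intro o t
      rw [abs_mul]
      have := one_le_abs_reflFactor o
      nlinarith [abs_nonneg t, mul_le_mul_of_nonneg_right this (abs_nonneg t),
        mul_nonneg (Nat.cast_nonneg (α := ℝ) l) (mul_nonneg (abs_nonneg (reflFactor o))
          (abs_nonneg t))]
    have hsmall : ∀ (o : Option (Fin (l + 1))) (t : ℝ), |reflFactor o * t| ≤ (l + 1) * |t| := by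
      intro o t
      rw [abs_mul]
      exact mul_le_mul_of_nonneg_right (abs_reflFactor_le o) (abs_nonneg t)
    have h1 := hrle j (Φ x) hz _ (hsp o x hxV) (by rw [e0]; exact hbig _ _)
      (by rw [e1]; exact hbig _ _)
    have h2 := hrle j _ (hsp o x hxV) (Φ x) hz (by rw [e0]; exact hsmall _ _)
      (by rw [e1]; exact hsmall _ _)
    rw [Φ.left_inv hx.1] at h1 h2
    exact ⟨h1, h2⟩
  -- the function in the chart, cut off to be globally defined
  set T : (E3 → ℝ) → E3 → ℝ := fun v z => ζ z * v (Φ.symm z) with hT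
  have hTc : ∀ v, ContDiff ℝ l v → ContDiff ℝ l (T v) := by
    intro v hv
    rw [contDiff_iff_contDiffAt]
    intro z
    have hl : (l : ℕ∞ω) ≤ (∞ : ℕ∞ω) := by exact_mod_cast le_top
    by_cases hz : z ∈ tsupport ζ
    · exact (ζ.contDiff (n := l)).contDiffAt.mul (hv.contDiffAt.comp z
        ((IsSmoothChartAt.contDiffAt_symm hΦ (hε₁t (hζt hz))).of_le hl))
    · refine (contDiffAt_const (c := (0 : ℝ))).congr_of_eventuallyEq ?_
      filter_upwards [notMem_tsupport_iff_eventuallyEq.1 hz] with y hy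
      simp only [hT, hy, Pi.zero_apply, zero_mul]
  have hTR : ∀ v o, ∀ x ∈ V, T v (scalePair o (Φ x)) = v (R o x) := fun v o x hx => by
    simp only [hT, hζ1 _ (hscale _ hx.2 o), one_mul, hR]
  have hnull : ∀ i : Fin 3, ∀ᵐ x, x ∈ U → Φ x i ≠ 0 := by
    intro i
    have h1 : volume (Φ.symm '' ({z : E3 | z i = 0} ∩ Φ.target)) = 0 := by
      refine addHaar_image_eq_zero_of_differentiableOn_of_addHaar_eq_zero _ ?_
        (measure_mono_null inter_subset_left (volume_coord_eq_zero i))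
      exact (hΦ.2.2.2.differentiableOn (by simp)).mono inter_subset_right
    filter_upwards [compl_mem_ae_iff.2 h1] with x hx hxU h0
    exact hx ⟨Φ x, ⟨h0, Φ.map_source hxU.1⟩, Φ.left_inv hxU.1⟩
  refine ⟨U, ⟨hΦ.1, by rw [mem_preimage, hΦ.2.1]; exact Metric.mem_ball_self (by positivity)⟩,
    hUA, ⟨{
    ι := Option (Fin (l + 1)) × Option (Fin (l + 1))
    fintype := inferInstance
    op :=
      { toFun := fun v x => τ.ext l (T v) (Φ x)
        map_add' := fun v w => by
          funext x
          simp only [CornerType.ext, hT, Pi.add_apply, mul_add, Finset.sum_add_distrib]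
        map_smul' := fun c v => by
          funext x
          simp only [CornerType.ext, hT, Pi.smul_apply, smul_eq_mul, Finset.mul_sum,
            RingHom.id_apply]
          exact Finset.sum_congr rfl fun o _ => by ring }
    R := R
    B := B'
    one_le_B := h1B
    isOpen := hUo
    contDiffOn_R := fun o => (hRc o).mono hUV
    injOn_R := fun o x hx y hy hxy => by
      rw [← hSR o x (hUV hx), ← hSR o y (hUV hy), hxy]
    norm_le := fun o x hx i _ hi => ((hB o x (hUC hx)).1 i hi).trans (hBo o)
    det_le := fun o x hx => (hB o x (hUC hx)).2.trans
      (mul_le_mul_of_nonneg_right (hBo o) (abs_nonneg _))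
    comparable := hcmp
    rho_le := fun x hx => by rw [rho_eq_norm]; exact (hAa x (hUA hx)).2.le.trans hbB
    ae_formula := by
      filter_upwards [hnull 0, hnull 1] with x h0 h1 hxU _
      refine ⟨τ.coeff (0 < Φ x 0) (0 < Φ x 1), fun o => (hM _ _ o).trans hMB, fun o ho => ?_,
        fun v => ?_⟩
      · refine ⟨?_, hRA o x (hUV hxU)⟩
        rw [h.2.1 _ (hRs o x (hUV hxU)), hΦR o x (hUV hxU)]
        exact τ.scalePair_mem_domain (h0 hxU) (h1 hxU) ho
      · filter_upwards [(Φ.continuousAt hxU.1).eventually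
          (τ.eventually_coeff_eq (l := l) (h0 hxU) (h1 hxU)), hUo.mem_nhds hxU] with y hy hyU
        simp only [LinearMap.coe_mk, AddHom.coe_mk, CornerType.ext]
        exact Finset.sum_congr rfl fun o _ => by rw [hy o, hTR v o y (hUV hyU)]
    contDiffOn_op := fun v hv => (τ.contDiff_ext (hTc v hv)).comp_contDiffOn
      ((hΦ.2.2.1.mono inter_subset_left).of_le (by exact_mod_cast le_top))
    op_eq := fun v x hx hxD => by
      have h1 : Φ x ∈ τ.domain := (h.2.1 x hx.1).1 hxD.1
      simp only [LinearMap.coe_mk, AddHom.coe_mk]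
      rw [τ.ext_eq_self _ h1]
      simp only [hT]
      rw [hζ1 _ (hb2 (hUV hx).2), one_mul, Φ.left_inv hx.1]
    exists_ne_zero := fun v x hx hne => by
      simp only [LinearMap.coe_mk, AddHom.coe_mk, CornerType.ext] at hne
      obtain ⟨o, -, ho⟩ := Finset.exists_ne_zero_of_sum_ne_zero hne
      refine ⟨o, fun h0 => ho ?_⟩
      rw [hTR v o x (hUV hx), h0, mul_zero] }⟩⟩

end PolyhedralCone

/-! ### Corner charts at the boundary points of a polyhedral cone -/

lemma exists_polar_coordinates (y : E3) : ∃ r φ : ℝ, 0 ≤ r ∧ -Real.pi < φ ∧ φ ≤ Real.pi ∧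
    y 0 = r * Real.cos φ ∧ y 1 = r * Real.sin φ := by
  set w : ℂ := ⟨y 0, y 1⟩
  refine ⟨‖w‖, w.arg, norm_nonneg _, w.neg_pi_lt_arg, w.arg_le_pi, ?_, ?_⟩
  · exact (Complex.norm_mul_cos_arg w).symm
  · exact (Complex.norm_mul_sin_arg w).symm

lemma polar_linear_forms (r φ η : ℝ) :
    Real.sin η * (r * Real.cos φ) + Real.cos η * (r * Real.sin φ) = r * Real.sin (η + φ) ∧
    Real.sin η * (r * Real.cos φ) - Real.cos η * (r * Real.sin φ) = r * Real.sin (η - φ) := by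
  rw [Real.sin_add, Real.sin_sub]
  constructor <;> ring

/-- A dihedron with opening angle at most `π` is an intersection of half-spaces. -/
lemma mem_dihedron_iff_and {θ : ℝ} (h0 : 0 < θ) (hθ : θ ≤ Real.pi) (y : E3) :
    y ∈ dihedron θ ↔ 0 < Real.sin (θ / 2) * y 0 + Real.cos (θ / 2) * y 1 ∧
      0 < Real.sin (θ / 2) * y 0 - Real.cos (θ / 2) * y 1 := by
  constructor
  · rintro ⟨r, φ, hr, h1, h2, e0, e1⟩
    rw [e0, e1, (polar_linear_forms r φ (θ / 2)).1, (polar_linear_forms r φ (θ / 2)).2]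
    exact ⟨mul_pos hr (Real.sin_pos_of_pos_of_lt_pi (by linarith) (by linarith)),
      mul_pos hr (Real.sin_pos_of_pos_of_lt_pi (by linarith) (by linarith))⟩
  · rintro ⟨h1, h2⟩
    obtain ⟨r, φ, hr, hφ1, hφ2, e0, e1⟩ := exists_polar_coordinates y
    rw [e0, e1, (polar_linear_forms r φ (θ / 2)).1] at h1
    rw [e0, e1, (polar_linear_forms r φ (θ / 2)).2] at h2
    have hr' : 0 < r := hr.lt_of_ne' fun h => by rw [h, zero_mul] at h1; exact lt_irrefl _ h1
    refine ⟨r, φ, hr', ?_, ?_, e0, e1⟩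
    · by_contra hcon
      have := Real.sin_nonpos_of_nonpos_of_neg_pi_le (x := θ / 2 + φ) (by linarith) (by linarith)
      nlinarith
    · by_contra hcon
      have := Real.sin_nonpos_of_nonpos_of_neg_pi_le (x := θ / 2 - φ) (by linarith) (by linarith)
      nlinarith

lemma Real.sin_nonpos_of_pi_le_of_le_two_pi {x : ℝ} (h1 : Real.pi ≤ x) (h2 : x ≤ 2 * Real.pi) :
    Real.sin x ≤ 0 := by
  have := Real.sin_nonpos_of_nonpos_of_neg_pi_le (x := x - 2 * Real.pi) (by linarith) (by linarith)
  rwa [Real.sin_sub_two_pi] at this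

/-- A dihedron with opening angle larger than `π` is a union of half-spaces. -/
lemma mem_dihedron_iff_or {θ : ℝ} (hθ : Real.pi < θ) (hθ2 : θ < 2 * Real.pi) (y : E3) :
    y ∈ dihedron θ ↔ 0 < Real.sin (θ / 2) * y 0 + Real.cos (θ / 2) * y 1 ∨
      0 < Real.sin (θ / 2) * y 0 - Real.cos (θ / 2) * y 1 := by
  have hpi := Real.pi_pos
  constructor
  · rintro ⟨r, φ, hr, h1, h2, e0, e1⟩
    rw [e0, e1, (polar_linear_forms r φ (θ / 2)).1, (polar_linear_forms r φ (θ / 2)).2]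
    rcases le_total 0 φ with hφ | hφ
    · exact Or.inr (mul_pos hr (Real.sin_pos_of_pos_of_lt_pi (by linarith) (by linarith)))
    · exact Or.inl (mul_pos hr (Real.sin_pos_of_pos_of_lt_pi (by linarith) (by linarith)))
  · intro h
    obtain ⟨r, φ, hr, hφ1, hφ2, e0, e1⟩ := exists_polar_coordinates y
    rw [e0, e1, (polar_linear_forms r φ (θ / 2)).1, (polar_linear_forms r φ (θ / 2)).2] at h
    have hr' : 0 < r := hr.lt_of_ne' fun h0 => by
      rw [h0, zero_mul, zero_mul] at h; exact h.elim (lt_irrefl _) (lt_irrefl _)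
    have h' : 0 < Real.sin (θ / 2 + φ) ∨ 0 < Real.sin (θ / 2 - φ) :=
      h.imp (fun h => pos_of_mul_pos_right h hr) fun h => pos_of_mul_pos_right h hr
    refine ⟨r, φ, hr', ?_, ?_, e0, e1⟩
    · by_contra hcon
      have a1 := Real.sin_nonpos_of_nonpos_of_neg_pi_le (x := θ / 2 + φ) (by linarith)
        (by linarith)
      have a2 := Real.sin_nonpos_of_pi_le_of_le_two_pi (x := θ / 2 - φ) (by linarith)
        (by linarith)
      rcases h' with h' | h' <;> linarith
    · by_contra hcon
      have a1 := Real.sin_nonpos_of_pi_le_of_le_two_pi (x := θ / 2 + φ) (by linarith)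
        (by linarith)
      have a2 := Real.sin_nonpos_of_nonpos_of_neg_pi_le (x := θ / 2 - φ) (by linarith)
        (by linarith)
      rcases h' with h' | h' <;> linarith

lemma mem_dihedron_pi_iff (y : E3) : y ∈ dihedron Real.pi ↔ 0 < y 0 := by
  rw [mem_dihedron_iff_and Real.pi_pos le_rfl]
  simp

/-- The linear change of coordinates that turns the two linear forms bounding a dihedron into the
first two coordinates. -/
def pairChange (s c : ℝ) (hs : s ≠ 0) (hc : c ≠ 0) : E3 ≃L[ℝ] E3 :=
  LinearEquiv.toContinuousLinearEquiv
    { toFun := fun z => !₂[s * z 0 + c * z 1, s * z 0 - c * z 1, z 2]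
      invFun := fun w => !₂[(w 0 + w 1) / (2 * s), (w 0 - w 1) / (2 * c), w 2]
      map_add' := fun z w => by ext i; fin_cases i <;> simp <;> ring
      map_smul' := fun a z => by ext i; fin_cases i <;> simp <;> ring
      left_inv := fun z => by ext i; fin_cases i <;> simp <;> field_simp <;> ring
      right_inv := fun z => by ext i; fin_cases i <;> simp <;> field_simp <;> ring }

lemma IsSmoothChartAt.transLinear {Φ : OpenPartialHomeomorph E3 E3} {x : E3}
    (h : IsSmoothChartAt Φ x) (Λ : E3 ≃L[ℝ] E3) :
    IsSmoothChartAt (Φ.transHomeomorph Λ.toHomeomorph) x := by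
  refine ⟨h.1, ?_, ?_, ?_⟩
  · change Λ (Φ x) = 0
    rw [h.2.1, map_zero]
  · exact Λ.contDiff.comp_contDiffOn h.2.2.1
  · exact h.2.2.2.comp Λ.symm.contDiff.contDiffOn fun z hz => hz

namespace PolyhedralCone

variable {n : ℕ} (K : PolyhedralCone n)

lemma exists_isCornerChart_of_mem_face {k : Fin n} {x : E3} (hx : x ∈ K.face k) :
    ∃ Φ τ, K.IsCornerChart Φ τ x := by
  obtain ⟨Φ, hΦ, h⟩ := K.face_chart k x hx
  refine ⟨Φ, CornerType.half, hΦ, fun y hy => (h y hy).1, fun j => Or.inl ?_⟩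
  exact K.r_pos_of_notMem (fun h0 => K.zero_notMem_face k (h0 ▸ hx))
    fun hj => (K.disjoint_edge_face j k).le_bot ⟨hj, hx⟩

lemma exists_isCornerChart_of_mem_edge {j : Fin n} {x : E3} (hx : x ∈ K.edge j) :
    ∃ Φ τ, K.IsCornerChart Φ τ x := by
  have hx0 : x ≠ 0 := by
    obtain ⟨t, ht, rfl⟩ := hx
    rw [← norm_pos_iff, norm_smul, K.norm_edgeDir]
    simp [ht.ne']
  have hother : ∀ i, i ≠ j → 0 < K.r i x := by
    intro i hij
    refine K.r_pos_of_notMem hx0 fun hi => hij ?_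
    obtain ⟨t, ht, rfl⟩ := hx
    obtain ⟨s, hs, hts⟩ := hi
    have h1 := congrArg norm hts
    rw [norm_smul, norm_smul, K.norm_edgeDir, K.norm_edgeDir, Real.norm_of_nonneg ht.le,
      Real.norm_of_nonneg hs.le, mul_one, mul_one] at h1
    subst h1
    exact K.edgeDir_injective (smul_right_injective E3 ht.ne' hts).symm
  obtain ⟨θ, hθ0, hθ2, Φ, hΦ, h⟩ := K.edge_chart j x hx
  have hpi := Real.pi_pos
  have hs : 0 < Real.sin (θ / 2) := Real.sin_pos_of_pos_of_lt_pi (by linarith) (by linarith)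
  by_cases hθ : θ = Real.pi
  · subst hθ
    refine ⟨Φ, CornerType.half, hΦ, fun y hy => ?_, fun i => ?_⟩
    · rw [(h y hy).1, mem_dihedron_pi_iff]; rfl
    · by_cases hij : i = j
      · subst hij; exact Or.inr fun y hy => (h y hy).2
      · exact Or.inl (hother i hij)
  have hc : Real.cos (θ / 2) ≠ 0 := by
    rcases lt_or_gt_of_ne hθ with h1 | h1
    · exact (Real.cos_pos_of_mem_Ioo ⟨by linarith, by linarith⟩).ne'
    · exact (Real.cos_neg_of_pi_div_two_lt_of_lt (by linarith) (by linarith)).ne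
  set Λ := pairChange _ _ hs.ne' hc
  have hedge : ∀ i, 0 < K.r i x ∨ ∀ y ∈ (Φ.transHomeomorph Λ.toHomeomorph).source,
      y ∈ K.edge i ↔ (Φ.transHomeomorph Λ.toHomeomorph) y 0 = 0 ∧
        (Φ.transHomeomorph Λ.toHomeomorph) y 1 = 0 := by
    intro i
    by_cases hij : i = j
    · subst hij
      refine Or.inr fun y hy => ((h y hy).2).trans ?_
      change _ ↔ Real.sin (θ / 2) * Φ y 0 + Real.cos (θ / 2) * Φ y 1 = 0 ∧
        Real.sin (θ / 2) * Φ y 0 - Real.cos (θ / 2) * Φ y 1 = 0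
      constructor
      · rintro ⟨e0, e1⟩; rw [e0, e1]; simp
      · rintro ⟨e0, e1⟩
        have h1 : Real.sin (θ / 2) * Φ y 0 = 0 := by linarith
        have h2 : Real.cos (θ / 2) * Φ y 1 = 0 := by linarith
        exact ⟨(mul_eq_zero.1 h1).resolve_left hs.ne', (mul_eq_zero.1 h2).resolve_left hc⟩
    · exact Or.inl (hother i hij)
  rcases lt_or_gt_of_ne hθ with h1 | h1
  · refine ⟨Φ.transHomeomorph Λ.toHomeomorph, CornerType.inter, hΦ.transLinear Λ,
      fun y hy => ?_, hedge⟩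
    rw [(h y hy).1, mem_dihedron_iff_and hθ0 h1.le]; rfl
  · refine ⟨Φ.transHomeomorph Λ.toHomeomorph, CornerType.union, hΦ.transLinear Λ,
      fun y hy => ?_, hedge⟩
    rw [(h y hy).1, mem_dihedron_iff_or h1 hθ2]; rfl

/-- Every point of the closed cone except the vertex has a neighbourhood with a local extension
operator. -/
lemma exists_localExt_of_mem_closure {x : E3} (hx : x ∈ closure K.carrier) (hx0 : x ≠ 0) (l : ℕ)
    {A : Set E3} (hA : IsOpen A) (hxA : x ∈ A) {a b : ℝ} (ha : 0 < a)
    (hAa : ∀ x ∈ A, a < ‖x‖ ∧ ‖x‖ < b) :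
    ∃ U, IsOpen U ∧ x ∈ U ∧ U ⊆ A ∧ Nonempty (K.LocalExt l (K.carrier ∩ A) univ U) := by
  by_cases hxK : x ∈ K.carrier
  · exact ⟨K.carrier ∩ A, K.isOpen_carrier.inter hA, ⟨hxK, hxA⟩, inter_subset_right,
      nonempty_localExt_id l (K.isOpen_carrier.inter hA) inter_subset_left (r := b)
      fun y hy => by simpa using (hAa y hy.2).2.le⟩
  have hchart : ∃ Φ τ, K.IsCornerChart Φ τ x := by
    have hf : x ∈ frontier K.carrier := by
      rw [K.isOpen_carrier.frontier_eq]; exact ⟨hx, hxK⟩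
    rw [K.frontier_carrier] at hf
    rcases hf with (hf | hf) | hf
    · exact absurd hf hx0
    · obtain ⟨j, hj⟩ := mem_iUnion.1 hf
      exact K.exists_isCornerChart_of_mem_edge hj
    · obtain ⟨k, hk⟩ := mem_iUnion.1 hf
      exact K.exists_isCornerChart_of_mem_face hk
  obtain ⟨Φ, τ, h⟩ := hchart
  obtain ⟨U, hxU, hUA, ⟨L⟩⟩ := h.exists_localExt l hA hxA ha hAa
  exact ⟨U, L.isOpen, hxU, hUA, ⟨L⟩⟩

end PolyhedralCone

/-! ### Gluing local extension operators -/

namespace PolyhedralCone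

variable {n : ℕ} (K : PolyhedralCone n)

/-- The functions of class `C^l` with compact support away from the singular set. -/
def IsAdm (l : ℕ) (v : E3 → ℝ) : Prop :=
  ContDiff ℝ l v ∧ HasCompactSupport v ∧ Disjoint (tsupport v) K.singularSet

/-- There is a linear extension operator from `D` to `D'` on functions of class `C^l` with compact
support away from the singular set, bounded in the weighted Sobolev norms. -/
def HasExtension (J : Finset (Fin n)) (l : ℕ) (q β : ℝ) (δ : Fin n → ℝ) (D D' : Set E3) : Prop :=
  ∃ T : (E3 → ℝ) →ₗ[ℝ] (E3 → ℝ), (∀ v, K.IsAdm l v → K.IsAdm l (T v)) ∧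
    (∀ v, K.IsAdm l v → ∀ x ∈ D, T v x = v x) ∧
    ∃ C : ℝ≥0∞, C ≠ ⊤ ∧ ∀ v, K.IsAdm l v →
      K.energy J l q β δ D' (T v) ≤ C * K.energy J l q β δ D v

variable {K}

lemma HasExtension.trans {J : Finset (Fin n)} {l : ℕ} {q β : ℝ} {δ : Fin n → ℝ}
    {D D' D'' : Set E3} (h : K.HasExtension J l q β δ D D') (h' : K.HasExtension J l q β δ D' D'')
    (hD : D ⊆ D') : K.HasExtension J l q β δ D D'' := by
  obtain ⟨T, ha, he, C, hC, hb⟩ := h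
  obtain ⟨T', ha', he', C', hC', hb'⟩ := h'
  refine ⟨T' ∘ₗ T, fun v hv => ha' _ (ha v hv), fun v hv x hx => ?_, C' * C,
    ENNReal.mul_ne_top hC' hC, fun v hv => ?_⟩
  · exact (he' _ (ha v hv) x (hD hx)).trans (he v hv x hx)
  · refine (hb' _ (ha v hv)).trans ?_
    rw [mul_assoc]
    exact mul_le_mul_right (hb v hv) _

/-- The support of an admissible function keeps a distance from the vertex and the edges. -/
lemma IsAdm.exists_bounds {l : ℕ} {v : E3 → ℝ} (hv : K.IsAdm l v) : ∃ ε > 0, ∃ M : ℝ,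
    ∀ y, v y ≠ 0 → ε ≤ K.rho y ∧ K.rho y ≤ M ∧ ∀ j, ε ≤ K.r j y := by
  obtain ⟨-, hc, hd⟩ := hv
  have hc : IsCompact (tsupport v) := hc
  have hlow : ∀ f : E3 → ℝ, Continuous f → (∀ y, y ∉ K.singularSet → 0 < f y) →
      ∃ ε > 0, ∀ y ∈ tsupport v, ε ≤ f y := by
    intro f hf hpos
    rcases (tsupport v).eq_empty_or_nonempty with he | hne
    · exact ⟨1, one_pos, by simp [he]⟩
    · obtain ⟨y, hy, hmin⟩ := hc.exists_isMinOn hne hf.continuousOn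
      exact ⟨f y, hpos y fun h => hd.le_bot ⟨hy, h⟩, fun z hz => hmin hz⟩
  obtain ⟨ε₀, hε₀, h₀⟩ := hlow K.rho K.continuous_rho fun y hy => K.rho_pos hy
  choose ε hε h using fun j => hlow (K.r j) (K.continuous_r j) fun y hy => K.r_pos hy
  obtain ⟨M, hM⟩ := hc.exists_bound_of_continuousOn K.continuous_rho.continuousOn
  have hmin : ∃ e > 0, ∀ j, e ≤ ε j := by
    rcases isEmpty_or_nonempty (Fin n) with hn | hn
    · exact ⟨1, one_pos, fun j => (hn.false j).elim⟩
    · obtain ⟨j, hj⟩ := Finite.exists_min ε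
      exact ⟨ε j, hε j, hj⟩
  obtain ⟨e, he, hej⟩ := hmin
  refine ⟨min ε₀ e, lt_min hε₀ he, M, fun y hy => ?_⟩
  have hyt := subset_tsupport v hy
  exact ⟨(min_le_left _ _).trans (h₀ y hyt), (le_abs_self _).trans (hM y hyt),
    fun j => (min_le_right _ _).trans ((hej j).trans (h j y hyt))⟩

/-- If every point of the support of `w` is comparable to a point of the support of an admissible
function, then `w` has compact support away from the singular set. -/
lemma IsAdm.support_of_comparable {l : ℕ} {v w : E3 → ℝ} (hv : K.IsAdm l v) {B : ℝ} (hB : 1 ≤ B)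
    (h : ∀ x, w x ≠ 0 → ∃ y, v y ≠ 0 ∧ K.Comparable B x y) :
    HasCompactSupport w ∧ Disjoint (tsupport w) K.singularSet := by
  obtain ⟨ε, hε, M, hb⟩ := hv.exists_bounds
  have hB0 : 0 < B := by linarith
  set F : Set E3 := {x | ε ≤ B * K.rho x ∧ K.rho x ≤ B * M ∧ ∀ j, ε ≤ B * K.r j x} with hF
  have hFc : IsClosed F := by
    have h1 : F = {x | ε ≤ B * K.rho x} ∩ ({x | K.rho x ≤ B * M} ∩ ⋂ j, {x | ε ≤ B * K.r j x}) := by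
      ext x; simp [hF]
    rw [h1]
    exact (isClosed_le continuous_const (continuous_const.mul K.continuous_rho)).inter
      ((isClosed_le K.continuous_rho continuous_const).inter (isClosed_iInter fun j =>
        isClosed_le continuous_const (continuous_const.mul (K.continuous_r j))))
  have hsub : tsupport w ⊆ F := by
    refine closure_minimal (fun x hx => ?_) hFc
    obtain ⟨y, hy, hxy⟩ := h x hx
    obtain ⟨h1, h2, h3⟩ := hb y hy
    exact ⟨h1.trans hxy.1.2, hxy.1.1.trans (mul_le_mul_of_nonneg_left h2 hB0.le),
      fun j => (h3 j).trans (hxy.2 j).2⟩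
  constructor
  · refine HasCompactSupport.of_support_subset_isCompact (isCompact_closedBall (0 : E3) (B * M)) ?_
    intro x hx
    have := (hsub (subset_tsupport w hx)).2.1
    rwa [rho_eq_norm, ← mem_closedBall_zero_iff] at this
  · rw [Set.disjoint_left]
    intro x hx hS
    obtain ⟨h1, -, h3⟩ := hsub hx
    rcases hS with hS | hS
    · rw [hS, rho_eq_norm, norm_zero, mul_zero] at h1
      linarith
    · obtain ⟨j, hj⟩ := mem_iUnion.1 hS
      have := h3 j
      rw [K.r_eq_zero_of_mem_edge hj, mul_zero] at this
      linarith

/-- Local extension operators are glued by means of cut-off functions. -/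
lemma exists_glued_operator {l : ℕ} {D D' : Set E3} (hD : MeasurableSet D) (hD' : MeasurableSet D')
    {κ : Type} [Fintype κ] {U : κ → Set E3} (L : ∀ i, K.LocalExt l D D' (U i)) {χ : κ → E3 → ℝ}
    (hχ : ∀ i, ContDiff ℝ ∞ (χ i)) (hχc : ∀ i, HasCompactSupport (χ i))
    (hχU : ∀ i, tsupport (χ i) ⊆ U i) (J : Finset (Fin n)) {q : ℝ} (hq : 1 ≤ q) (β : ℝ)
    (δ : Fin n → ℝ) : ∃ T : (E3 → ℝ) →ₗ[ℝ] (E3 → ℝ), ∃ B : ℝ, 1 ≤ B ∧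
      (∀ v, ContDiff ℝ l v → ContDiff ℝ l (T v)) ∧
      (∀ v, ∀ x ∈ D, T v x = (∑ i, χ i x) * v x) ∧
      (∀ v x, T v x ≠ 0 → (∃ i, χ i x ≠ 0) ∧ ∃ y, v y ≠ 0 ∧ K.Comparable B x y) ∧
      ∃ C : ℝ≥0∞, C ≠ ⊤ ∧ ∀ v, ContDiff ℝ l v →
        K.energy J l q β δ D' (T v) ≤ C * K.energy J l q β δ D v := by
  set T : (E3 → ℝ) →ₗ[ℝ] (E3 → ℝ) := ∑ i, LinearMap.mulLeft ℝ (χ i) ∘ₗ (L i).op with hT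
  have hTx : ∀ v, T v = fun x => ∑ i, χ i x * (L i).op v x := by
    intro v; funext x
    simp [hT, LinearMap.sum_apply, Finset.sum_apply]
  have hBi : ∀ i, (L i).B ≤ 1 + ∑ i, (L i).B := fun i => by
    have := Finset.single_le_sum (f := fun i => (L i).B)
      (fun i _ => zero_le_one.trans (L i).one_le_B) (Finset.mem_univ i)
    linarith
  have hsupp : ∀ i x, χ i x ≠ 0 → x ∈ U i := fun i x h => hχU i (subset_tsupport _ h)
  choose C hC hCe using fun i => (L i).exists_energy_le hD hD' (hχ i) (hχc i) (hχU i) J hq β δ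
  refine ⟨T, 1 + ∑ i, (L i).B, ?_, fun v hv => ?_, fun v x hx => ?_, fun v x hne => ?_,
    (Fintype.card κ : ℝ≥0∞) ^ (q - 1) * ∑ i, C i, ?_, fun v hv => ?_⟩
  · have : 0 ≤ ∑ i, (L i).B := Finset.sum_nonneg fun i _ => zero_le_one.trans (L i).one_le_B
    linarith
  · rw [hTx]
    exact ContDiff.sum fun i _ => (L i).contDiff_mul (hχ i) (hχU i) hv
  · rw [hTx, Finset.sum_mul]
    refine Finset.sum_congr rfl fun i _ => ?_
    by_cases h : χ i x = 0
    · simp [h]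
    · rw [(L i).op_eq v x (hsupp i x h) hx]
  · rw [hTx] at hne
    obtain ⟨i, -, hi⟩ := Finset.exists_ne_zero_of_sum_ne_zero hne
    have h1 := left_ne_zero_of_mul hi
    obtain ⟨o, ho⟩ := (L i).exists_ne_zero v x (hsupp i x h1) (right_ne_zero_of_mul hi)
    exact ⟨⟨i, h1⟩, (L i).R o x, ho, ((L i).comparable o x (hsupp i x h1)).mono K (hBi i)⟩
  · exact ENNReal.mul_ne_top (ENNReal.rpow_ne_top_of_nonneg (by linarith) (by simp))
      (ENNReal.sum_ne_top.2 fun i _ => hC i)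
  · rw [hTx]
    refine (K.energy_sum_le J l hq β δ D' Finset.univ (fun i x => χ i x * (L i).op v x)
      fun i _ => (L i).contDiff_mul (hχ i) (hχU i) hv).trans ?_
    rw [Finset.card_univ, mul_assoc, Finset.sum_mul]
    gcongr with i
    exact hCe i v hv

end PolyhedralCone

/-! ### Dyadic decomposition of the cone -/

namespace PolyhedralCone

variable {n : ℕ} {K : PolyhedralCone n}

/-- A radial cut-off that is `1` on the unit ball and vanishes outside the ball of radius `2`. -/
def radialBump : ContDiffBump (0 : E3) := ⟨1, 2, one_pos, one_lt_two⟩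

lemma radialBump_eq_one {x : E3} (hx : ‖x‖ ≤ 1) : radialBump x = 1 :=
  radialBump.one_of_mem_closedBall (mem_closedBall_zero_iff.2 hx)

lemma radialBump_eq_zero {x : E3} (hx : 2 ≤ ‖x‖) : radialBump x = 0 :=
  radialBump.zero_of_le_dist (by rw [dist_zero_right]; exact hx)

/-- The dyadic cut-off `η`, supported in `1 ≤ |x| ≤ 4`, with `∑ η(2^{-k} x) = 1` for `x ≠ 0`. -/
def shellBump (x : E3) : ℝ := radialBump ((2 : ℝ)⁻¹ • x) - radialBump x

lemma contDiff_shellBump : ContDiff ℝ ∞ shellBump :=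
  (radialBump.contDiff.comp (contDiff_const_smul _)).sub radialBump.contDiff

lemma norm_mem_of_shellBump_ne_zero {x : E3} (h : shellBump x ≠ 0) : 1 ≤ ‖x‖ ∧ ‖x‖ ≤ 4 := by
  have hn : ‖(2 : ℝ)⁻¹ • x‖ = ‖x‖ / 2 := by rw [norm_smul]; norm_num; ring
  constructor
  · by_contra hx
    push Not at hx
    refine h ?_
    rw [shellBump, radialBump_eq_one hx.le, radialBump_eq_one (by rw [hn]; linarith), sub_self]
  · by_contra hx
    push Not at hx
    refine h ?_
    rw [shellBump, radialBump_eq_zero (x := x) (by linarith),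
      radialBump_eq_zero (by rw [hn]; linarith), sub_self]

/-- The spherical shell around the support of `shellBump`. -/
def shell : Set E3 := {x | 1 / 2 < ‖x‖ ∧ ‖x‖ < 8}

lemma isOpen_shell : IsOpen shell :=
  (isOpen_lt continuous_const continuous_norm).inter (isOpen_lt continuous_norm continuous_const)

/-- The extension operator at unit scale. -/
lemma exists_shell_operator (K : PolyhedralCone n) (J : Finset (Fin n)) (l : ℕ) {q : ℝ}
    (hq : 1 ≤ q) (β : ℝ) (δ : Fin n → ℝ) : ∃ T : (E3 → ℝ) →ₗ[ℝ] (E3 → ℝ), ∃ B : ℝ, 1 ≤ B ∧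
      (∀ v, ContDiff ℝ l v → ContDiff ℝ l (T v)) ∧
      (∀ v, ∀ x ∈ K.carrier, T v x = shellBump x * v x) ∧
      (∀ v x, T v x ≠ 0 → (1 ≤ ‖x‖ ∧ ‖x‖ ≤ 4) ∧ ∃ y, v y ≠ 0 ∧ K.Comparable B x y) ∧
      ∃ C : ℝ≥0∞, C ≠ ⊤ ∧ ∀ v, ContDiff ℝ l v →
        K.energy J l q β δ univ (T v) ≤ C * K.energy J l q β δ (K.carrier ∩ shell) v := by
  set Z : Set E3 := closure K.carrier ∩ {x | 1 ≤ ‖x‖ ∧ ‖x‖ ≤ 4} with hZ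
  have hZcl : IsClosed Z := isClosed_closure.inter
    ((isClosed_le continuous_const continuous_norm).inter
      (isClosed_le continuous_norm continuous_const))
  have hZc : IsCompact Z := (isCompact_closedBall (0 : E3) 4).of_isClosed_subset hZcl
    fun x hx => mem_closedBall_zero_iff.2 hx.2.2
  have hloc : ∀ x ∈ Z, ∃ U, IsOpen U ∧ x ∈ U ∧ U ⊆ shell ∧
      Nonempty (K.LocalExt l (K.carrier ∩ shell) univ U) := fun x hx =>
    K.exists_localExt_of_mem_closure hx.1
      (fun h0 => by have := hx.2.1; rw [h0, norm_zero] at this; linarith) l isOpen_shell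
      ⟨by linarith [hx.2.1], by linarith [hx.2.2]⟩ (by norm_num) fun x hx => hx
  choose! U hUo hxU hUs hUL using hloc
  obtain ⟨t, htZ, htU⟩ := hZc.elim_nhds_subcover U fun x hx => (hUo x hx).mem_nhds (hxU x hx)
  obtain ⟨f, hf⟩ := SmoothPartitionOfUnity.exists_isSubordinate (modelWithCornersSelf ℝ E3) hZcl
    (fun i : t => U i) (fun i => hUo i (htZ i i.2)) (by simpa [iUnion_subtype] using htU)
  have hfc : ∀ i : t, ContDiff ℝ ∞ (f i) := fun i => (f i).contMDiff.contDiff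
  set χ : t → E3 → ℝ := fun i x => shellBump x * f i x with hχ
  have hχU : ∀ i, tsupport (χ i) ⊆ U i := fun i => (tsupport_mul_subset_right).trans (hf i)
  have hχ4 : ∀ i x, χ i x ≠ 0 → 1 ≤ ‖x‖ ∧ ‖x‖ ≤ 4 := fun i x h =>
    norm_mem_of_shellBump_ne_zero (left_ne_zero_of_mul h)
  obtain ⟨T, B, hB, h1, h2, h3, h4⟩ := exists_glued_operator
    (K.isOpen_carrier.inter isOpen_shell).measurableSet MeasurableSet.univ
    (fun i : t => (hUL i (htZ i i.2)).some) (χ := χ)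
    (fun i => contDiff_shellBump.mul (hfc i))
    (fun i => HasCompactSupport.of_support_subset_isCompact (isCompact_closedBall (0 : E3) 4)
      fun x hx => mem_closedBall_zero_iff.2 (hχ4 i x hx).2)
    hχU J hq β δ
  refine ⟨T, B, hB, h1, fun v x hx => ?_, fun v x hne => ?_, h4⟩
  · by_cases hη : shellBump x = 0
    · rw [hη, zero_mul]
      by_contra hne
      obtain ⟨⟨i, hi⟩, -⟩ := h3 v x hne
      exact hi (by simp [hχ, hη])
    · have hn := norm_mem_of_shellBump_ne_zero hη
      have hxZ : x ∈ Z := ⟨subset_closure hx, hn⟩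
      have hsum := f.sum_eq_one hxZ
      rw [finsum_eq_sum_of_fintype] at hsum
      rw [h2 v x ⟨hx, by linarith [hn.1], by linarith [hn.2]⟩]
      simp only [hχ]
      rw [← Finset.mul_sum, hsum, mul_one]
  · obtain ⟨⟨i, hi⟩, h⟩ := h3 v x hne
    exact ⟨hχ4 i x hi, h⟩

/-- Scaling of the energy. -/
lemma energy_comp_smul_le (J : Finset (Fin n)) (l : ℕ) {q : ℝ} (hq : 1 ≤ q) (β : ℝ)
    (δ : Fin n → ℝ) {D D' : Set E3} (hD : IsOpen D) (hD' : MeasurableSet D') {t : ℝ} (ht : 0 < t)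
    (hDD' : ∀ x ∈ D, t • x ∈ D') {v : E3 → ℝ} (hv : ContDiff ℝ l v) :
    K.energy J l q β δ D (fun x => v (t • x)) ≤
      ENNReal.ofReal (t ^ (-(q * (β - l) + 3))) * K.energy J l q β δ D' v := by
  rw [energy, energy, Finset.mul_sum]
  refine Finset.sum_le_sum fun m hm => ?_
  have hml : m ≤ l := Nat.lt_succ_iff.1 (Finset.mem_range.1 hm)
  set G : E3 → ℝ≥0∞ := fun y =>
    ENNReal.ofReal (K.weight J l q β δ m y) * ‖iteratedFDeriv ℝ m v y‖ₑ ^ q with hG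
  have hpt : ∀ x, ENNReal.ofReal (K.weight J l q β δ m x) *
      ‖iteratedFDeriv ℝ m (fun x => v (t • x)) x‖ₑ ^ q =
      ENNReal.ofReal (t ^ (-(q * (β - l)))) * G (t • x) := by
    intro x
    rw [iteratedFDeriv_comp_const_smul t (hv.of_le (by exact_mod_cast hml)), enorm_smul,
      ENNReal.mul_rpow_of_nonneg _ _ (by linarith), hG]
    simp only
    rw [K.weight_smul J l q β δ m ht, ENNReal.ofReal_mul (by positivity), ← mul_assoc, ← mul_assoc,
      ← mul_assoc, ← ENNReal.ofReal_mul (by positivity), ← Real.rpow_add ht]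
    have e1 : -(q * (β - l)) + q * (β - l + m) = m * q := by ring
    have e2 : ‖t ^ m‖ₑ ^ q = ENNReal.ofReal (t ^ (m * q)) := by
      rw [Real.enorm_eq_ofReal (by positivity), ENNReal.ofReal_rpow_of_nonneg (by positivity)
        (by linarith), ← Real.rpow_natCast, ← Real.rpow_mul ht.le]
    rw [e1, e2]
    ring
  have hcv : ∫⁻ x in D, D'.indicator G (t • x) ≤
      ENNReal.ofReal (t ^ (-(3 : ℝ))) * ∫⁻ y, D'.indicator G y := by
    refine lintegral_comp_le_of_det (R := fun x => t • x) hD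
      ((differentiable_id.const_smul t).differentiableOn)
      (fun x _ y _ h => smul_right_injective E3 ht.ne' h) (fun x _ => ?_) _
    have hf : fderiv ℝ (fun x : E3 => t • x) x = t • ContinuousLinearMap.id ℝ E3 :=
      ((hasFDerivAt_id x).const_smul t).fderiv
    have hid : LinearMap.det (ContinuousLinearMap.id ℝ E3 : E3 →ₗ[ℝ] E3) = 1 := LinearMap.det_id
    rw [hf, ContinuousLinearMap.det, ContinuousLinearMap.toLinearMap_smul, LinearMap.det_smul, hid,
      mul_one, finrank_euclideanSpace, Fintype.card_fin, abs_of_pos (by positivity),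
      Real.rpow_neg ht.le]
    norm_cast
    rw [inv_mul_cancel₀ (by positivity)]
  simp only [hpt]
  rw [lintegral_const_mul' _ _ ENNReal.ofReal_ne_top]
  have e3 : t ^ (-(q * (β - l) + 3)) = t ^ (-(q * (β - l))) * t ^ (-(3 : ℝ)) := by
    rw [← Real.rpow_add ht]; ring_nf
  rw [e3, ENNReal.ofReal_mul (by positivity), mul_assoc]
  gcongr
  rw [lintegral_indicator hD'] at hcv
  refine le_trans (setLIntegral_mono' hD.measurableSet fun x hx => ?_) hcv
  rw [indicator_of_mem (hDD' x hx)]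

/-- The operator `T`, transplanted to the scale `2^k`. -/
def dilate (T : (E3 → ℝ) →ₗ[ℝ] (E3 → ℝ)) (k : ℤ) (v : E3 → ℝ) (x : E3) : ℝ :=
  T (fun y => v ((2 : ℝ) ^ k • y)) ((2 : ℝ) ^ (-k) • x)

lemma dilate_add (T : (E3 → ℝ) →ₗ[ℝ] (E3 → ℝ)) (k : ℤ) (v w : E3 → ℝ) (x : E3) :
    dilate T k (v + w) x = dilate T k v x + dilate T k w x := by
  simp only [dilate]
  rw [← Pi.add_apply, ← map_add]
  rfl

lemma dilate_smul (T : (E3 → ℝ) →ₗ[ℝ] (E3 → ℝ)) (k : ℤ) (c : ℝ) (v : E3 → ℝ) (x : E3) :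
    dilate T k (c • v) x = c * dilate T k v x := by
  simp only [dilate]
  rw [← smul_eq_mul, ← Pi.smul_apply, ← map_smul]
  rfl

/-- The dyadic shell number `κ`, an open set; these sets cover the complement of the origin. -/
def dyadicShell (κ : ℤ) : Set E3 := {x | (2 : ℝ) ^ (κ - 1) < ‖x‖ ∧ ‖x‖ < 2 ^ (κ + 1)}

lemma isOpen_dyadicShell (κ : ℤ) : IsOpen (dyadicShell κ) :=
  (isOpen_lt continuous_const continuous_norm).inter (isOpen_lt continuous_norm continuous_const)

lemma exists_two_zpow_le {x : E3} (hx : x ≠ 0) :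
    ∃ κ : ℤ, (2 : ℝ) ^ κ ≤ ‖x‖ ∧ ‖x‖ < 2 ^ (κ + 1) := by
  obtain ⟨κ, h1, h2⟩ := exists_mem_Ico_zpow (norm_pos_iff.2 hx) (one_lt_two (α := ℝ))
  exact ⟨κ, h1, h2⟩

lemma mem_dyadicShell {x : E3} {κ : ℤ} (h1 : (2 : ℝ) ^ κ ≤ ‖x‖) (h2 : ‖x‖ < 2 ^ (κ + 1)) :
    x ∈ dyadicShell κ :=
  ⟨(zpow_lt_zpow_right₀ one_lt_two (by omega)).trans_le h1, h2⟩

lemma norm_two_zpow_smul (k : ℤ) (x : E3) : ‖(2 : ℝ) ^ k • x‖ = 2 ^ k * ‖x‖ := by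
  rw [norm_smul, Real.norm_of_nonneg (by positivity)]

lemma two_zpow_smul_smul (k : ℤ) (x : E3) : (2 : ℝ) ^ k • (2 : ℝ) ^ (-k) • x = x := by
  rw [smul_smul, ← zpow_add₀ two_ne_zero]
  simp

/-- On the shell number `κ` only three scales contribute. -/
lemma dilate_ne_zero {T : (E3 → ℝ) →ₗ[ℝ] (E3 → ℝ)}
    (hT : ∀ v x, T v x ≠ 0 → 1 ≤ ‖x‖ ∧ ‖x‖ ≤ 4) {κ k : ℤ} {v : E3 → ℝ} {x : E3}
    (hx : x ∈ dyadicShell κ) (h : dilate T k v x ≠ 0) : k ∈ Finset.Icc (κ - 2) κ := by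
  obtain ⟨h1, h2⟩ := hT _ _ h
  rw [norm_two_zpow_smul, zpow_neg, inv_mul_eq_div] at h1 h2
  have hk : (0 : ℝ) < 2 ^ k := by positivity
  rw [one_le_div hk] at h1
  rw [div_le_iff₀ hk] at h2
  have e4 : (4 : ℝ) * 2 ^ k = 2 ^ (k + 2) := by rw [zpow_add₀ two_ne_zero]; norm_num; ring
  rw [e4] at h2
  have a1 := (zpow_lt_zpow_iff_right₀ (one_lt_two (α := ℝ))).1 (h1.trans_lt hx.2)
  have a2 := (zpow_lt_zpow_iff_right₀ (one_lt_two (α := ℝ))).1 (hx.1.trans_le h2)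
  rw [Finset.mem_Icc]
  omega

/-- The sum over all scales. -/
def dyadicSum (T : (E3 → ℝ) →ₗ[ℝ] (E3 → ℝ)) (v : E3 → ℝ) (x : E3) : ℝ := ∑ᶠ k : ℤ, dilate T k v x

lemma dyadicSum_eq_sum {T : (E3 → ℝ) →ₗ[ℝ] (E3 → ℝ)}
    (hT : ∀ v x, T v x ≠ 0 → 1 ≤ ‖x‖ ∧ ‖x‖ ≤ 4) {κ : ℤ} (v : E3 → ℝ) {x : E3}
    (hx : x ∈ dyadicShell κ) : dyadicSum T v x = ∑ k ∈ Finset.Icc (κ - 2) κ, dilate T k v x :=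
  finsum_eq_sum_of_support_subset _ fun _ hk => Finset.mem_coe.2 (dilate_ne_zero hT hx hk)

lemma dyadicSum_zero {T : (E3 → ℝ) →ₗ[ℝ] (E3 → ℝ)}
    (hT : ∀ v x, T v x ≠ 0 → 1 ≤ ‖x‖ ∧ ‖x‖ ≤ 4) (v : E3 → ℝ) : dyadicSum T v 0 = 0 := by
  refine finsum_eq_zero_of_forall_eq_zero fun k => ?_
  by_contra h
  have := (hT _ _ h).1
  rw [smul_zero, norm_zero] at this
  linarith

lemma sum_shellBump {x : E3} {κ : ℤ} (h1 : (2 : ℝ) ^ κ ≤ ‖x‖) (h2 : ‖x‖ < 2 ^ (κ + 1)) :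
    ∑ k ∈ Finset.Icc (κ - 2) κ, shellBump ((2 : ℝ) ^ (-k) • x) = 1 := by
  have hI : Finset.Icc (κ - 2) κ = {κ - 2, κ - 1, κ} := by ext k; simp; omega
  have hs : ∀ k : ℤ, shellBump ((2 : ℝ) ^ (-k) • x) =
      radialBump ((2 : ℝ) ^ (-(k + 1)) • x) - radialBump ((2 : ℝ) ^ (-k) • x) := by
    intro k
    rw [shellBump, smul_smul, neg_add, zpow_add₀ two_ne_zero, zpow_neg_one, mul_comm]
  have hone : radialBump ((2 : ℝ) ^ (-(κ + 1)) • x) = 1 := by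
    refine radialBump_eq_one ?_
    rw [norm_two_zpow_smul, zpow_neg, inv_mul_eq_div, div_le_one (by positivity)]
    exact h2.le
  have hzero : radialBump ((2 : ℝ) ^ (-(κ - 2)) • x) = 0 := by
    refine radialBump_eq_zero ?_
    rw [norm_two_zpow_smul, zpow_neg, inv_mul_eq_div, le_div_iff₀ (by positivity)]
    refine le_trans (le_of_eq_of_le ?_ (zpow_le_zpow_right₀ (one_le_two (α := ℝ))
      (by omega : κ - 1 ≤ κ))) h1
    rw [show κ - 1 = 1 + (κ - 2) by ring, zpow_add₀ two_ne_zero, zpow_one]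
  rw [hI, Finset.sum_insert (by simp), Finset.sum_pair (by omega), hs, hs, hs, hone, hzero,
    show κ - 2 + 1 = κ - 1 by ring, show κ - 1 + 1 = κ by ring]
  ring

/-- The shells occurring in the bounds overlap boundedly. -/
lemma tsum_indicator_shell_le (D : Set E3) {F : E3 → ℝ≥0∞}
    (hF : Measurable F) :
    ∑' k : ℤ, ∫⁻ x in D ∩ {x | (2 : ℝ) ^ (-k) • x ∈ shell}, F x ≤ 4 * ∫⁻ x in D, F x := by
  have hm : ∀ k : ℤ, MeasurableSet {x : E3 | (2 : ℝ) ^ (-k) • x ∈ shell} := fun k =>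
    (isOpen_shell.preimage (continuous_const_smul _)).measurableSet
  have h1 : ∀ k : ℤ, ∫⁻ x in D ∩ {x | (2 : ℝ) ^ (-k) • x ∈ shell}, F x =
      ∫⁻ x in D, {x : E3 | (2 : ℝ) ^ (-k) • x ∈ shell}.indicator F x := by
    intro k
    rw [lintegral_indicator (hm k), Measure.restrict_restrict (hm k), inter_comm]
  simp_rw [h1]
  rw [← lintegral_tsum fun k => (hF.indicator (hm k)).aemeasurable,
    ← lintegral_const_mul' _ _ (by simp)]
  refine lintegral_mono fun x => ?_
  rcases eq_or_ne x 0 with rfl | hx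
  · have : ∀ k : ℤ, {x : E3 | (2 : ℝ) ^ (-k) • x ∈ shell}.indicator F 0 = 0 := by
      intro k
      refine indicator_of_notMem (fun h => ?_) _
      have := h.1
      rw [smul_zero, norm_zero] at this
      norm_num at this
    simp only [this, tsum_zero, zero_le]
  · obtain ⟨κ, hκ1, hκ2⟩ := exists_two_zpow_le hx
    rw [tsum_eq_sum (s := Finset.Icc (κ - 2) (κ + 1))]
    · refine (Finset.sum_le_card_nsmul _ _ (F x) fun k _ => indicator_le_self _ _ _).trans_eq ?_
      rw [Int.card_Icc, nsmul_eq_mul]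
      congr 1
      have : (κ + 1 + 1 - (κ - 2)).toNat = 4 := by omega
      rw [this]; norm_num
    · intro k hk
      refine indicator_of_notMem (fun h => hk ?_) _
      obtain ⟨h1, h2⟩ := h
      rw [norm_two_zpow_smul, zpow_neg, inv_mul_eq_div] at h1 h2
      have hk0 : (0 : ℝ) < 2 ^ k := by positivity
      rw [lt_div_iff₀ hk0] at h1
      rw [div_lt_iff₀ hk0] at h2
      have e1 : (1 / 2 : ℝ) * 2 ^ k = 2 ^ (k - 1) := by
        rw [zpow_sub₀ two_ne_zero, zpow_one]; ring
      have e8 : (8 : ℝ) * 2 ^ k = 2 ^ (k + 3) := by rw [zpow_add₀ two_ne_zero]; norm_num; ring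
      rw [e1] at h1
      rw [e8] at h2
      have a1 := (zpow_lt_zpow_iff_right₀ (one_lt_two (α := ℝ))).1 (h1.trans hκ2)
      have a2 := (zpow_lt_zpow_iff_right₀ (one_lt_two (α := ℝ))).1 (hκ1.trans_lt h2)
      rw [Finset.mem_Icc]
      omega

lemma tsum_energy_shell_le (J : Finset (Fin n)) (l : ℕ) (q β : ℝ) (δ : Fin n → ℝ) (D : Set E3)
    {v : E3 → ℝ} (hv : ContDiff ℝ l v) :
    ∑' k : ℤ, K.energy J l q β δ (D ∩ {x | (2 : ℝ) ^ (-k) • x ∈ shell}) v ≤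
      4 * K.energy J l q β δ D v := by
  simp only [energy]
  rw [Summable.tsum_finsetSum fun _ _ => ENNReal.summable, Finset.mul_sum]
  exact Finset.sum_le_sum fun m hm => tsum_indicator_shell_le D
    (K.measurable_energy_integrand J l q β δ (Nat.lt_succ_iff.1 (Finset.mem_range.1 hm)) hv)

/-- The energy of a dyadic sum is bounded by the sum of the energies of its terms. -/
lemma energy_dyadicSum_le {T : (E3 → ℝ) →ₗ[ℝ] (E3 → ℝ)}
    (hT : ∀ v x, T v x ≠ 0 → 1 ≤ ‖x‖ ∧ ‖x‖ ≤ 4) (J : Finset (Fin n)) (l : ℕ) {q : ℝ} (hq : 1 ≤ q)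
    (β : ℝ) (δ : Fin n → ℝ) {v : E3 → ℝ} (hv : ∀ k, ContDiff ℝ l (dilate T k v)) :
    K.energy J l q β δ univ (dyadicSum T v) ≤
      3 ^ (q - 1) * ∑' k : ℤ, K.energy J l q β δ univ (dilate T k v) := by
  simp only [energy]
  rw [Summable.tsum_finsetSum fun _ _ => ENNReal.summable, Finset.mul_sum]
  refine Finset.sum_le_sum fun m hm => ?_
  have hml : m ≤ l := Nat.lt_succ_iff.1 (Finset.mem_range.1 hm)
  rw [← lintegral_tsum fun k =>
    (K.measurable_energy_integrand J l q β δ hml (hv k)).aemeasurable,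
    ← lintegral_const_mul' _ _ (ENNReal.rpow_ne_top_of_nonneg (by linarith) (by simp))]
  have h0 : ∀ᵐ x : E3 ∂(volume.restrict univ), x ≠ 0 := by
    rw [Measure.restrict_univ]
    exact compl_mem_ae_iff.2 (measure_singleton 0)
  refine lintegral_mono_ae ?_
  filter_upwards [h0] with x hx
  obtain ⟨κ, h1, h2⟩ := exists_two_zpow_le hx
  have hev : dyadicSum T v =ᶠ[nhds x] fun y => ∑ k ∈ Finset.Icc (κ - 2) κ, dilate T k v y := by
    filter_upwards [(isOpen_dyadicShell κ).mem_nhds (mem_dyadicShell h1 h2)] with y hy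
      using dyadicSum_eq_sum hT v hy
  rw [(hev.iteratedFDeriv ℝ m).eq_of_nhds, iteratedFDeriv_fun_sum_apply fun k _ =>
    ((hv k).of_le (by exact_mod_cast hml)).contDiffAt]
  have hcard : (Finset.Icc (κ - 2) κ).card = 3 := by rw [Int.card_Icc]; omega
  calc _ ≤ ENNReal.ofReal (K.weight J l q β δ m x) *
        (3 ^ (q - 1) * ∑ k ∈ Finset.Icc (κ - 2) κ, ‖iteratedFDeriv ℝ m (dilate T k v) x‖ₑ ^ q) := by
        gcongr
        refine (ENNReal.rpow_le_rpow (enorm_sum_le _ _) (by linarith)).trans ?_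
        refine (ENNReal.rpow_sum_le_const_mul_sum_rpow _ _ hq).trans_eq ?_
        rw [hcard]; norm_num
    _ = 3 ^ (q - 1) * ∑ k ∈ Finset.Icc (κ - 2) κ, ENNReal.ofReal (K.weight J l q β δ m x) *
          ‖iteratedFDeriv ℝ m (dilate T k v) x‖ₑ ^ q := by
        rw [mul_left_comm, Finset.mul_sum]
    _ ≤ _ := by
        gcongr
        exact ENNReal.sum_le_tsum _

/-- The extension operator for the infinite cone. -/
theorem hasExtension_carrier (K : PolyhedralCone n) (J : Finset (Fin n)) (l : ℕ) {q : ℝ}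
    (hq : 1 ≤ q) (β : ℝ) (δ : Fin n → ℝ) : K.HasExtension J l q β δ K.carrier univ := by
  obtain ⟨T, B, hB, hTc, hTe, hTs, C, hC, hTb⟩ := exists_shell_operator K J l hq β δ
  have hT : ∀ v x, T v x ≠ 0 → 1 ≤ ‖x‖ ∧ ‖x‖ ≤ 4 := fun v x h => (hTs v x h).1
  have hdc : ∀ v, ContDiff ℝ l v → ∀ k, ContDiff ℝ l (dilate T k v) := fun v hv k =>
    (hTc _ (hv.comp (contDiff_const_smul _))).comp (contDiff_const_smul _)
  set E : (E3 → ℝ) →ₗ[ℝ] (E3 → ℝ) :=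
    { toFun := dyadicSum T
      map_add' := fun v w => by
        funext x
        rw [Pi.add_apply]
        rcases eq_or_ne x 0 with rfl | hx
        · simp only [dyadicSum_zero hT, add_zero]
        · obtain ⟨κ, h1, h2⟩ := exists_two_zpow_le hx
          have hm := mem_dyadicShell h1 h2
          simp only [dyadicSum_eq_sum hT _ hm, dilate_add, Finset.sum_add_distrib]
      map_smul' := fun c v => by
        funext x
        rw [Pi.smul_apply, RingHom.id_apply, smul_eq_mul]
        rcases eq_or_ne x 0 with rfl | hx
        · simp only [dyadicSum_zero hT, mul_zero]
        · obtain ⟨κ, h1, h2⟩ := exists_two_zpow_le hx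
          have hm := mem_dyadicShell h1 h2
          simp only [dyadicSum_eq_sum hT _ hm, dilate_smul, Finset.mul_sum] } with hE
  refine ⟨E, fun v hv => ?_, fun v _ x hx => ?_, 3 ^ (q - 1) * (C * 4),
    ENNReal.mul_ne_top (ENNReal.rpow_ne_top_of_nonneg (by linarith) (by simp))
      (ENNReal.mul_ne_top hC (by simp)), fun v hv => ?_⟩
  · have hsupp : ∀ x, dyadicSum T v x ≠ 0 → ∃ y, v y ≠ 0 ∧ K.Comparable B x y := by
      intro x hx
      obtain ⟨k, hk⟩ : ∃ k, dilate T k v x ≠ 0 := by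
        by_contra hcon
        push Not at hcon
        exact hx (finsum_eq_zero_of_forall_eq_zero hcon)
      obtain ⟨-, y, hy, hxy⟩ := hTs _ _ hk
      refine ⟨(2 : ℝ) ^ k • y, hy, ?_⟩
      have := hxy.smul K (t := (2 : ℝ) ^ k) (by positivity)
      rwa [two_zpow_smul_smul] at this
    obtain ⟨hc, hd⟩ := hv.support_of_comparable hB hsupp
    refine ⟨contDiff_iff_contDiffAt.2 fun x => ?_, hc, hd⟩
    rcases eq_or_ne x 0 with rfl | hx
    · have h0 : (0 : E3) ∉ tsupport (dyadicSum T v) := fun h =>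
        hd.le_bot ⟨h, K.zero_mem_singularSet⟩
      exact (contDiffAt_const (c := (0 : ℝ))).congr_of_eventuallyEq
        (notMem_tsupport_iff_eventuallyEq.1 h0)
    · obtain ⟨κ, h1, h2⟩ := exists_two_zpow_le hx
      refine (ContDiffAt.sum (s := Finset.Icc (κ - 2) κ)
        fun k _ => (hdc v hv.1 k).contDiffAt).congr_of_eventuallyEq ?_
      filter_upwards [(isOpen_dyadicShell κ).mem_nhds (mem_dyadicShell h1 h2)] with y hy
        using dyadicSum_eq_sum hT v hy
  · have hx0 : x ≠ 0 := fun h => K.zero_notMem_carrier (h ▸ hx)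
    obtain ⟨κ, h1, h2⟩ := exists_two_zpow_le hx0
    change dyadicSum T v x = v x
    rw [dyadicSum_eq_sum hT v (mem_dyadicShell h1 h2)]
    have hk : ∀ k : ℤ, dilate T k v x = shellBump ((2 : ℝ) ^ (-k) • x) * v x := by
      intro k
      rw [dilate, hTe _ _ (K.smul_mem_carrier x hx _ (by positivity)), two_zpow_smul_smul]
    simp only [hk]
    rw [← Finset.sum_mul, sum_shellBump h1 h2, one_mul]
  · have hterm : ∀ k : ℤ, K.energy J l q β δ univ (dilate T k v) ≤
        C * K.energy J l q β δ (K.carrier ∩ {x | (2 : ℝ) ^ (-k) • x ∈ shell}) v := by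
      intro k
      set s : ℝ := -(q * (β - l) + 3)
      have h2k : (0 : ℝ) < 2 ^ k := by positivity
      have h2k' : (0 : ℝ) < 2 ^ (-k) := by positivity
      have hvk : ContDiff ℝ l (fun y => v ((2 : ℝ) ^ k • y)) := hv.1.comp (contDiff_const_smul _)
      have a1 := K.energy_comp_smul_le J l hq β δ isOpen_univ MeasurableSet.univ h2k'
        (fun _ _ => mem_univ _) (hTc _ hvk)
      have a2 := hTb _ hvk
      have a3 := K.energy_comp_smul_le J l hq β δ (K.isOpen_carrier.inter isOpen_shell)
        (D' := K.carrier ∩ {x | (2 : ℝ) ^ (-k) • x ∈ shell})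
        (K.isOpen_carrier.measurableSet.inter
          (isOpen_shell.preimage (continuous_const_smul _)).measurableSet) h2k
        (fun x hx => ⟨K.smul_mem_carrier x hx.1 _ h2k, by
          rw [mem_ofPred_eq, smul_smul, ← zpow_add₀ two_ne_zero]; simpa using hx.2⟩) hv.1
      have hone : ENNReal.ofReal ((2 ^ (-k) : ℝ) ^ s) * ENNReal.ofReal ((2 ^ k : ℝ) ^ s) = 1 := by
        rw [← ENNReal.ofReal_mul (by positivity), ← Real.mul_rpow h2k'.le h2k.le,
          ← zpow_add₀ two_ne_zero]
        simp
      calc _ ≤ ENNReal.ofReal ((2 ^ (-k) : ℝ) ^ s) * (C * (ENNReal.ofReal ((2 ^ k : ℝ) ^ s) *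
            K.energy J l q β δ (K.carrier ∩ {x | (2 : ℝ) ^ (-k) • x ∈ shell}) v)) :=
            a1.trans (mul_le_mul_right (a2.trans (mul_le_mul_right a3 _)) _)
        _ = C * ((ENNReal.ofReal ((2 ^ (-k) : ℝ) ^ s) * ENNReal.ofReal ((2 ^ k : ℝ) ^ s)) *
            K.energy J l q β δ (K.carrier ∩ {x | (2 : ℝ) ^ (-k) • x ∈ shell}) v) := by ring
        _ = _ := by rw [hone, one_mul]
    refine (energy_dyadicSum_le hT J l hq β δ (hdc v hv.1)).trans ?_
    rw [mul_assoc]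
    refine mul_le_mul_right ?_ _
    refine (ENNReal.tsum_le_tsum hterm).trans ?_
    rw [ENNReal.tsum_mul_left, mul_assoc]
    exact mul_le_mul_right (tsum_energy_shell_le J l q β δ K.carrier hv.1) _

end PolyhedralCone

/-! ### Extension from a bounded cone to the infinite cone -/

/-- The radial map that scales `log (|x| / R)` by the factor `a`. -/
def radialMap (R a : ℝ) (x : E3) : E3 := (‖x‖ / R) ^ (a - 1) • x

lemma radialMap_one (R : ℝ) (x : E3) : radialMap R 1 x = x := by simp [radialMap]

lemma norm_radialMap {R : ℝ} (hR : 0 < R) (a : ℝ) {x : E3} (hx : x ≠ 0) :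
    ‖radialMap R a x‖ = R * (‖x‖ / R) ^ a := by
  have h : 0 < ‖x‖ / R := div_pos (norm_pos_iff.2 hx) hR
  rw [radialMap, norm_smul, Real.norm_of_nonneg (by positivity), Real.rpow_sub_one h.ne']
  field_simp

lemma radialMap_inv {R : ℝ} (hR : 0 < R) {a : ℝ} (ha : a ≠ 0) {x : E3} (hx : x ≠ 0) :
    radialMap R a⁻¹ (radialMap R a x) = x := by
  have h : 0 < ‖x‖ / R := div_pos (norm_pos_iff.2 hx) hR
  rw [radialMap, norm_radialMap hR a hx, mul_div_cancel_left₀ _ hR.ne', radialMap, smul_smul,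
    ← Real.rpow_mul h.le, ← Real.rpow_add h]
  have : a * (a⁻¹ - 1) + (a - 1) = 0 := by field_simp; ring
  rw [this, Real.rpow_zero, one_smul]

lemma contDiffAt_radialMap {R : ℝ} (hR : 0 < R) (a : ℝ) {x : E3} (hx : x ≠ 0) :
    ContDiffAt ℝ ∞ (radialMap R a) x := by
  have h : ‖x‖ / R ≠ 0 := (div_pos (norm_pos_iff.2 hx) hR).ne'
  exact (((contDiffAt_norm ℝ hx).div_const R).rpow_const_of_ne h).smul contDiffAt_id

/-- The defect of the radial reflection across the sphere of radius `R`. In the coordinates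
`s = log (|x| / R)` and `x / |x|` this is a reflection across the hyperplane `s = 0`. -/
lemma contDiffAt_radial_defect {l : ℕ} {R : ℝ} (hR : 0 < R) {v : E3 → ℝ} (hv : ContDiff ℝ l v)
    {x : E3} (hx : x ≠ 0) : ContDiffAt ℝ l (fun x => ∑ o : Option (Fin (l + 1)),
      defectCoeff (‖x‖ < R) o * v (radialMap R (reflFactor o) x)) x := by
  have hg : ContDiff ℝ l (fun y : ℝ × E3 => v (Real.exp y.1 • y.2)) :=
    hv.comp ((Real.contDiff_exp.comp contDiff_fst).smul contDiff_snd)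
  have hN := contDiff_ite_sum_scaleAlong (-ContinuousLinearMap.fst ℝ ℝ E3) ((-1, 0) : ℝ × E3)
    reflFactor (fun o => idCoeff o - optReflCoeff o) (reflection_moments (l := l)) hg
  have hl : (l : ℕ∞ω) ≤ (∞ : ℕ∞ω) := by exact_mod_cast le_top
  have hR0 : ‖x‖ / R ≠ 0 := (div_pos (norm_pos_iff.2 hx) hR).ne'
  have hc : ContDiffAt ℝ ∞ (fun x : E3 => (Real.log (‖x‖ / R), (R / ‖x‖) • x)) x :=
    (((contDiffAt_norm ℝ hx).div_const R).log hR0).prodMk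
      ((contDiffAt_const.div (contDiffAt_norm ℝ hx) (norm_ne_zero_iff.2 hx)).smul contDiffAt_id)
  refine (hN.contDiffAt.comp x (hc.of_le hl)).congr_of_eventuallyEq ?_
  filter_upwards [isOpen_ne.mem_nhds hx] with y hy
  have hy0 : 0 < ‖y‖ := norm_pos_iff.2 hy
  have hyR : 0 < ‖y‖ / R := div_pos hy0 hR
  have hlog : -Real.log (‖y‖ / R) ≤ 0 ↔ ¬ ‖y‖ < R := by
    rw [neg_nonpos, Real.log_nonneg_iff hyR, le_div_iff₀ hR, one_mul, not_lt]
  have hmap : ∀ a : ℝ, Real.exp (a * Real.log (‖y‖ / R)) • (R / ‖y‖) • y = radialMap R a y := by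
    intro a
    rw [radialMap, smul_smul, mul_comm a, ← Real.rpow_def_of_pos hyR, Real.rpow_sub_one hyR.ne']
    congr 1
    field_simp
  simp only [Function.comp_apply, neg_apply, ContinuousLinearMap.coe_fst',
    scaleAlong_apply]
  by_cases h : ‖y‖ < R
  · rw [if_neg (by rw [hlog]; exact not_not.2 h)]
    simp [defectCoeff, h]
  · rw [if_pos (hlog.2 h)]
    refine Finset.sum_congr rfl fun o _ => ?_
    rw [defectCoeff, if_neg h, ← hmap]
    congr 3
    · simp; ring_nf
    · simp

namespace PolyhedralCone

variable {n : ℕ} {K : PolyhedralCone n}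

/-- The local extension operator across the sphere of radius `R`. -/
lemma nonempty_localExt_radial (K : PolyhedralCone n) (l : ℕ) {R : ℝ} (hR : 0 < R) :
    Nonempty (K.LocalExt l (K.carrier ∩ Metric.ball 0 R) K.carrier
      {x | R / 2 < ‖x‖ ∧ ‖x‖ < 2 * R}) := by
  set U : Set E3 := {x | R / 2 < ‖x‖ ∧ ‖x‖ < 2 * R} with hU
  have hU0 : ∀ x ∈ U, x ≠ 0 := fun x hx h => by
    have := hx.1; rw [h, norm_zero] at this; linarith
  have hUo : IsOpen U :=
    (isOpen_lt continuous_const continuous_norm).inter (isOpen_lt continuous_norm continuous_const)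
  set Z : Set E3 := {x | R / 2 ≤ ‖x‖ ∧ ‖x‖ ≤ 2 * R} with hZ
  have hZc : IsCompact Z := (isCompact_closedBall (0 : E3) (2 * R)).of_isClosed_subset
    ((isClosed_le continuous_const continuous_norm).inter
      (isClosed_le continuous_norm continuous_const)) fun x hx => mem_closedBall_zero_iff.2 hx.2
  have hZ0 : Z ⊆ {x | x ≠ 0} := fun x hx h => by
    have := hx.1; rw [h, norm_zero] at this; linarith
  have hUZ : U ⊆ Z := fun x hx => ⟨hx.1.le, hx.2.le⟩
  have hne : ∀ (a : ℝ) (x : E3), x ≠ 0 → radialMap R a x ≠ 0 := fun a x hx => by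
    have h : 0 < ‖x‖ / R := div_pos (norm_pos_iff.2 hx) hR
    exact smul_ne_zero (by positivity) hx
  have hRc : ∀ o : Option (Fin (l + 1)), ContDiffOn ℝ ∞ (radialMap R (reflFactor o)) {x | x ≠ 0} :=
    fun o x hx => (contDiffAt_radialMap hR _ hx).contDiffWithinAt
  choose B hB1 hB using fun o : Option (Fin (l + 1)) =>
    exists_bound_of_leftInverse l (isOpen_ne (x := (0 : E3))) hZc hZ0 (hRc o)
      (S := radialMap R (reflFactor o)⁻¹)
      (fun x hx => (contDiffAt_radialMap hR _ (hne _ x hx)).differentiableAt (by simp))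
      fun x hx => radialMap_inv hR (reflFactor_ne_zero o) hx
  have hcoeff : ∀ (s : Prop) (o : Option (Fin (l + 1))), |idCoeff o - defectCoeff s o| ≤
      ∑ o : Option (Fin (l + 1)), (|idCoeff o| + |optReflCoeff o|) := by
    intro s o
    have h1 := Finset.single_le_sum (f := fun o : Option (Fin (l + 1)) =>
      |idCoeff o| + |optReflCoeff o|) (fun _ _ => by positivity) (Finset.mem_univ o)
    refine le_trans ?_ h1
    by_cases hs : s
    · rw [idCoeff_sub_defectCoeff_pos hs]; simp
    · rw [idCoeff_sub_defectCoeff_neg hs]; simp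
  have hS1 : 0 ≤ ∑ o : Option (Fin (l + 1)), (|idCoeff o| + |optReflCoeff o|) :=
    Finset.sum_nonneg fun _ _ => by positivity
  have hS2 : 0 ≤ ∑ o, |B o| := Finset.sum_nonneg fun _ _ => abs_nonneg _
  have hP : (1 : ℝ) ≤ 2 ^ ((l : ℝ) + 2) := Real.one_le_rpow one_le_two (by positivity)
  set B' : ℝ := (∑ o, |B o|) + (∑ o : Option (Fin (l + 1)), (|idCoeff o| + |optReflCoeff o|)) +
    2 ^ ((l : ℝ) + 2) + 2 * R with hB'
  have hBo : ∀ o, B o ≤ B' := fun o => by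
    have := Finset.single_le_sum (f := fun o => |B o|) (fun _ _ => abs_nonneg _)
      (Finset.mem_univ o)
    linarith [le_abs_self (B o)]
  have hPB : 2 ^ ((l : ℝ) + 2) ≤ B' := by linarith
  have h1B : 1 ≤ B' := hP.trans hPB
  have hsphere : ∀ᵐ x : E3, ‖x‖ ≠ R := by
    have := Measure.addHaar_sphere volume (0 : E3) R
    filter_upwards [compl_mem_ae_iff.2 this] with x hx h
    exact hx (by simpa using h)
  -- the maps are dilations by bounded factors
  have hfac : ∀ (o : Option (Fin (l + 1))) (x : E3), x ∈ U →
      (‖x‖ / R) ^ (reflFactor o - 1) ≤ B' ∧ 1 ≤ B' * (‖x‖ / R) ^ (reflFactor o - 1) := by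
    intro o x hx
    have hx0 : 0 < ‖x‖ := norm_pos_iff.2 (hU0 x hx)
    have hq : 0 < ‖x‖ / R := div_pos hx0 hR
    have h1 : ‖x‖ / R ≤ 2 * 1 := by rw [div_le_iff₀ hR]; linarith [hx.2]
    have h2 : 1 ≤ 2 * (‖x‖ / R) := by
      rw [← mul_div_assoc, one_le_div hR]; linarith [hx.1]
    have hexp : (2 : ℝ) ^ |(reflFactor o : ℝ) - 1| ≤ B' := by
      refine le_trans (Real.rpow_le_rpow_of_exponent_le one_le_two ?_) hPB
      have := abs_sub (reflFactor o : ℝ) 1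
      have := abs_reflFactor_le o
      rw [abs_one] at *
      linarith
    have h3 := Real.rpow_le_of_comparable (t := reflFactor o - 1) hq.le zero_le_one one_le_two h1 h2
    have h4 := Real.rpow_le_of_comparable (t := reflFactor o - 1) zero_le_one hq.le one_le_two h2 h1
    rw [Real.one_rpow] at h3 h4
    refine ⟨by linarith, h4.trans ?_⟩
    exact mul_le_mul_of_nonneg_right hexp (by positivity)
  refine ⟨{
    ι := Option (Fin (l + 1))
    fintype := inferInstance
    op :=
      { toFun := fun v x => ∑ o : Option (Fin (l + 1)),
          (idCoeff o - defectCoeff (‖x‖ < R) o) * v (radialMap R (reflFactor o) x)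
        map_add' := fun v w => by
          funext x
          simp only [Pi.add_apply, mul_add, Finset.sum_add_distrib]
        map_smul' := fun c v => by
          funext x
          simp only [Pi.smul_apply, smul_eq_mul, Finset.mul_sum, RingHom.id_apply]
          exact Finset.sum_congr rfl fun o _ => by ring }
    R := fun o => radialMap R (reflFactor o)
    B := B'
    one_le_B := h1B
    isOpen := hUo
    contDiffOn_R := fun o => (hRc o).mono (hUZ.trans hZ0)
    injOn_R := fun o x hx y hy hxy => by
      rw [← radialMap_inv hR (reflFactor_ne_zero o) (hU0 x hx), hxy,
        radialMap_inv hR (reflFactor_ne_zero o) (hU0 y hy)]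
    norm_le := fun o x hx i _ hi => ((hB o x (hUZ hx)).1 i hi).trans (hBo o)
    det_le := fun o x hx => (hB o x (hUZ hx)).2.trans
      (mul_le_mul_of_nonneg_right (hBo o) (abs_nonneg _))
    comparable := fun o x hx => by
      obtain ⟨h1, h2⟩ := hfac o x hx
      have hpos : 0 < (‖x‖ / R) ^ ((reflFactor o : ℝ) - 1) := by
        have : 0 < ‖x‖ / R := div_pos (norm_pos_iff.2 (hU0 x hx)) hR
        positivity
      have key : ∀ t : ℝ, 0 ≤ t → t ≤ B' * ((‖x‖ / R) ^ ((reflFactor o : ℝ) - 1) * t) ∧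
          (‖x‖ / R) ^ ((reflFactor o : ℝ) - 1) * t ≤ B' * t := fun t ht => by
        refine ⟨?_, mul_le_mul_of_nonneg_right h1 ht⟩
        rw [← mul_assoc]
        exact le_mul_of_one_le_left ht h2
      refine ⟨?_, fun j => ?_⟩
      · rw [radialMap, K.rho_smul hpos]; exact key _ (K.rho_nonneg x)
      · rw [radialMap, K.r_smul hpos]; exact key _ (K.r_nonneg j x)
    rho_le := fun x hx => by rw [rho_eq_norm]; linarith [hx.2]
    ae_formula := by
      filter_upwards [hsphere] with x hxR hxU hxK
      have hx0 : 0 < ‖x‖ := norm_pos_iff.2 (hU0 x hxU)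
      refine ⟨fun o => idCoeff o - defectCoeff (‖x‖ < R) o,
        fun o => (hcoeff _ o).trans (by linarith), fun o ho => ⟨?_, ?_⟩, fun v => ?_⟩
      · refine K.smul_mem_carrier x hxK _ ?_
        have : 0 < ‖x‖ / R := div_pos hx0 hR
        positivity
      · beta_reduce at ho
        rw [mem_ball_zero_iff]
        by_cases h : ‖x‖ < R
        · rw [idCoeff_sub_defectCoeff_pos h] at ho
          rw [eq_none_of_idCoeff_ne_zero ho]
          simpa [reflFactor, radialMap_one] using h
        · rw [idCoeff_sub_defectCoeff_neg h] at ho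
          rw [norm_radialMap hR _ (hU0 x hxU)]
          have h1 : 1 < ‖x‖ / R := by
            rw [one_lt_div hR]; exact lt_of_le_of_ne (not_lt.1 h) (Ne.symm hxR)
          have := Real.rpow_lt_one_of_one_lt_of_neg h1 (reflFactor_neg_of_reflCoeff_ne_zero ho)
          nlinarith
      · have hev : ∀ᶠ y : E3 in nhds x, (‖y‖ < R) = (‖x‖ < R) := by
          rcases lt_or_gt_of_ne hxR with h | h
          · filter_upwards [(isOpen_lt continuous_norm continuous_const).mem_nhds h] with y hy
            exact propext ⟨fun _ => h, fun _ => hy⟩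
          · filter_upwards [(isOpen_lt continuous_const continuous_norm).mem_nhds h] with y hy
            have hy' : R < ‖y‖ := hy
            exact propext ⟨fun h' => absurd h' hy'.le.not_gt, fun h' => absurd h' h.le.not_gt⟩
        filter_upwards [hev] with y hy
        simp only [LinearMap.coe_mk, AddHom.coe_mk, hy]
    contDiffOn_op := fun v hv x hx => by
      have h1 : (fun x => ∑ o : Option (Fin (l + 1)),
          (idCoeff o - defectCoeff (‖x‖ < R) o) * v (radialMap R (reflFactor o) x)) =
          fun x => v x - ∑ o : Option (Fin (l + 1)),
            defectCoeff (‖x‖ < R) o * v (radialMap R (reflFactor o) x) := by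
        funext y
        simp only [sub_mul, Finset.sum_sub_distrib, sum_idCoeff_mul]
        rw [show reflFactor (none : Option (Fin (l + 1))) = 1 from rfl, radialMap_one]
      simp only [LinearMap.coe_mk, AddHom.coe_mk, h1]
      exact (hv.contDiffAt.sub (contDiffAt_radial_defect hR hv (hU0 x hx))).contDiffWithinAt
    op_eq := fun v x _ hxD => by
      have hx : ‖x‖ < R := mem_ball_zero_iff.1 hxD.2
      simp only [LinearMap.coe_mk, AddHom.coe_mk, idCoeff_sub_defectCoeff_pos (s := ‖x‖ < R) hx,
        sum_idCoeff_mul]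
      rw [show reflFactor (none : Option (Fin (l + 1))) = 1 from rfl, radialMap_one]
    exists_ne_zero := fun v x _ hne => by
      simp only [LinearMap.coe_mk, AddHom.coe_mk] at hne
      obtain ⟨o, -, ho⟩ := Finset.exists_ne_zero_of_sum_ne_zero hne
      exact ⟨o, right_ne_zero_of_mul ho⟩ }⟩

/-- The extension operator from a bounded cone to the infinite cone. -/
theorem hasExtension_carrier_inter_ball (K : PolyhedralCone n) (J : Finset (Fin n)) (l : ℕ) {q : ℝ}
    (hq : 1 ≤ q) (β : ℝ) (δ : Fin n → ℝ) {R : ℝ} (hR : 0 < R) :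
    K.HasExtension J l q β δ (K.carrier ∩ Metric.ball 0 R) K.carrier := by
  let f : ContDiffBump (0 : E3) := ⟨2 * R / 3, 3 * R / 4, by positivity, by linarith⟩
  let g : ContDiffBump (0 : E3) := ⟨R, 3 * R / 2, by positivity, by linarith⟩
  have hf1 : ∀ x : E3, ‖x‖ ≤ 2 * R / 3 → f x = 1 := fun x hx =>
    f.one_of_mem_closedBall (mem_closedBall_zero_iff.2 hx)
  have hg1 : ∀ x : E3, ‖x‖ ≤ R → g x = 1 := fun x hx =>
    g.one_of_mem_closedBall (mem_closedBall_zero_iff.2 hx)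
  have hf0 : ∀ x : E3, 3 * R / 4 ≤ ‖x‖ → f x = 0 := fun x hx =>
    f.zero_of_le_dist (by rw [dist_zero_right]; exact hx)
  have hg0 : ∀ x : E3, 3 * R / 2 ≤ ‖x‖ → g x = 0 := fun x hx =>
    g.zero_of_le_dist (by rw [dist_zero_right]; exact hx)
  obtain ⟨L0⟩ := nonempty_localExt_id (K := K) l (D := K.carrier ∩ Metric.ball 0 R)
    (D' := K.carrier) (Metric.isOpen_ball (x := (0 : E3)) (ε := R)) (fun x hx => ⟨hx.2, hx.1⟩)
    Metric.ball_subset_closedBall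
  obtain ⟨L1⟩ := nonempty_localExt_radial K l hR
  -- `f` lives well inside the ball; `g` is one on the ball, so that the cut-offs `f` and `g - f`
  -- add up to one there
  set U : Bool → Set E3 := fun b => if b then {x | R / 2 < ‖x‖ ∧ ‖x‖ < 2 * R} else Metric.ball 0 R
  set χ : Bool → E3 → ℝ := fun b => if b then fun x => g x - f x else f
  have hs1 : tsupport (fun x => g x - f x) ⊆ {x | 2 * R / 3 ≤ ‖x‖ ∧ ‖x‖ ≤ 3 * R / 2} := by
    refine closure_minimal (fun x hx => ?_) ((isClosed_le continuous_const continuous_norm).inter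
      (isClosed_le continuous_norm continuous_const))
    constructor
    · by_contra h
      push Not at h
      exact hx (by simp only [hf1 x h.le, hg1 x (by linarith), sub_self])
    · by_contra h
      push Not at h
      exact hx (by simp only [hf0 x (by linarith), hg0 x h.le, sub_self])
  obtain ⟨T, B, hB, h1, h2, h3, C, hC, h4⟩ := exists_glued_operator (K := K) (l := l)
    (K.isOpen_carrier.inter (Metric.isOpen_ball (x := (0 : E3)) (ε := R))).measurableSet
    K.isOpen_carrier.measurableSet (U := U) (χ := χ)
    (fun b => match b with
      | true => L1
      | false => L0)
    (fun b => match b with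
      | true => g.contDiff.sub f.contDiff
      | false => f.contDiff)
    (fun b => match b with
      | true => HasCompactSupport.of_support_subset_isCompact
          (isCompact_closedBall (0 : E3) (3 * R / 2)) fun x hx =>
            mem_closedBall_zero_iff.2 (hs1 (subset_tsupport _ hx)).2
      | false => f.hasCompactSupport)
    (fun b => match b with
      | true => fun x hx => ⟨by linarith [(hs1 hx).1], by linarith [(hs1 hx).2]⟩
      | false => fun x hx => by
          have hx' : x ∈ tsupport f := hx
          rw [f.tsupport_eq] at hx'
          refine Metric.closedBall_subset_ball ?_ hx'
          change 3 * R / 4 < R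
          linarith)
    J hq β δ
  refine ⟨T, fun v hv => ?_, fun v _ x hx => ?_, C, hC, fun v hv => h4 v hv.1⟩
  · exact ⟨h1 v hv.1, hv.support_of_comparable hB fun x hx => (h3 v x hx).2⟩
  · rw [h2 v x hx]
    have hx' : ‖x‖ < R := mem_ball_zero_iff.1 hx.2
    have : ∑ b, χ b x = 1 := by
      simp only [χ, Fintype.sum_bool, if_true, Bool.false_eq_true, if_false]
      rw [sub_add_cancel, hg1 x hx'.le]
    rw [this, one_mul]

end PolyhedralCone

/-! ### Mollification -/

open scoped Convolution in
/-- Convolution with an integrable function commutes with partial derivatives. -/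
lemma partialDeriv_convolution {k f : E3 → ℝ} (hk : LocallyIntegrable k) (hf : ContDiff ℝ 1 f)
    (hc : HasCompactSupport f) (i : Fin 3) :
    partialDeriv i (k ⋆[ContinuousLinearMap.lsmul ℝ ℝ] f) =
      k ⋆[ContinuousLinearMap.lsmul ℝ ℝ] partialDeriv i f := by
  funext x
  rw [partialDeriv,
    (hc.hasFDerivAt_convolution_right (ContinuousLinearMap.lsmul ℝ ℝ) hk hf x).fderiv]
  exact convolution_precompR_apply (ContinuousLinearMap.lsmul ℝ ℝ) hk (hc.fderiv ℝ)
    (hf.continuous_fderiv (by simp)) x _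

lemma tsupport_partialDeriv_subset (i : Fin 3) (f : E3 → ℝ) :
    tsupport (partialDeriv i f) ⊆ tsupport f := by
  refine (closure_mono fun x hx => ?_).trans (tsupport_fderiv_subset ℝ)
  exact fun h => hx (by rw [partialDeriv, h]; rfl)

lemma tsupport_wordDeriv_subset (L : List (Fin 3)) (f : E3 → ℝ) :
    tsupport (wordDeriv L f) ⊆ tsupport f := by
  induction L with
  | nil => exact subset_rfl
  | cons i L ih => exact (tsupport_partialDeriv_subset i _).trans ih

lemma tsupport_multiDeriv_subset (α : Fin 3 → ℕ) (f : E3 → ℝ) :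
    tsupport (multiDeriv α f) ⊆ tsupport f := by
  rw [multiDeriv_eq_wordDeriv]
  exact tsupport_wordDeriv_subset _ f

open scoped Convolution in
lemma wordDeriv_convolution {k f : E3 → ℝ} (hk : LocallyIntegrable k) (hc : HasCompactSupport f)
    {L : List (Fin 3)} (hf : ContDiff ℝ L.length f) :
    wordDeriv L (k ⋆[ContinuousLinearMap.lsmul ℝ ℝ] f) =
      k ⋆[ContinuousLinearMap.lsmul ℝ ℝ] wordDeriv L f := by
  induction L with
  | nil => rfl
  | cons i L ih =>
    rw [wordDeriv_cons, ih (hf.of_le (by simp)), wordDeriv_cons]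
    refine partialDeriv_convolution hk
      (ContDiff.wordDeriv_nat (k := 1) (by convert hf using 2; simp; ring)) ?_ i
    exact HasCompactSupport.of_support_subset_isCompact hc
      ((subset_tsupport _).trans (tsupport_wordDeriv_subset L f))

lemma contDiff_multiDeriv_of_le {l : ℕ} {f : E3 → ℝ} (hf : ContDiff ℝ l f) (α : MultiIdx l) :
    ContDiff ℝ (∑ i, α.toNat i : ℕ) f :=
  hf.of_le (by exact_mod_cast α.2)

lemma continuous_multiDeriv {l : ℕ} {f : E3 → ℝ} (hf : ContDiff ℝ l f) (α : MultiIdx l) :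
    Continuous (multiDeriv α.toNat f) :=
  (contDiff_multiDeriv_nat (k := 0) α.toNat
    (by simpa using contDiff_multiDeriv_of_le hf α)).continuous

open scoped Convolution in
/-- Functions of class `C^l` with compact support are approximated by smooth functions uniformly
together with the derivatives of order at most `l`, with control of the supports. -/
lemma exists_contDiff_approx {l : ℕ} {f : E3 → ℝ} (hf : ContDiff ℝ l f) (hc : HasCompactSupport f)
    {η ε : ℝ} (hη : 0 < η) (hε : 0 < ε) :
    ∃ g : E3 → ℝ, ContDiff ℝ ∞ g ∧ tsupport g ⊆ Metric.cthickening η (tsupport f) ∧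
      ∀ (α : MultiIdx l) (x : E3), ‖multiDeriv α.toNat g x - multiDeriv α.toNat f x‖ ≤ ε := by
  have huc : ∀ α : MultiIdx l, ∃ d > 0, ∀ x y : E3, dist x y < d →
      dist (multiDeriv α.toNat f x) (multiDeriv α.toNat f y) < ε := fun α => by
    have h1 : HasCompactSupport (multiDeriv α.toNat f) :=
      HasCompactSupport.of_support_subset_isCompact hc
        ((subset_tsupport _).trans (tsupport_multiDeriv_subset _ f))
    have h2 := h1.uniformContinuous_of_continuous (continuous_multiDeriv hf α)
    obtain ⟨d, hd, h⟩ := Metric.uniformContinuous_iff.1 h2 ε hε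
    exact ⟨d, hd, fun x y hxy => h hxy⟩
  choose d hd hdε using huc
  obtain ⟨r, hr, hrη, hrd⟩ : ∃ r > 0, r ≤ η ∧ ∀ α, r ≤ d α := by
    have : Nonempty (MultiIdx l) := ⟨⟨fun _ => 0, by simp⟩⟩
    obtain ⟨α, hα⟩ := Finite.exists_min d
    exact ⟨min η (d α), lt_min hη (hd α), min_le_left _ _,
      fun α' => (min_le_right _ _).trans (hα α')⟩
  let φ : ContDiffBump (0 : E3) := ⟨r / 2, r, by positivity, by linarith⟩
  have hφi : LocallyIntegrable (φ.normed volume) := φ.continuous_normed.locallyIntegrable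
  refine ⟨φ.normed volume ⋆[ContinuousLinearMap.lsmul ℝ ℝ] f, ?_, ?_, fun α x => ?_⟩
  · exact φ.hasCompactSupport_normed.contDiff_convolution_left _ φ.contDiff_normed
      hf.continuous.locallyIntegrable
  · refine closure_minimal (fun x hx => ?_) Metric.isClosed_cthickening
    obtain ⟨y, hy, z, hz, rfl⟩ := support_convolution_subset _ hx
    rw [φ.support_normed_eq, mem_ball_zero_iff] at hy
    refine Metric.mem_cthickening_of_dist_le _ z _ _ (subset_tsupport f hz) ?_
    simp only [dist_add_self_left]
    exact hy.le.trans hrη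
  · have h : multiDeriv α.toNat (φ.normed volume ⋆[ContinuousLinearMap.lsmul ℝ ℝ] f) =
        φ.normed volume ⋆[ContinuousLinearMap.lsmul ℝ ℝ] multiDeriv α.toNat f := by
      rw [multiDeriv_eq_wordDeriv, multiDeriv_eq_wordDeriv]
      refine wordDeriv_convolution hφi hc ?_
      convert contDiff_multiDeriv_of_le hf α using 2
      simp [Fin.sum_univ_three]; ring
    rw [h, ← dist_eq_norm]
    refine φ.dist_normed_convolution_le (continuous_multiDeriv hf α).aestronglyMeasurable
      fun y hy => (hdε α y x (hy.trans_le (hrd α))).le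

namespace PolyhedralCone

variable {n : ℕ} {K : PolyhedralCone n} {J : Finset (Fin n)} {l : ℕ} {p : ℝ≥0∞} {β : ℝ}
  {δ : Fin n → ℝ}

/-- The weights are bounded on compact sets away from the vertex and the edges. -/
lemma weightedMeasure_lt_top (D : Set E3) (m : ℕ) {Z : Set E3} (hZ : IsCompact Z)
    (hd : Disjoint Z K.singularSet) : K.weightedMeasure D J l p β δ m Z < ⊤ := by
  obtain ⟨C, hC⟩ := hZ.exists_bound_of_continuousOn
    ((K.continuousOn_weight (J := J) (l := l) (q := p.toReal) (β := β) (δ := δ) m).mono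
      hd.subset_compl_right)
  rw [weightedMeasure, withDensity_apply _ hZ.measurableSet]
  calc _ ≤ ∫⁻ x in Z, ENNReal.ofReal (K.weight J l p.toReal β δ m x) :=
        lintegral_mono' (Measure.restrict_mono subset_rfl Measure.restrict_le_self) le_rfl
    _ ≤ ∫⁻ _ in Z, ENNReal.ofReal C := setLIntegral_mono' hZ.measurableSet fun x hx =>
        ENNReal.ofReal_le_ofReal ((le_abs_self _).trans (hC x hx))
    _ < ⊤ := by
        rw [setLIntegral_const]
        exact ENNReal.mul_lt_top (by simp) hZ.measure_lt_top

lemma eLpNorm_weightedMeasure_le (D : Set E3) (m : ℕ) {Z : Set E3}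
    {f : E3 → ℝ} (hf : Function.support f ⊆ Z) {ε : ℝ} (hε : ∀ x, ‖f x‖ ≤ ε) :
    eLpNorm f p (K.weightedMeasure D J l p β δ m) ≤
      K.weightedMeasure D J l p β δ m Z ^ p.toReal⁻¹ * ENNReal.ofReal ε := by
  rw [← eLpNorm_restrict_eq_of_support_subset hf]
  refine (eLpNorm_le_of_ae_bound (Filter.Eventually.of_forall hε)).trans ?_
  rw [Measure.restrict_apply_univ]

lemma IsAdm.memLp {f : E3 → ℝ} (hf : K.IsAdm l f) (D : Set E3) (α : MultiIdx l) :
    MemLp (multiDeriv α.toNat f) p (K.weightedMeasure D J l p β δ α.order) := by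
  have hs := (subset_tsupport _).trans (tsupport_multiDeriv_subset α.toNat f)
  have hcont := continuous_multiDeriv hf.1 α
  obtain ⟨C, hC⟩ := hcont.bounded_above_of_compact_support
    (HasCompactSupport.of_support_subset_isCompact hf.2.1 hs)
  refine ⟨hcont.aestronglyMeasurable, ?_⟩
  refine (eLpNorm_weightedMeasure_le D _ hs hC).trans_lt (ENNReal.mul_lt_top ?_ (by simp))
  exact ENNReal.rpow_lt_top_of_nonneg (by positivity)
    (weightedMeasure_lt_top D _ hf.2.1 hf.2.2).ne

/-- The family of the derivatives of order at most `l` of an admissible function. -/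
def IsAdm.jet {f : E3 → ℝ} (hf : K.IsAdm l f) (D : Set E3) (J : Finset (Fin n)) (p : ℝ≥0∞) (β : ℝ)
    (δ : Fin n → ℝ) : K.JetSpace D J l p β δ :=
  WithLp.toLp p fun α => (hf.memLp D α).toLp

lemma IsAdm.coeFn_jet {f : E3 → ℝ} (hf : K.IsAdm l f) (D : Set E3) (α : MultiIdx l) :
    (hf.jet D J p β δ α : E3 → ℝ) =ᵐ[K.weightedMeasure D J l p β δ α.order]
      multiDeriv α.toNat f := (hf.memLp D α).coeFn_toLp

/-- Admissible functions, although only of class `C^l`, belong to the weighted Sobolev space: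
their mollifications converge to them. -/
lemma IsAdm.jet_mem_W [Fact (1 ≤ p)] {f : E3 → ℝ} (hf : K.IsAdm l f) (D : Set E3) :
    hf.jet D J p β δ ∈ K.W D J l p β δ := by
  obtain ⟨η, hη, hηS⟩ := hf.2.1.isCompact.exists_cthickening_subset_open
    K.isClosed_singularSet.isOpen_compl hf.2.2.subset_compl_right
  set Z := Metric.cthickening η (tsupport f) with hZ
  have hZc : IsCompact Z := hf.2.1.isCompact.cthickening
  have hZS : Disjoint Z K.singularSet := disjoint_left.2 fun x hx => hηS hx
  have hfZ : tsupport f ⊆ Z := Metric.self_subset_cthickening _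
  choose g hg hgZ hgf using fun k : ℕ => exists_contDiff_approx hf.1 hf.2.1 hη
    (Nat.one_div_pos_of_nat (α := ℝ) (n := k))
  have hga : ∀ k, K.IsAdm l (g k) := fun k => ⟨(hg k).of_le (by exact_mod_cast le_top),
    HasCompactSupport.of_support_subset_isCompact hZc ((subset_tsupport _).trans (hgZ k)),
    hZS.mono_left (hgZ k)⟩
  refine mem_closure_of_tendsto (f := fun k => (hga k).jet D J p β δ) (b := Filter.atTop) ?_
    (Filter.Eventually.of_forall fun k => ?_)
  · refine ((PiLp.continuous_toLp p _).tendsto _).comp (tendsto_pi_nhds.2 fun α => ?_)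
    refine (Lp.tendsto_Lp_iff_tendsto_eLpNorm'' _ (fun k => (hga k).memLp D α) _
      (hf.memLp D α)).2 ?_
    have h0 : Filter.Tendsto (fun k : ℕ => K.weightedMeasure D J l p β δ α.order Z ^ p.toReal⁻¹ *
        ENNReal.ofReal (1 / ((k : ℝ) + 1))) Filter.atTop (nhds 0) := by
      have := ENNReal.Tendsto.const_mul (a := K.weightedMeasure D J l p β δ α.order Z ^ p.toReal⁻¹)
        (ENNReal.tendsto_ofReal (tendsto_one_div_add_atTop_nhds_zero_nat (𝕜 := ℝ)))
        (Or.inr (ENNReal.rpow_lt_top_of_nonneg (by positivity)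
          (weightedMeasure_lt_top D _ hZc hZS).ne).ne)
      simpa using this
    refine tendsto_of_tendsto_of_tendsto_of_le_of_le tendsto_const_nhds h0 (fun _ => zero_le)
      fun k => eLpNorm_weightedMeasure_le D _ (fun x hx => ?_) (hgf k α)
    by_contra hxZ
    refine hx ?_
    rw [Pi.sub_apply, image_eq_zero_of_notMem_tsupport fun h => hxZ (hgZ k
      (tsupport_multiDeriv_subset _ _ h)), image_eq_zero_of_notMem_tsupport fun h => hxZ (hfZ
      (tsupport_multiDeriv_subset _ _ h)), sub_zero]
  · exact ⟨g k, hg k, (hga k).2.1, (hga k).2.2, fun α => (hga k).coeFn_jet D α⟩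

end PolyhedralCone

/-! ### The extension operator on the weighted Sobolev spaces -/

lemma Set.EqOn.multiDeriv {D : Set E3} (hD : IsOpen D) {f g : E3 → ℝ} (h : EqOn f g D)
    (α : Fin 3 → ℕ) : EqOn (multiDeriv α f) (multiDeriv α g) D := by
  have key : ∀ L : List (Fin 3), EqOn (wordDeriv L f) (wordDeriv L g) D := by
    intro L
    induction L with
    | nil => exact h
    | cons i L ih =>
      intro x hx
      rw [wordDeriv_cons, wordDeriv_cons, partialDeriv, partialDeriv,
        Filter.EventuallyEq.fderiv_eq (ih.eventuallyEq_of_mem (hD.mem_nhds hx))]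
  simp only [multiDeriv_eq_wordDeriv]
  exact key _

/-- Being a restriction is a closed condition in the Lebesgue spaces. -/
lemma isClosed_setOf_ae_eq_restrict {X : Type*} [MeasurableSpace X] {μ ν : Measure X}
    {D : Set X} (hν : ν = μ.restrict D) {p : ℝ≥0∞} [Fact (1 ≤ p)] :
    IsClosed {w : Lp ℝ p μ × Lp ℝ p ν | (w.1 : X → ℝ) =ᵐ[ν] w.2} := by
  subst hν
  have h : {w : Lp ℝ p μ × Lp ℝ p (μ.restrict D) | (w.1 : X → ℝ) =ᵐ[μ.restrict D] w.2} =
      {w | LpToLpRestrictCLM X ℝ ℝ μ p D w.1 = w.2} := by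
    ext w
    have h1 := LpToLpRestrictCLM_coeFn ℝ D w.1
    exact ⟨fun hw => Lp.ext (h1.trans hw), fun hw => h1.symm.trans (by rw [hw])⟩
  rw [h]
  exact isClosed_eq ((LpToLpRestrictCLM X ℝ ℝ μ p D).continuous.comp continuous_fst) continuous_snd

namespace PolyhedralCone

variable {n : ℕ} {K : PolyhedralCone n} {J : Finset (Fin n)} {l : ℕ} {p : ℝ≥0∞} {β : ℝ}
  {δ : Fin n → ℝ}

lemma weightedMeasure_univ_restrict {D : Set E3} (hD : MeasurableSet D) (m : ℕ) :
    K.weightedMeasure D J l p β δ m = (K.weightedMeasure univ J l p β δ m).restrict D := by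
  rw [weightedMeasure, weightedMeasure, restrict_withDensity hD, Measure.restrict_univ]

lemma absolutelyContinuous_weightedMeasure (D : Set E3) (m : ℕ) :
    volume.restrict D ≪ K.weightedMeasure D J l p β δ m := by
  refine withDensity_absolutelyContinuous'
    (K.measurable_weight J l _ β δ m).ennreal_ofReal.aemeasurable (ae_restrict_of_ae ?_)
  filter_upwards [K.ae_notMem_singularSet] with x hx
  exact (ENNReal.ofReal_pos.2 (K.weight_pos J l _ β δ m hx)).ne'

section Jet

variable [Fact (1 ≤ p)]

lemma enorm_jetSpace_rpow (hp : p ≠ ⊤) {D : Set E3} (V : K.JetSpace D J l p β δ) :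
    ‖V‖ₑ ^ p.toReal = ∑ α, ‖V α‖ₑ ^ p.toReal := by
  have h0 : 0 < p.toReal := ENNReal.toReal_pos (zero_lt_one.trans_le Fact.out).ne' hp
  rw [← edist_zero_right, PiLp.edist_eq_sum h0, ← ENNReal.rpow_mul, one_div,
    inv_mul_cancel₀ h0.ne', ENNReal.rpow_one]
  simp only [PiLp.zero_apply, edist_zero_right]

lemma IsAdm.enorm_jet_apply_rpow (hp : p ≠ ⊤) {f : E3 → ℝ} (hf : K.IsAdm l f) (D : Set E3)
    (α : MultiIdx l) : ‖hf.jet D J p β δ α‖ₑ ^ p.toReal =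
      ∫⁻ x in D, ENNReal.ofReal (K.weight J l p.toReal β δ α.order x) *
        ‖multiDeriv α.toNat f x‖ₑ ^ p.toReal := by
  have h1 : p ≠ 0 := (zero_lt_one.trans_le Fact.out).ne'
  have h0 : 0 < p.toReal := ENNReal.toReal_pos h1 hp
  rw [Lp.enorm_def, eLpNorm_congr_ae (hf.coeFn_jet D α),
    eLpNorm_eq_lintegral_rpow_enorm_toReal h1 hp, ← ENNReal.rpow_mul, one_div,
    inv_mul_cancel₀ h0.ne', ENNReal.rpow_one, weightedMeasure,
    lintegral_withDensity_eq_lintegral_mul _ (K.measurable_weight J l _ β δ _).ennreal_ofReal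
      ((continuous_multiDeriv hf.1 α).measurable.enorm.pow_const _)]
  rfl

/-- The weighted Sobolev norm is bounded by the energy. -/
lemma IsAdm.enorm_jet_rpow_le (hp : p ≠ ⊤) {f : E3 → ℝ} (hf : K.IsAdm l f) (D : Set E3) :
    ‖hf.jet D J p β δ‖ₑ ^ p.toReal ≤
      Fintype.card (MultiIdx l) * K.energy J l p.toReal β δ D f := by
  rw [enorm_jetSpace_rpow hp, ← nsmul_eq_mul, ← Finset.card_univ]
  refine Finset.sum_le_card_nsmul _ _ _ fun α _ => ?_
  rw [hf.enorm_jet_apply_rpow hp]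
  refine le_trans (lintegral_mono fun x => ?_) (Finset.single_le_sum (f := fun m =>
    ∫⁻ x in D, ENNReal.ofReal (K.weight J l p.toReal β δ m x) *
      ‖iteratedFDeriv ℝ m f x‖ₑ ^ p.toReal) (fun _ _ => zero_le)
    (Finset.mem_range.2 (Nat.lt_succ_iff.2 α.2)))
  refine mul_le_mul_right (ENNReal.rpow_le_rpow ?_ ENNReal.toReal_nonneg) _
  exact enorm_le_iff_norm_le.2 (abs_multiDeriv_le α.toNat rfl (contDiff_multiDeriv_of_le hf.1 α) x)

/-- The energy is bounded by the weighted Sobolev norm. -/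
lemma exists_energy_le_enorm_jet (hp : p ≠ ⊤) (K : PolyhedralCone n) (J : Finset (Fin n)) (l : ℕ)
    (β : ℝ) (δ : Fin n → ℝ) (D : Set E3) : ∃ C : ℝ≥0∞, C ≠ ⊤ ∧ ∀ f, ∀ hf : K.IsAdm l f,
      K.energy J l p.toReal β δ D f ≤ C * ‖hf.jet D J p β δ‖ₑ ^ p.toReal := by
  have hq : 1 ≤ p.toReal := by
    rw [← ENNReal.toReal_one]
    exact ENNReal.toReal_mono hp Fact.out
  refine ⟨∑ m ∈ Finset.range (l + 1), (Fintype.card (Fin m → Fin 3) : ℝ≥0∞) ^ (p.toReal - 1) *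
    Fintype.card (Fin m → Fin 3), ?_, fun f hf => ?_⟩
  · exact ENNReal.sum_ne_top.2 fun m _ => ENNReal.mul_ne_top
      (ENNReal.rpow_ne_top_of_nonneg (by linarith) (by simp)) (by simp)
  · rw [energy, Finset.sum_mul]
    refine Finset.sum_le_sum fun m hm => ?_
    have hml : m ≤ l := Nat.lt_succ_iff.1 (Finset.mem_range.1 hm)
    have hfm : ContDiff ℝ m f := hf.1.of_le (by exact_mod_cast hml)
    have hpt : ∀ x, ‖iteratedFDeriv ℝ m f x‖ₑ ^ p.toReal ≤
        (Fintype.card (Fin m → Fin 3) : ℝ≥0∞) ^ (p.toReal - 1) *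
          ∑ w : Fin m → Fin 3, ‖multiDeriv (MultiIdx.ofWord hml w).toNat f x‖ₑ ^ p.toReal := by
      intro x
      refine le_trans (ENNReal.rpow_le_rpow (z := p.toReal) (?_ : _ ≤
        ∑ w : Fin m → Fin 3, ‖multiDeriv (MultiIdx.ofWord hml w).toNat f x‖ₑ) (by linarith))
        (ENNReal.rpow_sum_le_const_mul_sum_rpow _ _ hq)
      have h := norm_iteratedFDeriv_le_sum_multiDeriv hml hfm x
      simp only [← ofReal_norm]
      rw [← ENNReal.ofReal_sum_of_nonneg fun _ _ => norm_nonneg _]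
      exact ENNReal.ofReal_le_ofReal h
    have hmeas : ∀ w : Fin m → Fin 3, Measurable fun x =>
        ENNReal.ofReal (K.weight J l p.toReal β δ m x) *
          ‖multiDeriv (MultiIdx.ofWord hml w).toNat f x‖ₑ ^ p.toReal := fun w =>
      (K.measurable_weight J l _ β δ _).ennreal_ofReal.mul
        ((continuous_multiDeriv hf.1 _).measurable.enorm.pow_const _)
    calc _ ≤ ∫⁻ x in D, (Fintype.card (Fin m → Fin 3) : ℝ≥0∞) ^ (p.toReal - 1) *
          ∑ w : Fin m → Fin 3, ENNReal.ofReal (K.weight J l p.toReal β δ m x) *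
            ‖multiDeriv (MultiIdx.ofWord hml w).toNat f x‖ₑ ^ p.toReal := by
          refine lintegral_mono fun x => (mul_le_mul_right (hpt x) _).trans_eq ?_
          rw [← Finset.mul_sum]; ring
      _ = (Fintype.card (Fin m → Fin 3) : ℝ≥0∞) ^ (p.toReal - 1) * ∑ w : Fin m → Fin 3,
          ‖hf.jet D J p β δ (MultiIdx.ofWord hml w)‖ₑ ^ p.toReal := by
          rw [lintegral_const_mul _ (Finset.measurable_sum _ fun w _ => hmeas w),
            lintegral_finsetSum _ fun w _ => hmeas w]
          congr 1
          refine Finset.sum_congr rfl fun w _ => ?_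
          rw [hf.enorm_jet_apply_rpow hp, MultiIdx.order_ofWord]
      _ ≤ _ := by
          rw [mul_assoc]
          refine mul_le_mul_right ?_ _
          rw [← nsmul_eq_mul, ← Finset.card_univ]
          refine Finset.sum_le_card_nsmul _ _ _ fun w _ => ?_
          rw [enorm_jetSpace_rpow hp]
          exact Finset.single_le_sum (f := fun α => ‖hf.jet D J p β δ α‖ₑ ^ p.toReal)
            (fun _ _ => zero_le) (Finset.mem_univ _)

end Jet

variable (K l) in
/-- The space of functions of class `C^l` with compact support away from the singular set. -/
def admSubmodule : Submodule ℝ (E3 → ℝ) where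
  carrier := {f | K.IsAdm l f}
  zero_mem' := ⟨contDiff_const, HasCompactSupport.zero, by simp⟩
  add_mem' := by
    rintro f g ⟨hf, cf, df⟩ ⟨hg, cg, dg⟩
    exact ⟨hf.add hg, cf.add cg, (df.union_left dg).mono_left (tsupport_add f g)⟩
  smul_mem' := by
    rintro c f ⟨hf, cf, df⟩
    exact ⟨contDiff_const.smul hf, cf.smul_left (f := fun _ => c),
      df.mono_left (closure_mono (Function.support_const_smul_subset c f))⟩

lemma IsAdm.jet_eq_add_smul {f g h : E3 → ℝ} (hf : K.IsAdm l f) (hg : K.IsAdm l g)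
    (hh : K.IsAdm l h) {c : ℝ} (hfg : h = f + c • g) (D : Set E3) :
    hh.jet D J p β δ = hf.jet D J p β δ + c • hg.jet D J p β δ := by
  subst hfg
  refine PiLp.ext fun α => Lp.ext ((hh.coeFn_jet D α).trans ?_)
  rw [multiDeriv_lin_nat _ (contDiff_multiDeriv_of_le hf.1 α) (contDiff_multiDeriv_of_le hg.1 α)]
  refine Filter.EventuallyEq.symm ((Lp.coeFn_add _ _).trans ((hf.coeFn_jet D α).add ?_))
  exact (Lp.coeFn_smul _ _).trans ((hg.coeFn_jet D α).const_smul c)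

variable [Fact (1 ≤ p)]

instance completeSpace_W (D : Set E3) : CompleteSpace (K.W D J l p β δ) :=
  (Submodule.isClosed_topologicalClosure _).completeSpace_coe

variable (K J l p β δ) in
/-- The embedding of the admissible functions into the weighted Sobolev space on `D`. -/
def admToW (D : Set E3) : K.admSubmodule l →ₗ[ℝ] K.W D J l p β δ where
  toFun f := ⟨IsAdm.jet f.2 D J p β δ, IsAdm.jet_mem_W f.2 D⟩
  map_add' f g := Subtype.ext <| by
    have h := IsAdm.jet_eq_add_smul (J := J) (p := p) (β := β) (δ := δ) f.2 g.2 (f + g).2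
      (c := 1) (by rw [one_smul]; rfl) D
    rw [one_smul] at h
    exact h
  map_smul' c f := Subtype.ext <| by
    have h0 := IsAdm.jet_eq_add_smul (J := J) (p := p) (β := β) (δ := δ) f.2 f.2
      (0 : K.admSubmodule l).2 (c := -1) (by rw [neg_one_smul, add_neg_cancel]; rfl) D
    have h := IsAdm.jet_eq_add_smul (J := J) (p := p) (β := β) (δ := δ)
      (0 : K.admSubmodule l).2 f.2 (c • f).2 (c := c) (by rw [Submodule.coe_zero, zero_add]; rfl) D
    rw [h0, neg_one_smul, add_neg_cancel, zero_add] at h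
    exact h

lemma denseRange_admToW (D : Set E3) : DenseRange (K.admToW J l p β δ D) := by
  intro u
  rw [closure_subtype]
  refine closure_mono ?_ u.2
  rintro U ⟨φ, h1, h2, h3, h4⟩
  have hφ : K.IsAdm l φ := ⟨h1.of_le (by exact_mod_cast le_top), h2, h3⟩
  refine ⟨K.admToW J l p β δ D ⟨φ, hφ⟩, ⟨_, rfl⟩, ?_⟩
  exact PiLp.ext fun α => Lp.ext ((hφ.coeFn_jet D α).trans (h4 α).symm)

/-- An extension operator on the admissible functions extends by density to the weighted Sobolev
space. -/
theorem HasExtension.exists_continuousLinearMap (hp : p ≠ ⊤) {D : Set E3} (hD : IsOpen D)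
    (h : K.HasExtension J l p.toReal β δ D univ) :
    ∃ E : K.W D J l p β δ →L[ℝ] K.W univ J l p β δ,
      ∀ (u : K.W D J l p β δ) (α : MultiIdx l),
        ((E u : K.JetSpace univ J l p β δ) α : E3 → ℝ) =ᵐ[volume.restrict D]
          ((u : K.JetSpace D J l p β δ) α : E3 → ℝ) := by
  obtain ⟨T, hT, hTD, C, hC, hb⟩ := h
  obtain ⟨C', hC', hb'⟩ := exists_energy_le_enorm_jet hp K J l β δ D
  have h0 : 0 < p.toReal := ENNReal.toReal_pos (zero_lt_one.trans_le Fact.out).ne' hp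
  set e := K.admToW J l p β δ D with he
  set F : K.admSubmodule l →ₗ[ℝ] K.W univ J l p β δ :=
    K.admToW J l p β δ univ ∘ₗ T.restrict (p := K.admSubmodule l) (q := K.admSubmodule l) hT with hF
  have hbound : ∃ M : ℝ, ∀ f, ‖F f‖ ≤ M * ‖e f‖ := by
    set M : ℝ≥0∞ := Fintype.card (MultiIdx l) * (C * C') with hM
    have hMt : M ≠ ⊤ := ENNReal.mul_ne_top (by simp) (ENNReal.mul_ne_top hC hC')
    have hMr : M ^ (p.toReal)⁻¹ ≠ ⊤ := ENNReal.rpow_ne_top_of_nonneg (by positivity) hMt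
    refine ⟨(M ^ (p.toReal)⁻¹).toReal, fun f => ?_⟩
    have h1 : ‖F f‖ₑ ^ p.toReal ≤ M * ‖e f‖ₑ ^ p.toReal := by
      refine (IsAdm.enorm_jet_rpow_le hp (hT f f.2) univ).trans ?_
      rw [hM, mul_assoc]
      refine mul_le_mul_right ((hb f f.2).trans ?_) _
      rw [mul_assoc]
      exact mul_le_mul_right (hb' f f.2) _
    have h2 : ‖F f‖ₑ ≤ M ^ (p.toReal)⁻¹ * ‖e f‖ₑ := by
      rw [← ENNReal.rpow_le_rpow_iff h0, ENNReal.mul_rpow_of_nonneg _ _ h0.le, ← ENNReal.rpow_mul,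
        inv_mul_cancel₀ h0.ne', ENNReal.rpow_one]
      exact h1
    have h3 := ENNReal.toReal_mono (ENNReal.mul_ne_top hMr enorm_ne_top) h2
    rwa [ENNReal.toReal_mul, toReal_enorm, toReal_enorm] at h3
  have hdense : DenseRange e := denseRange_admToW D
  refine ⟨F.extendOfNorm e, fun u α => ?_⟩
  refine (absolutelyContinuous_weightedMeasure (K := K) (J := J) (l := l) (p := p) (β := β) (δ := δ)
    D α.order).ae_eq ?_
  have hrestr := weightedMeasure_univ_restrict (K := K) (J := J) (l := l) (p := p) (β := β) (δ := δ)
    hD.measurableSet α.order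
  refine hdense.induction_on u ?_ fun f => ?_
  · refine (isClosed_setOf_ae_eq_restrict hrestr).preimage (f := fun u : K.W D J l p β δ =>
      ((F.extendOfNorm e u : K.JetSpace univ J l p β δ) α, (u : K.JetSpace D J l p β δ) α)) ?_
    exact (((PiLp.continuous_apply p _ α).comp continuous_subtype_val).comp
      (F.extendOfNorm e).continuous).prodMk
      ((PiLp.continuous_apply p _ α).comp continuous_subtype_val)
  · rw [LinearMap.extendOfNorm_eq hdense hbound]
    have h1 : (((F f : K.W univ J l p β δ) : K.JetSpace univ J l p β δ) α : E3 → ℝ)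
        =ᵐ[K.weightedMeasure D J l p β δ α.order] multiDeriv α.toNat (T f) := by
      rw [hrestr]
      exact ae_restrict_of_ae (IsAdm.coeFn_jet (hT f f.2) univ α)
    refine h1.trans (Filter.EventuallyEq.trans ?_ (IsAdm.coeFn_jet f.2 D α).symm)
    have h2 : ∀ᵐ x ∂(K.weightedMeasure D J l p β δ α.order), x ∈ D := by
      rw [hrestr]
      exact ae_restrict_mem hD.measurableSet
    filter_upwards [h2] with x hx
    exact Set.EqOn.multiDeriv hD (hTD f f.2) α.toNat hx

end PolyhedralCone

end

theorem mainTheorem7 {n : ℕ} (K : PolyhedralCone n) (D : Set E3)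
    (hD : D = K.carrier ∨ ∃ R : ℝ, 0 < R ∧ D = K.carrier ∩ Metric.ball 0 R)
    (J : Finset (Fin n)) (l : ℕ) (p : ℝ≥0∞) [Fact (1 ≤ p)] (hp : p ≠ ⊤) (β : ℝ)
    (δ : Fin n → ℝ) (hδ : ∀ j, j ∉ J → -2 / p.toReal < δ j) :
    ∃ E : K.W D J l p β δ →L[ℝ] K.W univ J l p β δ,
      ∀ (u : K.W D J l p β δ) (α : MultiIdx l),
        ((E u : K.JetSpace univ J l p β δ) α : E3 → ℝ) =ᵐ[volume.restrict D]
          ((u : K.JetSpace D J l p β δ) α : E3 → ℝ) := by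
  have hq : 1 ≤ p.toReal := by
    rw [← ENNReal.toReal_one]
    exact ENNReal.toReal_mono hp Fact.out
  have hK := PolyhedralCone.hasExtension_carrier K J l hq β δ
  rcases hD with rfl | ⟨R, hR, rfl⟩
  · exact hK.exists_continuousLinearMap hp K.isOpen_carrier
  · exact ((PolyhedralCone.hasExtension_carrier_inter_ball K J l hq β δ hR).trans hK
      inter_subset_left).exists_continuousLinearMap hp
      (K.isOpen_carrier.inter Metric.isOpen_ball)
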